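/- **Setting.** Let $n,m\ge 1$, $p_1,\dots,p_n\ge 1$ be integers, $[n]=\{1,\dots,n\}$; norms are Euclidean, $\mathbb B^{p}$ and $\mathbb S^{p}$ are the unit ball and unit sphere of $\mathbb R^p$, vector inequalities are componentwise, $\mathcal P_K$ is the projection onto a closed convex set $K$, and $[\cdot]_+$ is the projection onto $\mathbb R^m_+$. *Graphs.* $\mathcal G_t=([n],\mathcal E_t)$, $t\ge1$, are directed graphs and $W_t\in\mathbb R^{n\times n}$ are mixing matrices with $[W_t]_{ij}>0$ if $(j,i)\in\mathcal E_t$ or $i=j$, and $[W_t]_{ij}=0$ otherwise. There are $w\in(0,1)$ and an integer $\iota>0$ such that for every $t\ge1$: every positive entry of $W_t$ is at least $w$; $W_t$ is doubly stochastic; the graph $([n],\bigcup_{l=0}^{\iota-1}\mathcal E_{t+l})$ is strongly connected. *Randomness.* The random vectors $u_{i,t}$ ($i\in[n]$, $t\ge1$) are independent, $u_{i,t}$ uniformly distributed on $\mathbb S^{p_i}$. Let $\mathcal U_{t-1}$ be the $\sigma$-algebra generated by the $u_{i,s}$ with $1\le s<t$. *Functions.* For each $i$ the set $\mathbb X_i\subseteq\mathbb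 R^{p_i}$ is closed and convex with $r_i\mathbb B^{p_i}\subseteq\mathbb X_i\subseteq R_i\mathbb B^{p_i}$, $r_i,R_i>0$. The loss functions $f_{i,t}:\mathbb X_i\to\mathbb R$ and constraint functions $g_{i,t}:\mathbb X_i\to\mathbb R^m$ are chosen by an adversary who may use the past of the game (for each $x$, $f_{i,t}(x)$ and $g_{i,t}(x)$ are $\mathcal U_{t-1}$-measurable; in particular they may be deterministic). The functions $f_{i,t}$ and $[g_{i,t}]_j$ are convex and differentiable on $\mathbb X_i$, and for constants $F_{f_i},F_{g_i},G_{f_i},G_{g_i}>0$ one has, for all $t\ge1$, $j\in[m]$, $x\in\mathbb X_i$, $|f_{i,t}(x)|\le F_{f_i}$, $|[g_{i,t}(x)]_j|\le F_{g_i}$, $\|\nabla f_{i,t}(x)\|\le G_{f_i}$, $\|\nabla[g_{i,t}(x)]_j\|\le G_{g_i}$. Put $\mathbb X=\prod_i\mathbb X_i$, $f_t(x)=\sum_i f_{i,t}(x_i)$, $g_t(x)=\sum_i g_{i,t}(x_i)$, and $\mathcal X_T=\{(y_1,\dots,y_T): y_t\in\mathbb X,\ g_t(y_t)\le 0,\ t=1,\dots,T\}$.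 It is assumed that there is a (non-random) static decision $y^0\in\mathbb X$ with $(y^0,\dots,y^0)\in\mathcal X_T$ almost surely. *Algorithm.* Let $\theta_1\in(0,1)$, $\theta_2\in(0,\theta_1/3)$, $\theta_3\in(\theta_2,(\theta_1-\theta_2)/2]$ and, for $t\ge 1$, $$\alpha_{i,t}=\frac{r_i^2}{4mp_i^2F_{g_i}^2t^{\theta_1}},\quad \beta_t=\frac{2}{t^{\theta_2}},\quad \gamma_t=\frac1{t^{1-\theta_2}},\quad \xi_t=\frac1{(t+1)^{\theta_3}},\quad \delta_{i,t}=\frac{r_i}{(t+1)^{\theta_3}}.$$ Start from $z_{i,1}\in(1-\xi_1)\mathbb X_i$ and $q_{i,1}=0$. The decision of agent $i$ at each time $t\ge1$ is $x_{i,t}=z_{i,t}+\delta_{i,t}u_{i,t}$, and for $t\ge 2$ $$\tilde q_{i,t}=\sum_{j=1}^n[W_{t-1}]_{ij}q_{j,t-1},\qquad a_{i,t}=\frac{p_i}{\delta_{i,t-1}}\Big(f_{i,t-1}(x_{i,t-1})+\tilde q_{i,t}^{\top}g_{i,t-1}(x_{i,t-1})\Big)u_{i,t-1},$$ $$z_{i,t}=\mathcal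 P_{(1-\xi_t)\mathbb X_i}\big(z_{i,t-1}-\alpha_{i,t}a_{i,t}\big),\qquad q_{i,t}=\big[(1-\beta_t\gamma_t)\tilde q_{i,t}+\gamma_t g_{i,t-1}(x_{i,t-1})\big]_+ .$$ **Theorem.** Let $T\ge1$. For every comparator sequence $y_T=(y_1,\dots,y_T)$ lying almost surely in $\mathcal X_T$, with $y_t$ being $\mathcal U_{t-1}$-measurable (for instance deterministic), $$\mathbf E\Big[\sum_{t=1}^Tf_t(x_t)-\sum_{t=1}^Tf_t(y_t)\Big]\le C_1T^{\max\{\theta_1,\,1-\theta_1+2\theta_3,\,1-\theta_3+\theta_2\}}+\max_{i\in[n]}\Big\{\frac{8mp_i^2F_{g_i}^2R_i}{r_i^2}\Big\}T^{\theta_1}\,\mathbf E[V(y_T)],$$ where $V(y_T)=\sum_{t=1}^{T-1}\sum_{i=1}^n\|y_{i,t+1}-y_{i,t}\|$, and $$\mathbf E\Big[\Big\|\Big[\sum_{t=1}^Tg_t(x_t)\Big]_+\Big\|\Big]\le\sqrt{C_2}\,T^{1-\theta_2/2}.$$ All these expectations are of integrable random variables. The constants are, with $F_g=\max_iF_{g_i}$,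 $\tau=(1-\frac{w}{2n^2})^{-2}$, $\lambda=(1-\frac{w}{2n^2})^{1/\iota}$ and $C_0=\frac{6mn^2F_g^2\tau}{1-\lambda}+2mnF_g^2$, $$C_1=\sum_{i=1}^n\Big(\frac{mF_gG_{g_i}(2r_i+R_i)}{1-\theta_3+\theta_2}+\frac{G_{f_i}(2r_i+R_i)}{1-\theta_3}+\frac{8mp_i^2F_{g_i}^2R_i^2}{r_i^2}+\frac{F_{f_i}^2}{4mF_{g_i}^2(1-\theta_1+2\theta_3)}+\frac{16mp_i^2F_{g_i}^2R_i^2}{r_i^2}\Big)+\frac{C_0}{\theta_2},$$ $$C_2=C_{2,1}\Big(2\sum_{i=1}^nF_{f_i}+C_1\Big),\qquad C_{2,1}=2n\Big(1+\max_{i\in[n]}\Big\{\frac{F_{f_i}^2}{F_{g_i}^2(1-\theta_1+2\theta_3)}\Big\}+\frac1{1-\theta_2}\Big).$$ -/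

import Mathlib

open MeasureTheory ProbabilityTheory
open scoped Pointwise

noncomputable section

namespace BanditOCO

/-- `ℝ^p` with the Euclidean norm. -/
abbrev Vec (p : ℕ) := EuclideanSpace ℝ (Fin p)

/-- The unit sphere of `ℝ^p`. -/
abbrev USphere (p : ℕ) := Metric.sphere (0 : Vec p) 1

/-- The uniform probability distribution on the unit sphere of `ℝ^p` (for `1 ≤ p`):
the normalized surface measure. -/
def uniformSphere (p : ℕ) : Measure (USphere p) :=
  ((volume : Measure (Vec p)).toSphere Set.univ)⁻¹ • (volume : Measure (Vec p)).toSphere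

/-- The projection onto `K`: a point of `K` nearest to `x` (it exists and is unique when `K` is
nonempty, closed and convex). -/
def proj {p : ℕ} (K : Set (Vec p)) (x : Vec p) : Vec p :=
  Classical.epsilon fun y => y ∈ K ∧ ∀ w ∈ K, ‖x - y‖ ≤ ‖x - w‖

/-- `[v]_+`, the projection onto the nonnegative orthant, which is the componentwise positive
part. -/
def posPart {m : ℕ} (v : Vec m) : Vec m := WithLp.toLp 2 fun j => max (v j) 0

/-- The one-point gradient estimator `(p / δ) f (x + δ u) u`. -/
def gradEst {p : ℕ} (δ : ℝ) (f : Vec p → ℝ) (x u : Vec p) : Vec p :=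
  ((p : ℝ) / δ * f (x + δ • u)) • u

/-! ### The communication graph -/

/-- The assumptions on the directed graphs `G t` (`(G t).Adj j i`: agent `i` receives data from
agent `j` at time `t`) and the mixing matrices `W t`, with constants `w` and `ι`. -/
structure GraphAssumption {n : ℕ} (G : ℕ → Digraph (Fin n)) (W : ℕ → Matrix (Fin n) (Fin n) ℝ)
    (w : ℝ) (ι : ℕ) : Prop where
  pos_of_edge : ∀ t, 1 ≤ t → ∀ i j, ((G t).Adj j i ∨ i = j) → 0 < W t i j
  zero_of_not_edge : ∀ t, 1 ≤ t → ∀ i j, ¬ ((G t).Adj j i ∨ i = j) → W t i j = 0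
  w_pos : 0 < w
  w_lt_one : w < 1
  weight_ge : ∀ t, 1 ≤ t → ∀ i j, 0 < W t i j → w ≤ W t i j
  col_sum : ∀ t, 1 ≤ t → ∀ j, ∑ i, W t i j = 1
  row_sum : ∀ t, 1 ≤ t → ∀ i, ∑ j, W t i j = 1
  ι_pos : 0 < ι
  /-- The union of any `ι` consecutive graphs is strongly connected. -/
  connected : ∀ t, 1 ≤ t → ∀ i j,
    Relation.ReflTransGen (fun a b => ∃ l < ι, (G (t + l)).Adj a b) i j

/-! ### Loss and constraint functions -/

/-- The constants attached to the agents: radii of the decision sets, and uniform bounds on the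
values and on the gradients of the loss and constraint functions. -/
structure Bounds (n : ℕ) where
  r : Fin n → ℝ
  R : Fin n → ℝ
  Ff : Fin n → ℝ
  Fg : Fin n → ℝ
  Gf : Fin n → ℝ
  Gg : Fin n → ℝ

/-- A real function on the set `X` that is convex, bounded by `F`, and differentiable with
gradient bounded by `G` (relative to `X`, which here always has nonempty interior). -/
structure NiceOn {p : ℕ} (X : Set (Vec p)) (h : Vec p → ℝ) (F G : ℝ) : Prop where
  convex : ConvexOn ℝ X h
  bounded : ∀ x ∈ X, |h x| ≤ F
  differentiable : DifferentiableOn ℝ h X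
  grad_bounded : ∀ x ∈ X, ‖fderivWithin ℝ h X x‖ ≤ G

/-- The assumptions on the decision sets `X i` and on one realization of the loss functions
`f i t` and constraint functions `g i t`, `t ≥ 1`. -/
structure FunctionAssumption {n m : ℕ} {p : Fin n → ℕ} (b : Bounds n) (X : ∀ i, Set (Vec (p i)))
    (f : ∀ i, ℕ → Vec (p i) → ℝ) (g : ∀ i, ℕ → Vec (p i) → Vec m) : Prop where
  r_pos : ∀ i, 0 < b.r i
  R_pos : ∀ i, 0 < b.R i
  Ff_pos : ∀ i, 0 < b.Ff i
  Fg_pos : ∀ i, 0 < b.Fg i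
  Gf_pos : ∀ i, 0 < b.Gf i
  Gg_pos : ∀ i, 0 < b.Gg i
  convex_set : ∀ i, Convex ℝ (X i)
  closed_set : ∀ i, IsClosed (X i)
  ball_subset : ∀ i, Metric.closedBall 0 (b.r i) ⊆ X i
  subset_ball : ∀ i, X i ⊆ Metric.closedBall 0 (b.R i)
  loss : ∀ i t, 1 ≤ t → NiceOn (X i) (f i t) (b.Ff i) (b.Gf i)
  constr : ∀ i t, 1 ≤ t → ∀ j, NiceOn (X i) (fun x => g i t x j) (b.Fg i) (b.Gg i)

/-- The set of feasible decision sequences over the rounds `1, …, T`. -/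
def feasibleSeqs {n m : ℕ} {p : Fin n → ℕ} (X : ∀ i, Set (Vec (p i)))
    (g : ∀ i, ℕ → Vec (p i) → Vec m) (T : ℕ) : Set (ℕ → ∀ i, Vec (p i)) :=
  {y | ∀ t ∈ Finset.Icc 1 T, (∀ i, y t i ∈ X i) ∧ ∀ j, (∑ i, g i t (y t i)) j ≤ 0}

/-- The regret of the decision sequence `x` with respect to `y` over `T` rounds. -/
def regret {n : ℕ} {p : Fin n → ℕ} (f : ∀ i, ℕ → Vec (p i) → ℝ) (T : ℕ)
    (x y : ℕ → ∀ i, Vec (p i)) : ℝ :=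
  ∑ t ∈ Finset.Icc 1 T, ∑ i, f i t (x t i) - ∑ t ∈ Finset.Icc 1 T, ∑ i, f i t (y t i)

/-- The constraint violation of the decision sequence `x` over `T` rounds. -/
def violation {n m : ℕ} {p : Fin n → ℕ} (g : ∀ i, ℕ → Vec (p i) → Vec m) (T : ℕ)
    (x : ℕ → ∀ i, Vec (p i)) : ℝ :=
  ‖posPart (∑ t ∈ Finset.Icc 1 T, ∑ i, g i t (x t i))‖

/-- The path length of the sequence `y` over `T` rounds. -/
def pathLength {n : ℕ} {p : Fin n → ℕ} (T : ℕ) (y : ℕ → ∀ i, Vec (p i)) : ℝ :=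
  ∑ t ∈ Finset.Icc 1 (T - 1), ∑ i, ‖y (t + 1) i - y t i‖

/-! ### The algorithm -/

/-- The step sizes, shrinkage coefficients and exploration parameters. -/
structure Params (n : ℕ) where
  α : Fin n → ℕ → ℝ
  β : Fin n → ℕ → ℝ
  γ : Fin n → ℕ → ℝ
  ξ : Fin n → ℕ → ℝ
  δ : Fin n → ℕ → ℝ

/-- The variables that the agents carry from one round to the next. -/
structure State (n m : ℕ) (p : Fin n → ℕ) where
  z : ∀ i, Vec (p i)
  q : Fin n → Vec m

/-- One iteration: the state at time `t + 1`, computed from the state `s` at time `t`, the mixing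
matrix `W`, loss functions `f`, constraint functions `g` and directions `u` of time `t`. -/
def step {n m : ℕ} {p : Fin n → ℕ} (c : Params n) (X : ∀ i, Set (Vec (p i)))
    (W : Matrix (Fin n) (Fin n) ℝ) (f : ∀ i, Vec (p i) → ℝ) (g : ∀ i, Vec (p i) → Vec m)
    (u : ∀ i, Vec (p i)) (t : ℕ) (s : State n m p) : State n m p :=
  let qt : Fin n → Vec m := fun i => ∑ j, W i j • s.q j
  let x : ∀ i, Vec (p i) := fun i => s.z i + c.δ i t • u i
  let a : ∀ i, Vec (p i) := fun i =>
    gradEst (c.δ i t) (f i) (s.z i) (u i)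
      + ∑ k, qt i k • gradEst (c.δ i t) (fun v => g i v k) (s.z i) (u i)
  { z := fun i => proj ((1 - c.ξ i (t + 1)) • X i) (s.z i - c.α i (t + 1) • a i)
    q := fun i => posPart ((1 - c.β i (t + 1) * c.γ i (t + 1)) • qt i
      + c.γ i (t + 1) • g i (x i)) }

/-- The state at time `t ≥ 1`, started at time `1` from `z1` and zero dual variables
(the value at `t = 0` is a placeholder). -/
def run {n m : ℕ} {p : Fin n → ℕ} (c : Params n) (X : ∀ i, Set (Vec (p i)))
    (W : ℕ → Matrix (Fin n) (Fin n) ℝ) (f : ∀ i, ℕ → Vec (p i) → ℝ)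
    (g : ∀ i, ℕ → Vec (p i) → Vec m) (u : ∀ i, ℕ → Vec (p i)) (z1 : ∀ i, Vec (p i)) :
    ℕ → State n m p
  | 0 => ⟨z1, fun _ => 0⟩
  | 1 => ⟨z1, fun _ => 0⟩
  | t + 2 => step c X (W (t + 1)) (fun i => f i (t + 1)) (fun i => g i (t + 1))
      (fun i => u i (t + 1)) (t + 1) (run c X W f g u z1 (t + 1))

/-- The decisions `x_{i,t} = z_{i,t} + δ_{i,t} u_{i,t}`. -/
def decision {n m : ℕ} {p : Fin n → ℕ} (c : Params n) (X : ∀ i, Set (Vec (p i)))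
    (W : ℕ → Matrix (Fin n) (Fin n) ℝ) (f : ∀ i, ℕ → Vec (p i) → ℝ)
    (g : ∀ i, ℕ → Vec (p i) → Vec m) (u : ∀ i, ℕ → Vec (p i)) (z1 : ∀ i, Vec (p i))
    (t : ℕ) (i : Fin n) : Vec (p i) :=
  (run c X W f g u z1 t).z i + c.δ i t • u i t

/-- The information available before round `t`: the σ-algebra generated by the directions
`u_{i,s}` with `1 ≤ s < t`. -/
@[reducible] def past {Ω : Type*} {n : ℕ} {p : Fin n → ℕ} (u : ∀ i, ℕ → Ω → USphere (p i)) (t : ℕ) :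
    MeasurableSpace Ω :=
  ⨆ (i : Fin n) (s : ℕ) (_ : 1 ≤ s ∧ s < t), MeasurableSpace.comap (u i s) inferInstance

/-! ### The parameters and the constants of the bounds -/

/-- The step sizes, shrinkage coefficients and exploration parameters with exponents `θ₁, θ₂, θ₃`. -/
def params {n : ℕ} (m : ℕ) (p : Fin n → ℕ) (b : Bounds n) (θ₁ θ₂ θ₃ : ℝ) : Params n where
  α i t := b.r i ^ 2 / (4 * m * (p i : ℝ) ^ 2 * b.Fg i ^ 2 * (t : ℝ) ^ θ₁)
  β _ t := 2 / (t : ℝ) ^ θ₂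
  γ _ t := 1 / (t : ℝ) ^ (1 - θ₂)
  ξ _ t := 1 / ((t : ℝ) + 1) ^ θ₃
  δ i t := b.r i / ((t : ℝ) + 1) ^ θ₃

/-- `F_g = max_i F_{g_i}`. -/
def FgMax {n : ℕ} (b : Bounds n) : ℝ := ⨆ i, b.Fg i

def tauConst (n : ℕ) (w : ℝ) : ℝ := ((1 - w / (2 * (n : ℝ) ^ 2)) ^ 2)⁻¹

def lambdaConst (n : ℕ) (w : ℝ) (ι : ℕ) : ℝ := (1 - w / (2 * (n : ℝ) ^ 2)) ^ (1 / (ι : ℝ))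

def C0 {n : ℕ} (m : ℕ) (b : Bounds n) (w : ℝ) (ι : ℕ) : ℝ :=
  6 * m * (n : ℝ) ^ 2 * FgMax b ^ 2 * tauConst n w / (1 - lambdaConst n w ι)
    + 2 * m * n * FgMax b ^ 2

def C1 {n : ℕ} (m : ℕ) (p : Fin n → ℕ) (b : Bounds n) (w : ℝ) (ι : ℕ) (θ₁ θ₂ θ₃ : ℝ) : ℝ :=
  ∑ i, (m * FgMax b * b.Gg i * (2 * b.r i + b.R i) / (1 - θ₃ + θ₂)
      + b.Gf i * (2 * b.r i + b.R i) / (1 - θ₃)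
      + 8 * m * (p i : ℝ) ^ 2 * b.Fg i ^ 2 * b.R i ^ 2 / b.r i ^ 2
      + b.Ff i ^ 2 / (4 * m * b.Fg i ^ 2 * (1 - θ₁ + 2 * θ₃))
      + 16 * m * (p i : ℝ) ^ 2 * b.Fg i ^ 2 * b.R i ^ 2 / b.r i ^ 2)
    + C0 m b w ι / θ₂

def C21 {n : ℕ} (b : Bounds n) (θ₁ θ₂ θ₃ : ℝ) : ℝ :=
  2 * n * (1 + (⨆ i, b.Ff i ^ 2 / (b.Fg i ^ 2 * (1 - θ₁ + 2 * θ₃))) + 1 / (1 - θ₂))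

def C2 {n : ℕ} (m : ℕ) (p : Fin n → ℕ) (b : Bounds n) (w : ℝ) (ι : ℕ) (θ₁ θ₂ θ₃ : ℝ) : ℝ :=
  C21 b θ₁ θ₂ θ₃ * (2 * ∑ i, b.Ff i + C1 m p b w ι θ₁ θ₂ θ₃)

/-- The coefficient of the path length. -/
def pathCoeff {n : ℕ} (m : ℕ) (p : Fin n → ℕ) (b : Bounds n) : ℝ :=
  ⨆ i, 8 * m * (p i : ℝ) ^ 2 * b.Fg i ^ 2 * b.R i / b.r i ^ 2

end BanditOCO

end

/-!
The proof separates a deterministic inequality, valid along every realization of the game, from the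
only probabilistic fact that is needed.

*Pathwise.* Adding up the Lagrangians `f + ∑ k, qt_k * g_k` of all agents and rounds, with `qt` the
mixed dual variables, gives three contributions.
The projected gradient steps bound the linearized Lagrangian, in terms of the second moments of the
gradient estimators and of the path length of the comparator (`primal_regret_le`,
`IsPlay.sum_inner_le`).
The dual variables perform a regularized gradient ascent with mixing, which is contractive in the
Euclidean norm; this compares `qt` with an arbitrary constant vector `c ≥ 0` of multipliers
(`DualIteration.regret_le`), and the regularization absorbs the part of the second moments that is
quadratic in `qt`.
Finally, a feasible comparator satisfies the sum of the local constraints but not each of them, so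
the terms `qt_k * g_k (y)` are only nonpositive up to the disagreement between the agents' dual
variables. By strong connectivity of `ι` consecutive graphs this disagreement is contracted over
every window (`GraphAssumption.norm_disagreement_window`): if all values are split by a large gap,
some agent has to average over values from both sides of it, and the squared disagreement drops by
the variances of the averaged values.
The result is `IsPlay.regret_add_le`: the regret plus `∑ k, c k * ∑ t, g_k` is at most the claimed
bound plus a multiple of `∑ k, c k ^ 2` plus `totalExcess`, the sum of the differences between the
actual loss (or weighted constraint value) and its linearization with the one-point gradient
estimator.

*In expectation.* Given the past, the direction of a round is uniform on the sphere, so each excess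
has nonpositive expectation (`le_integral_inner_gradEst`, `integral_mul_excess_nonpos`). Instead of
differentiating a smoothed function, the expectation of the estimator along `e = z - y` is
symmetrized with the reflection in the hyperplane orthogonal to `e`, which turns it into an average
of increments of the convex function along `e`, with weights whose mean is known because the
distribution is isotropic.

The choice `c = 0` gives the regret bound. For the violation the comparator is static and `c` is a
small multiple of the positive part of the accumulated constraint values. This bounds the expected
*squared* violation (`IsPlay.sq_violation_le`), and hence the expected violation.
-/

namespace BanditOCO

/-! ### Disagreement and mixing -/

/-- The average of the entries of `x`. -/
noncomputable def avg {n : ℕ} (x : Fin n → ℝ) : ℝ := (∑ i, x i) / n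

/-- The vector of deviations of the entries of `x` from their average; its Euclidean norm measures
the disagreement between the agents. -/
noncomputable def disagreement {n : ℕ} (x : Fin n → ℝ) : Vec n :=
  WithLp.toLp 2 fun i => x i - avg x

section Mixing

variable {n : ℕ}

lemma norm_sq_disagreement (x : Fin n → ℝ) :
    ‖disagreement x‖ ^ 2 = ∑ i, (x i - avg x) ^ 2 := by
  rw [EuclideanSpace.real_norm_sq_eq]
  rfl

lemma sum_sub_avg (hn : 0 < n) (x : Fin n → ℝ) : ∑ i, (x i - avg x) = 0 := by
  have : (n : ℝ) ≠ 0 := by positivity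
  simp only [Finset.sum_sub_distrib, avg, Finset.sum_const, Finset.card_univ, Fintype.card_fin,
    nsmul_eq_mul]
  field_simp
  ring

lemma norm_sq_disagreement_eq (hn : 0 < n) (x : Fin n → ℝ) :
    ‖disagreement x‖ ^ 2 = ∑ i, x i ^ 2 - n * avg x ^ 2 := by
  have h := sum_sub_avg hn x
  rw [norm_sq_disagreement]
  have : ∀ i, (x i - avg x) ^ 2 = x i ^ 2 - avg x ^ 2 - 2 * avg x * (x i - avg x) := by
    intro i; ring
  simp only [this, Finset.sum_sub_distrib, ← Finset.mul_sum, Finset.sum_const, Finset.card_univ,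
    Fintype.card_fin, nsmul_eq_mul]
  rw [Finset.sum_sub_distrib] at h
  simp only [Finset.sum_const, Finset.card_univ, Fintype.card_fin, nsmul_eq_mul] at h
  rw [h]; ring

lemma disagreement_add (x y : Fin n → ℝ) :
    disagreement (x + y) = disagreement x + disagreement y := by
  ext i
  simp only [disagreement, avg, Pi.add_apply, PiLp.add_apply, Finset.sum_add_distrib]
  ring

lemma disagreement_zero : disagreement (0 : Fin n → ℝ) = 0 := by
  ext i
  simp [disagreement, avg]

lemma norm_disagreement_le (hn : 0 < n) {x : Fin n → ℝ} {C : ℝ} (hx : ∀ i, |x i| ≤ C) :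
    ‖disagreement x‖ ≤ √n * C := by
  have hC : 0 ≤ C := (abs_nonneg _).trans (hx ⟨0, hn⟩)
  refine abs_le_of_sq_le_sq' ?_ (by positivity) |>.2
  rw [norm_sq_disagreement_eq hn, mul_pow, Real.sq_sqrt (by positivity)]
  have h1 : ∑ i, x i ^ 2 ≤ ∑ _i : Fin n, C ^ 2 :=
    Finset.sum_le_sum fun i _ => sq_le_sq' (by linarith [(abs_le.1 (hx i)).1]) (abs_le.1 (hx i)).2
  simp only [Finset.sum_const, Finset.card_univ, Fintype.card_fin, nsmul_eq_mul] at h1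
  have : 0 ≤ (n : ℝ) * avg x ^ 2 := by positivity
  linarith

lemma sum_abs_sub_avg_le (x : Fin n → ℝ) :
    ∑ i, |x i - avg x| ≤ √n * ‖disagreement x‖ := by
  refine abs_le_of_sq_le_sq' ?_ (by positivity) |>.2
  rw [mul_pow, Real.sq_sqrt (by positivity), norm_sq_disagreement]
  have := sq_sum_le_card_mul_sum_sq (s := (Finset.univ : Finset (Fin n)))
    (f := fun i => |x i - avg x|)
  simpa using this

/-- A probability vector that puts weight at least `ω` on both sides of a gap of size `g` has
variance at least `ω / 2 * g ^ 2`. -/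
lemma half_mul_sq_le_variance {v x : Fin n → ℝ} (hv : ∀ j, 0 ≤ v j) (hv1 : ∑ j, v j = 1)
    {S : Fin n → Prop} {c g ω : ℝ} (hg : 0 ≤ g) (hω : 0 ≤ ω)
    (hS : ∀ j, S j → c + g ≤ x j) (hS' : ∀ j, ¬ S j → x j ≤ c)
    {j₁ j₂ : Fin n} (h₁ : S j₁) (h₂ : ¬ S j₂) (hw₁ : ω ≤ v j₁) (hw₂ : ω ≤ v j₂) :
    ω / 2 * g ^ 2 ≤ ∑ j, v j * x j ^ 2 - (∑ j, v j * x j) ^ 2 := by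
  classical
  let χ : Fin n → ℝ := fun j => if S j then 1 else 0
  set a := ∑ j, v j * χ j with ha
  have hpair : ∀ i j, v i * v j * ((χ i * (1 - χ j) + (1 - χ i) * χ j) * g ^ 2) ≤
      v i * v j * (x i - x j) ^ 2 := by
    intro i j
    refine mul_le_mul_of_nonneg_left ?_ (mul_nonneg (hv i) (hv j))
    by_cases hi : S i <;> by_cases hj : S j <;> simp only [χ, hi, hj, if_true, if_false]
    · nlinarith [sq_nonneg (x i - x j)]
    · nlinarith [hS i hi, hS' j hj]
    · nlinarith [hS j hj, hS' i hi]
    · nlinarith [sq_nonneg (x i - x j)]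
  have hsum := Finset.sum_le_sum fun i (_ : i ∈ Finset.univ) =>
    Finset.sum_le_sum fun j (_ : j ∈ Finset.univ) => hpair i j
  have hL : ∑ i, ∑ j, v i * v j * ((χ i * (1 - χ j) + (1 - χ i) * χ j) * g ^ 2)
      = 2 * (a * (1 - a)) * g ^ 2 := by
    have : ∀ i j, v i * v j * ((χ i * (1 - χ j) + (1 - χ i) * χ j) * g ^ 2)
        = (v i * χ i) * (g ^ 2 * v j) - (v i * χ i) * (2 * g ^ 2 * (v j * χ j))
          + (g ^ 2 * v i) * (v j * χ j) := by intros; ring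
    simp only [this, Finset.sum_add_distrib, Finset.sum_sub_distrib, ← Finset.mul_sum,
      ← Finset.sum_mul, hv1, ← ha]
    ring
  have hR : ∑ i, ∑ j, v i * v j * (x i - x j) ^ 2
      = 2 * (∑ j, v j * x j ^ 2 - (∑ j, v j * x j) ^ 2) := by
    have : ∀ i j, v i * v j * (x i - x j) ^ 2
        = (v i * x i ^ 2) * v j - (v i * x i) * (2 * (v j * x j)) + v i * (v j * x j ^ 2) := by
      intros; ring
    simp only [this, Finset.sum_add_distrib, Finset.sum_sub_distrib, ← Finset.mul_sum,
      ← Finset.sum_mul, hv1]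
    ring
  rw [hL, hR] at hsum
  have ha₁ : ω ≤ a := by
    refine le_trans ?_ (Finset.single_le_sum (f := fun j => v j * χ j) (fun j _ => ?_)
      (Finset.mem_univ j₁))
    · simpa [χ, h₁] using hw₁
    · dsimp only [χ]; split_ifs <;> simp [hv j]
  have ha₂ : ω ≤ 1 - a := by
    have : 1 - a = ∑ j, v j * (1 - χ j) := by
      simp only [mul_sub, mul_one, Finset.sum_sub_distrib, hv1, ha]
    rw [this]
    refine le_trans ?_ (Finset.single_le_sum (f := fun j => v j * (1 - χ j)) (fun j _ => ?_)
      (Finset.mem_univ j₂))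
    · simpa [χ, h₂] using hw₂
    · dsimp only [χ]; split_ifs <;> simp [hv j]
  have hprod : ω / 2 ≤ a * (1 - a) := by
    rcases le_total a (1 / 2) with h | h <;> nlinarith
  nlinarith [sq_nonneg g]

lemma weighted_variance_nonneg {v x : Fin n → ℝ} (hv : ∀ j, 0 ≤ v j) (hv1 : ∑ j, v j = 1) :
    0 ≤ ∑ j, v j * x j ^ 2 - (∑ j, v j * x j) ^ 2 := by
  have h : 0 ≤ ∑ j, v j * (x j - ∑ i, v i * x i) ^ 2 :=
    Finset.sum_nonneg fun j _ => mul_nonneg (hv j) (sq_nonneg _)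
  have h2 : ∀ j, v j * (x j - ∑ i, v i * x i) ^ 2 = v j * x j ^ 2
      - 2 * (∑ i, v i * x i) * (v j * x j) + (∑ i, v i * x i) ^ 2 * v j := by intro j; ring
  simp only [h2, Finset.sum_add_distrib, Finset.sum_sub_distrib, ← Finset.mul_sum, hv1] at h
  linarith

variable {W : Matrix (Fin n) (Fin n) ℝ}

lemma avg_mulVec (hW : W ∈ doublyStochastic ℝ (Fin n)) (x : Fin n → ℝ) :
    avg (W.mulVec x) = avg x := by
  obtain ⟨-, -, hc⟩ := mem_doublyStochastic_iff_sum.1 hW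
  simp only [avg, Matrix.mulVec, dotProduct]
  rw [Finset.sum_comm]
  simp only [← Finset.sum_mul, hc, one_mul]

/-- Mixing decreases the squared disagreement by the sum of the variances of the rows. -/
lemma norm_sq_disagreement_sub_mulVec (hn : 0 < n) (hW : W ∈ doublyStochastic ℝ (Fin n))
    (x : Fin n → ℝ) :
    ‖disagreement x‖ ^ 2 - ‖disagreement (W.mulVec x)‖ ^ 2
      = ∑ k, (∑ j, W k j * x j ^ 2 - (∑ j, W k j * x j) ^ 2) := by
  rw [norm_sq_disagreement_eq hn, norm_sq_disagreement_eq hn, avg_mulVec hW]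
  obtain ⟨-, -, hc⟩ := mem_doublyStochastic_iff_sum.1 hW
  rw [Finset.sum_sub_distrib, Finset.sum_comm]
  simp only [← Finset.sum_mul, hc, one_mul, Matrix.mulVec, dotProduct]
  ring

lemma norm_disagreement_mulVec_le (hn : 0 < n) (hW : W ∈ doublyStochastic ℝ (Fin n))
    (x : Fin n → ℝ) : ‖disagreement (W.mulVec x)‖ ≤ ‖disagreement x‖ := by
  obtain ⟨h0, hr, -⟩ := mem_doublyStochastic_iff_sum.1 hW
  have h := norm_sq_disagreement_sub_mulVec hn hW x
  have h2 : 0 ≤ ∑ k, (∑ j, W k j * x j ^ 2 - (∑ j, W k j * x j) ^ 2) :=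
    Finset.sum_nonneg fun k _ => weighted_variance_nonneg (h0 k) (hr k)
  exact abs_le_of_sq_le_sq' (by linarith) (norm_nonneg _) |>.2

/-- Some gap between consecutive values of `x` is at least a fraction `1 / n` of the range of `x`,
so that its square is at least a fraction `1 / n ^ 3` of the squared disagreement. -/
lemma exists_gap (hn : 0 < n) (x : Fin n → ℝ) (hx : 0 < ‖disagreement x‖) :
    ∃ (S : Fin n → Prop) (c g : ℝ), 0 ≤ g ∧ (∃ i, S i) ∧ (∃ i, ¬ S i) ∧
      (∀ i, S i → c + g ≤ x i) ∧ (∀ i, ¬ S i → x i ≤ c) ∧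
      ‖disagreement x‖ ^ 2 ≤ n ^ 3 * g ^ 2 := by
  have : Nonempty (Fin n) := ⟨⟨0, hn⟩⟩
  obtain ⟨lo, hlo⟩ := Finite.exists_min x
  obtain ⟨hi, hhi⟩ := Finite.exists_max x
  have hn' : (0 : ℝ) < n := by positivity
  set g := (x hi - x lo) / n with hg
  have hgn : n * g = x hi - x lo := by rw [hg]; field_simp
  have havg1 : x lo ≤ avg x := by
    rw [avg, le_div_iff₀ hn']
    have := Finset.sum_le_sum fun i (_ : i ∈ Finset.univ) => hlo i
    simp at this
    linarith
  have havg2 : avg x ≤ x hi := by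
    rw [avg, div_le_iff₀ hn']
    have := Finset.sum_le_sum fun i (_ : i ∈ Finset.univ) => hhi i
    simp at this
    linarith
  have hV : ‖disagreement x‖ ^ 2 ≤ n ^ 3 * g ^ 2 := by
    rw [norm_sq_disagreement]
    calc ∑ i, (x i - avg x) ^ 2 ≤ ∑ _i : Fin n, (n * g) ^ 2 := by
          refine Finset.sum_le_sum fun i _ => sq_le_sq' ?_ ?_
          · linarith [hlo i]
          · linarith [hhi i]
      _ = n ^ 3 * g ^ 2 := by simp; ring
  have hg0 : 0 < g := by
    have h0 : 0 ≤ g := div_nonneg (sub_nonneg.2 (hlo hi)) hn'.le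
    refine lt_of_le_of_ne h0 fun h => ?_
    have : 0 < ‖disagreement x‖ ^ 2 := by positivity
    rw [← h] at hV
    norm_num at hV
    simp [hV] at hx
  -- the cell of width `g` that contains `x i`; of the `n + 1` possible cells one is empty
  let φ : Fin n → ℕ := fun i => ⌊(x i - x lo) / g⌋₊
  have hφhi : φ hi = n := by
    simp only [φ, ← hgn]
    rw [mul_div_assoc, div_self hg0.ne', mul_one, Nat.floor_natCast]
  obtain ⟨k, hk, hk'⟩ : ∃ k ∈ Finset.range (n + 1), k ∉ Finset.univ.image φ := by
    by_contra! h
    have := Finset.card_le_card (show Finset.range (n + 1) ⊆ Finset.univ.image φ from h)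
    have h2 := Finset.card_image_le (s := (Finset.univ : Finset (Fin n))) (f := φ)
    simp at this h2
    omega
  have hne : ∀ i, φ i ≠ k := by simpa using hk'
  refine ⟨fun i => k < φ i, x lo + k * g, g, hg0.le, ⟨hi, ?_⟩, ⟨lo, ?_⟩, ?_, ?_, hV⟩
  · have := hne hi
    simp at hk
    omega
  · simp [φ]
  · intro i hi
    have : ((k + 1 : ℕ) : ℝ) ≤ (x i - x lo) / g :=
      (Nat.le_floor_iff (div_nonneg (sub_nonneg.2 (hlo i)) hg0.le)).1 hi
    rw [le_div_iff₀ hg0] at this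
    push_cast at this
    linarith
  · intro i hi
    have h1 : φ i < k := lt_of_le_of_ne (not_lt.1 hi) (hne i)
    have : (x i - x lo) / g < k := (Nat.floor_lt (div_nonneg (sub_nonneg.2 (hlo i)) hg0.le)).1 h1
    rw [div_lt_iff₀ hg0] at this
    linarith

/-- If a matrix does not mix across the gap, the gap persists. -/
lemma gap_mulVec (hW : W ∈ doublyStochastic ℝ (Fin n)) {x : Fin n → ℝ} {S : Fin n → Prop}
    {c d : ℝ} (hS : ∀ i, S i → d ≤ x i) (hS' : ∀ i, ¬ S i → x i ≤ c)
    (hcross : ∀ k j, W k j ≠ 0 → (S k ↔ S j)) :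
    (∀ i, S i → d ≤ W.mulVec x i) ∧ (∀ i, ¬ S i → W.mulVec x i ≤ c) := by
  obtain ⟨h0, hr, -⟩ := mem_doublyStochastic_iff_sum.1 hW
  constructor
  · intro i hi
    calc d = ∑ j, W i j * d := by rw [← Finset.sum_mul, hr, one_mul]
      _ ≤ ∑ j, W i j * x j := Finset.sum_le_sum fun j _ => by
          by_cases h : W i j = 0
          · simp [h]
          · exact mul_le_mul_of_nonneg_left (hS j ((hcross i j h).1 hi)) (h0 i j)
  · intro i hi
    calc ∑ j, W i j * x j ≤ ∑ j, W i j * c := Finset.sum_le_sum fun j _ => by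
          by_cases h : W i j = 0
          · simp [h]
          · exact mul_le_mul_of_nonneg_left (hS' j (fun hj => hi ((hcross i j h).2 hj))) (h0 i j)
      _ = c := by rw [← Finset.sum_mul, hr, one_mul]

/-- Mixing across the gap decreases the squared disagreement by `w / 2 * g ^ 2`. -/
lemma decrease_of_crossing (hn : 0 < n) (hW : W ∈ doublyStochastic ℝ (Fin n)) {w : ℝ}
    (hw : 0 ≤ w) (hdiag : ∀ i, w ≤ W i i) (hpos : ∀ i j, W i j ≠ 0 → w ≤ W i j)
    {x : Fin n → ℝ} {S : Fin n → Prop} {c g : ℝ} (hg : 0 ≤ g)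
    (hS : ∀ i, S i → c + g ≤ x i) (hS' : ∀ i, ¬ S i → x i ≤ c)
    {k j : Fin n} (hkj : W k j ≠ 0) (hcross : ¬ (S k ↔ S j)) :
    ‖disagreement (W.mulVec x)‖ ^ 2 ≤ ‖disagreement x‖ ^ 2 - w / 2 * g ^ 2 := by
  obtain ⟨h0, hr, -⟩ := mem_doublyStochastic_iff_sum.1 hW
  have h := norm_sq_disagreement_sub_mulVec hn hW x
  have h1 : w / 2 * g ^ 2 ≤ ∑ j, W k j * x j ^ 2 - (∑ j, W k j * x j) ^ 2 := by
    by_cases hk : S k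
    · have hj : ¬ S j := fun hj => hcross (iff_of_true hk hj)
      exact half_mul_sq_le_variance (h0 k) (hr k) hg hw hS hS' hk hj (hdiag k) (hpos k j hkj)
    · have hj : S j := by
        by_contra hj
        exact hcross (iff_of_false hk hj)
      exact half_mul_sq_le_variance (h0 k) (hr k) hg hw hS hS' hj hk (hpos k j hkj) (hdiag k)
  have h2 := Finset.single_le_sum
    (f := fun k => ∑ j, W k j * x j ^ 2 - (∑ j, W k j * x j) ^ 2)
    (fun k _ => weighted_variance_nonneg (h0 k) (hr k)) (Finset.mem_univ k)
  linarith

end Mixing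

/-! ### Contraction of the disagreement over connected windows -/

section Graph

variable {n : ℕ} {G : ℕ → Digraph (Fin n)} {W : ℕ → Matrix (Fin n) (Fin n) ℝ} {w : ℝ} {ι : ℕ}

lemma GraphAssumption.doublyStochastic (hG : GraphAssumption G W w ι) {t : ℕ} (ht : 1 ≤ t) :
    W t ∈ doublyStochastic ℝ (Fin n) := by
  refine mem_doublyStochastic_iff_sum.2 ⟨fun i j => ?_, hG.row_sum t ht, hG.col_sum t ht⟩
  by_cases h : (G t).Adj j i ∨ i = j
  · exact (hG.pos_of_edge t ht i j h).le
  · exact (hG.zero_of_not_edge t ht i j h).ge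

/-- The values at time `t + k` when `x` is mixed from time `t` on. -/
def mixed (W : ℕ → Matrix (Fin n) (Fin n) ℝ) (t : ℕ) (x : Fin n → ℝ) : ℕ → Fin n → ℝ
  | 0 => x
  | k + 1 => (W (t + k)).mulVec (mixed W t x k)

lemma mixed_add (t : ℕ) (x : Fin n → ℝ) (k l : ℕ) :
    mixed W t x (k + l) = mixed W (t + k) (mixed W t x k) l := by
  induction l with
  | zero => rfl
  | succ l ih => rw [← add_assoc, mixed, ih, mixed, add_assoc]

lemma GraphAssumption.norm_disagreement_mixed_mono (hG : GraphAssumption G W w ι) (hn : 0 < n)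
    {t : ℕ} (ht : 1 ≤ t) (x : Fin n → ℝ) {j k : ℕ} (hjk : j ≤ k) :
    ‖disagreement (mixed W t x k)‖ ≤ ‖disagreement (mixed W t x j)‖ :=
  antitone_nat_of_succ_le (f := fun k => ‖disagreement (mixed W t x k)‖)
    (fun _ => norm_disagreement_mulVec_le hn (hG.doublyStochastic (by omega)) _) hjk

/-- Over `ι` rounds some agents on different sides of a large gap exchange data, which contracts
the disagreement. -/
lemma GraphAssumption.norm_disagreement_window (hG : GraphAssumption G W w ι) (hn : 0 < n)
    {t : ℕ} (ht : 1 ≤ t) (x : Fin n → ℝ) :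
    ‖disagreement (mixed W t x ι)‖ ≤ (1 - w / (4 * n ^ 3)) * ‖disagreement x‖ := by
  have hn' : (1 : ℝ) ≤ n := by exact_mod_cast hn
  have hn3 : (1 : ℝ) ≤ n ^ 3 := one_le_pow₀ hn'
  have hw0 := hG.w_pos
  have hw1 := hG.w_lt_one
  have hmono : ∀ {j k : ℕ}, j ≤ k →
      ‖disagreement (mixed W t x k)‖ ≤ ‖disagreement (mixed W t x j)‖ :=
    hG.norm_disagreement_mixed_mono hn ht x
  have hmixed : mixed W t x 0 = x := rfl
  have hρ : 0 ≤ 1 - w / (4 * n ^ 3) := by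
    rw [sub_nonneg, div_le_one (by positivity)]
    linarith
  rcases (norm_nonneg (disagreement x)).eq_or_lt with hx | hx
  · have h : ‖disagreement (mixed W t x ι)‖ ≤ ‖disagreement x‖ := by
      simpa only [hmixed] using hmono (Nat.zero_le ι)
    rw [← hx] at h ⊢
    rwa [mul_zero]
  obtain ⟨S, c, g, hg, ⟨a, ha⟩, ⟨b, hb⟩, hS, hS', hV⟩ := exists_gap hn x hx
  have hdiag : ∀ s, 1 ≤ s → ∀ i, w ≤ W s i i := fun s hs i =>
    hG.weight_ge s hs i i (hG.pos_of_edge s hs i i (Or.inr rfl))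
  have hpos : ∀ s, 1 ≤ s → ∀ i j, W s i j ≠ 0 → w ≤ W s i j := fun s hs i j h =>
    hG.weight_ge s hs i j (lt_of_le_of_ne
      ((mem_doublyStochastic_iff_sum.1 (hG.doublyStochastic hs)).1 i j) (Ne.symm h))
  have hex : ∃ l, l < ι ∧ ∃ k j, W (t + l) k j ≠ 0 ∧ ¬ (S k ↔ S j) := by
    by_contra! hno
    have : ∀ i, Relation.ReflTransGen (fun a b => ∃ l < ι, (G (t + l)).Adj a b) a i → S i := by
      intro i hi
      induction hi with
      | refl => exact ha
      | tail _ h2 ih =>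
        obtain ⟨l, hl, hadj⟩ := h2
        exact (hno l hl _ _ (hG.pos_of_edge (t + l) (by omega) _ _ (Or.inl hadj)).ne').2 ih
    exact hb (this b (hG.connected t ht a b))
  classical
  obtain ⟨hl, k, j, hkj, hcross⟩ := Nat.find_spec hex
  set l := Nat.find hex
  have hsep : ∀ r ≤ l, (∀ i, S i → c + g ≤ mixed W t x r i) ∧
      (∀ i, ¬ S i → mixed W t x r i ≤ c) := by
    intro r
    induction r with
    | zero => exact fun _ => ⟨hS, hS'⟩
    | succ r ih =>
      intro hr
      obtain ⟨h1, h2⟩ := ih (by omega)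
      refine gap_mulVec (hG.doublyStochastic (by omega)) h1 h2 fun k j hkj => ?_
      by_contra hcr
      exact Nat.find_min hex (show r < l by omega) ⟨by omega, k, j, hkj, hcr⟩
  have h1 := decrease_of_crossing hn (hG.doublyStochastic (by omega)) hw0.le (hdiag (t + l)
    (by omega)) (hpos (t + l) (by omega)) hg (hsep l le_rfl).1 (hsep l le_rfl).2 hkj hcross
  have h2 : ‖disagreement (mixed W t x ι)‖ ^ 2 ≤ ‖disagreement (mixed W t x (l + 1))‖ ^ 2 :=
    pow_le_pow_left₀ (norm_nonneg _) (hmono (by omega)) 2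
  have h3 : ‖disagreement (mixed W t x l)‖ ^ 2 ≤ ‖disagreement x‖ ^ 2 := by
    simpa only [hmixed] using pow_le_pow_left₀ (norm_nonneg _) (hmono (Nat.zero_le l)) 2
  refine abs_le_of_sq_le_sq' ?_ (by positivity) |>.2
  have h4 : w / (2 * n ^ 3) * ‖disagreement x‖ ^ 2 ≤ w / 2 * g ^ 2 := by
    calc w / (2 * n ^ 3) * ‖disagreement x‖ ^ 2 ≤ w / (2 * n ^ 3) * (n ^ 3 * g ^ 2) := by gcongr
      _ = w / 2 * g ^ 2 := by field_simp
  have h5 : w / (4 * n ^ 3) * 2 = w / (2 * n ^ 3) := by field_simp; norm_num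
  change ‖disagreement (mixed W t x (l + 1))‖ ^ 2 ≤ _ at h1
  rw [mul_pow]
  nlinarith [sq_nonneg (w / (4 * n ^ 3) * ‖disagreement x‖)]

lemma GraphAssumption.norm_disagreement_mixed_le (hG : GraphAssumption G W w ι) (hn : 0 < n)
    (k : ℕ) {t : ℕ} (ht : 1 ≤ t) (x : Fin n → ℝ) :
    ‖disagreement (mixed W t x k)‖ ≤ (1 - w / (4 * n ^ 3)) ^ (k / ι) * ‖disagreement x‖ := by
  have hρ : 0 ≤ 1 - w / (4 * (n : ℝ) ^ 3) := by
    have hn' : (1 : ℝ) ≤ n := by exact_mod_cast hn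
    have hn3 : (1 : ℝ) ≤ n ^ 3 := one_le_pow₀ hn'
    rw [sub_nonneg, div_le_one (by positivity)]
    linarith [hG.w_lt_one]
  have hι := hG.ι_pos
  have key : ∀ M, ∀ t, 1 ≤ t → ∀ x, ‖disagreement (mixed W t x (ι * M))‖
      ≤ (1 - w / (4 * n ^ 3)) ^ M * ‖disagreement x‖ := by
    intro M
    induction M with
    | zero => intro t ht x; simp [mixed]
    | succ M ih =>
      intro t ht x
      rw [Nat.mul_succ, mixed_add]
      refine (hG.norm_disagreement_window hn (by omega) _).trans ?_
      rw [pow_succ' (1 - w / (4 * (n : ℝ) ^ 3)), mul_assoc]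
      exact mul_le_mul_of_nonneg_left (ih t ht x) hρ
  exact (hG.norm_disagreement_mixed_mono hn ht x (Nat.mul_div_le k ι)).trans (key _ _ ht x)

lemma sum_pow_div_le {ρ : ℝ} (h0 : 0 ≤ ρ) (h1 : ρ < 1) (hι : 0 < ι) (K : ℕ) :
    ∑ k ∈ Finset.range K, ρ ^ (k / ι) ≤ ι / (1 - ρ) := by
  have hblock : ∀ M, ∑ k ∈ Finset.range (ι * M), ρ ^ (k / ι) = ι * ∑ j ∈ Finset.range M, ρ ^ j := by
    intro M
    induction M with
    | zero => simp
    | succ M ih =>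
      rw [Nat.mul_succ, Finset.sum_range_add, ih, Finset.sum_range_succ, mul_add]
      congr 1
      rw [Finset.sum_congr rfl (g := fun _ => ρ ^ M)]
      · simp
      · intro k hk
        rw [Nat.mul_add_div hι, Nat.div_eq_of_lt (Finset.mem_range.1 hk), add_zero]
  calc ∑ k ∈ Finset.range K, ρ ^ (k / ι) ≤ ∑ k ∈ Finset.range (ι * K), ρ ^ (k / ι) :=
        Finset.sum_le_sum_of_subset_of_nonneg
          (Finset.range_mono (Nat.le_mul_of_pos_left K hι)) fun _ _ _ => pow_nonneg h0 _
    _ = ι * ∑ j ∈ Finset.range K, ρ ^ j := hblock K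
    _ ≤ ι * (1 - ρ)⁻¹ := by
        gcongr
        have := Summable.sum_le_tsum (Finset.range K) (fun i _ => pow_nonneg h0 i)
          (summable_geometric_of_lt_one h0 h1)
        rwa [tsum_geometric_of_lt_one h0 h1] at this
    _ = ι / (1 - ρ) := by rw [div_eq_mul_inv]

/-- The total disagreement of a perturbed consensus iteration started from zero is controlled by
the total size of the perturbations. -/
lemma GraphAssumption.sum_norm_disagreement_le (hG : GraphAssumption G W w ι) (hn : 0 < n)
    {x ε : ℕ → Fin n → ℝ} (h1 : x 1 = 0)
    (hx : ∀ t, 1 ≤ t → x (t + 1) = (W t).mulVec (x t) + ε (t + 1)) (T : ℕ) :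
    ∑ t ∈ Finset.Icc 1 T, ‖disagreement (x t)‖
      ≤ 4 * n ^ 3 * ι / w * ∑ t ∈ Finset.Icc 1 T, ‖disagreement (ε (t + 1))‖ := by
  have hn' : (1 : ℝ) ≤ n := by exact_mod_cast hn
  have hn3 : (1 : ℝ) ≤ n ^ 3 := one_le_pow₀ hn'
  have hw0 := hG.w_pos
  set ρ : ℝ := 1 - w / (4 * n ^ 3) with hρdef
  have hρ : 0 ≤ ρ := by
    rw [hρdef, sub_nonneg, div_le_one (by positivity)]
    linarith [hG.w_lt_one]
  have hρ1 : ρ < 1 := by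
    rw [hρdef]
    have : 0 < w / (4 * (n : ℝ) ^ 3) := by positivity
    linarith
  have hsol : ∀ t, x (t + 1) = ∑ s ∈ Finset.range t, mixed W (s + 2) (ε (s + 2)) (t - 1 - s) := by
    intro t
    induction t with
    | zero => simpa using h1
    | succ t ih =>
      rw [hx (t + 1) (by omega), ih, Finset.sum_range_succ, Matrix.mulVec_sum]
      congr 1
      · refine Finset.sum_congr rfl fun s hs => ?_
        have hs' := Finset.mem_range.1 hs
        rw [show t + 1 - 1 - s = (t - 1 - s) + 1 by omega, mixed]
        congr 2
        omega
      · simp [mixed]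
  have hdsum : ∀ (t : ℕ) (v : ℕ → Fin n → ℝ), ‖disagreement (∑ s ∈ Finset.range t, v s)‖
      ≤ ∑ s ∈ Finset.range t, ‖disagreement (v s)‖ := by
    intro t v
    induction t with
    | zero => simp [disagreement_zero]
    | succ t ih =>
      rw [Finset.sum_range_succ, Finset.sum_range_succ, disagreement_add]
      exact (norm_add_le _ _).trans (by gcongr)
  have hb : ∀ t, ‖disagreement (x (t + 1))‖
      ≤ ∑ s ∈ Finset.range t, ρ ^ ((t - 1 - s) / ι) * ‖disagreement (ε (s + 2))‖ := by
    intro t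
    rw [hsol t]
    refine (hdsum _ _).trans (Finset.sum_le_sum fun s _ => ?_)
    exact hG.norm_disagreement_mixed_le hn _ (by omega) _
  have hshift : ∀ φ : ℕ → ℝ, ∑ t ∈ Finset.Icc 1 T, φ t = ∑ t ∈ Finset.range T, φ (t + 1) := by
    intro φ
    rw [Finset.range_eq_Ico, Finset.sum_Ico_add' φ 0 T 1]
    rfl
  rw [hshift, hshift]
  calc ∑ t ∈ Finset.range T, ‖disagreement (x (t + 1))‖
      ≤ ∑ t ∈ Finset.range T, ∑ s ∈ Finset.range t,
          ρ ^ ((t - 1 - s) / ι) * ‖disagreement (ε (s + 2))‖ := Finset.sum_le_sum fun t _ => hb t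
    _ = ∑ s ∈ Finset.range T, ∑ t ∈ Finset.Ico (s + 1) T,
          ρ ^ ((t - 1 - s) / ι) * ‖disagreement (ε (s + 2))‖ := by
        refine Finset.sum_comm' fun t s => ?_
        simp only [Finset.mem_range, Finset.mem_Ico]
        omega
    _ ≤ ∑ s ∈ Finset.range T, 4 * n ^ 3 * ι / w * ‖disagreement (ε (s + 2))‖ := by
        refine Finset.sum_le_sum fun s _ => ?_
        rw [← Finset.sum_mul]
        refine mul_le_mul_of_nonneg_right ?_ (norm_nonneg _)
        rw [Finset.sum_Ico_eq_sum_range]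
        have : ∀ k, s + 1 + k - 1 - s = k := by intro k; omega
        simp only [this]
        refine (sum_pow_div_le hρ hρ1 hG.ι_pos _).trans_eq ?_
        rw [hρdef]
        have := hw0.ne'
        rw [sub_sub_cancel]
        field_simp
    _ = _ := by rw [Finset.mul_sum]

end Graph

/-! ### Sums of powers -/

section PowerSums

lemma rpow_neg_succ_le {a : ℝ} (ha0 : 0 ≤ a) (ha1 : a < 1) {t : ℝ} (ht : 1 ≤ t) :
    (1 - a) * (t + 1) ^ (-a) ≤ (t + 1) ^ (1 - a) - t ^ (1 - a) := by
  have h0 : 0 < t + 1 := by linarith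
  have hb := rpow_one_add_le_one_add_mul_self (s := -1 / (t + 1)) (p := 1 - a)
    (by rw [le_div_iff₀ h0]; linarith) (by linarith) (by linarith)
  have h1 : 1 + -1 / (t + 1) = t / (t + 1) := by field_simp; ring
  rw [h1, Real.div_rpow (by linarith) h0.le, div_le_iff₀ (by positivity)] at hb
  have h2 : (t + 1) ^ (1 - a) = (t + 1) * (t + 1) ^ (-a) := by
    rw [sub_eq_add_neg, Real.rpow_add h0, Real.rpow_one]
  rw [h2] at hb ⊢
  have h3 : (1 + (1 - a) * (-1 / (t + 1))) * ((t + 1) * (t + 1) ^ (-a))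
      = (t + 1) * (t + 1) ^ (-a) - (1 - a) * (t + 1) ^ (-a) := by
    field_simp
    ring
  linarith

lemma sum_Icc_two_rpow_neg_le {a : ℝ} (ha0 : 0 ≤ a) (ha1 : a < 1) {T : ℕ} (hT : 1 ≤ T) :
    ∑ t ∈ Finset.Icc 2 T, ((t : ℝ) + 1) ^ (-a) ≤ ((T : ℝ) ^ (1 - a) - 1) / (1 - a) := by
  have h1 : 0 < 1 - a := by linarith
  have key : ∑ t ∈ Finset.Icc 2 T, (t : ℝ) ^ (-a) ≤ ((T : ℝ) ^ (1 - a) - 1) / (1 - a) := by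
    induction T, hT using Nat.le_induction with
    | base => simp
    | succ T hT ih =>
      rw [Finset.sum_Icc_succ_top (by omega)]
      have h := rpow_neg_succ_le ha0 ha1 (t := T) (by exact_mod_cast hT)
      rw [le_div_iff₀ h1] at ih ⊢
      push_cast
      linarith
  refine (Finset.sum_le_sum fun t ht => ?_).trans key
  have : 0 < (t : ℝ) := by exact_mod_cast (by have := (Finset.mem_Icc.1 ht).1; omega)
  exact Real.rpow_le_rpow_of_nonpos this (by linarith) (by linarith)

lemma sum_rpow_neg_le {a : ℝ} (ha0 : 0 ≤ a) (ha1 : a < 1) {T : ℕ} (hT : 1 ≤ T) :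
    ∑ t ∈ Finset.Icc 1 T, ((t : ℝ) + 1) ^ (-a) ≤ (T : ℝ) ^ (1 - a) / (1 - a) := by
  have h1 : 0 < 1 - a := by linarith
  rw [← Finset.add_sum_Ioc_eq_sum_Icc hT]
  have h2 : (((1 : ℕ) : ℝ) + 1) ^ (-a) ≤ 1 :=
    Real.rpow_le_one_of_one_le_of_nonpos (by norm_num) (by linarith)
  have h3 := sum_Icc_two_rpow_neg_le ha0 ha1 hT
  have h4 : 1 ≤ 1 / (1 - a) := by rw [le_div_iff₀ h1]; linarith
  have h5 : ((T : ℝ) ^ (1 - a) - 1) / (1 - a) = (T : ℝ) ^ (1 - a) / (1 - a) - 1 / (1 - a) := by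
    rw [sub_div]
  have h6 : Finset.Ioc 1 T = Finset.Icc 2 T := by ext; simp; omega
  rw [h6]
  rw [h5] at h3
  exact (add_le_add h2 h3).trans (by linarith)

lemma rpow_succ_sub_rpow_le {a : ℝ} {t : ℝ} (ht : 1 ≤ t) (ha0 : 0 ≤ a) :
    (t + 1) ^ (1 - a) - t ^ (1 - a) ≤ (t + 1) ^ (-a) := by
  have h0 : 0 < t + 1 := by linarith
  have h1 : 0 < t := by linarith
  rw [sub_eq_add_neg 1 a, Real.rpow_add h0, Real.rpow_add h1, Real.rpow_one, Real.rpow_one]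
  have : (t + 1) ^ (-a) ≤ t ^ (-a) :=
    Real.rpow_le_rpow_of_nonpos h1 (by linarith) (by linarith)
  nlinarith

end PowerSums

/-! ### The dual iteration -/

/-- One component of the dual variables: `q (t + 1) i` is obtained by mixing `q t`, shrinking, and
adding a multiple of the constraint value `v t i`, whose modulus is at most `F`. The parameters are
`β = 2 / (t + 1) ^ θ` and `γ = 1 / (t + 1) ^ (1 - θ)`. -/
structure DualIteration {n : ℕ} (W : ℕ → Matrix (Fin n) (Fin n) ℝ) (θ F : ℝ)
    (q v : ℕ → Fin n → ℝ) : Prop where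
  stochastic : ∀ t, 1 ≤ t → W t ∈ doublyStochastic ℝ (Fin n)
  init : q 1 = 0
  step : ∀ t, 1 ≤ t → ∀ i, q (t + 1) i =
    max ((1 - 2 / ((t : ℝ) + 1) ^ θ * (1 / ((t : ℝ) + 1) ^ (1 - θ))) * (W t).mulVec (q t) i
      + 1 / ((t : ℝ) + 1) ^ (1 - θ) * v t i) 0
  abs_le : ∀ t, 1 ≤ t → ∀ i, |v t i| ≤ F

namespace DualIteration

variable {n : ℕ} {W : ℕ → Matrix (Fin n) (Fin n) ℝ} {θ F : ℝ} {q v : ℕ → Fin n → ℝ}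

lemma mulVec_mem (hq : DualIteration W θ F q v) {t : ℕ} (ht : 1 ≤ t) {a b : ℝ}
    (h : ∀ i, a ≤ q t i ∧ q t i ≤ b) (i : Fin n) :
    a ≤ (W t).mulVec (q t) i ∧ (W t).mulVec (q t) i ≤ b :=
  ⟨(gap_mulVec (hq.stochastic t ht) (S := fun _ => True) (c := b) (d := a)
      (fun i _ => (h i).1) (fun i hi => absurd trivial hi) (by simp)).1 i trivial,
    (gap_mulVec (hq.stochastic t ht) (S := fun _ => False) (c := b) (d := a)
      (fun i hi => absurd hi id) (fun i _ => (h i).2) (by simp)).2 i id⟩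

lemma beta_mul_gamma (t : ℕ) :
    2 / ((t : ℝ) + 1) ^ θ * (1 / ((t : ℝ) + 1) ^ (1 - θ)) = 2 / ((t : ℝ) + 1) := by
  have h0 : (0 : ℝ) < (t : ℝ) + 1 := by positivity
  rw [div_mul_div_comm, ← Real.rpow_add h0]
  simp

/-- The dual variables are nonnegative and at most `F / β`. -/
lemma bounds (hq : DualIteration W θ F q v) (hn : 0 < n) (hθ : 0 ≤ θ) {t : ℕ} (ht : 1 ≤ t)
    (i : Fin n) : 0 ≤ q t i ∧ q t i ≤ F * (t : ℝ) ^ θ / 2 := by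
  have hF : 0 ≤ F := (abs_nonneg _).trans (hq.abs_le 1 le_rfl ⟨0, hn⟩)
  induction t, ht using Nat.le_induction generalizing i with
  | base => simp [hq.init]; linarith
  | succ t ht ih =>
    have h0 : (0 : ℝ) < (t : ℝ) + 1 := by positivity
    have ht' : (1 : ℝ) ≤ t := by exact_mod_cast ht
    rw [hq.step t ht i, beta_mul_gamma]
    refine ⟨le_max_right _ _, max_le ?_ (by positivity)⟩
    obtain ⟨h1, h2⟩ := hq.mulVec_mem ht ih i
    have h3 : (W t).mulVec (q t) i ≤ F * ((t : ℝ) + 1) ^ θ / 2 := by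
      refine h2.trans ?_
      gcongr
      linarith
    have h4 : 0 ≤ 1 - 2 / ((t : ℝ) + 1) := by
      rw [sub_nonneg, div_le_one h0]; linarith
    have h5 : 1 / ((t : ℝ) + 1) ^ (1 - θ) * v t i ≤ 1 / ((t : ℝ) + 1) ^ (1 - θ) * F := by
      gcongr
      exact (_root_.abs_le.1 (hq.abs_le t ht i)).2
    have h6 : 1 / ((t : ℝ) + 1) ^ (1 - θ) = ((t : ℝ) + 1) ^ θ / ((t : ℝ) + 1) := by
      rw [Real.rpow_sub h0, Real.rpow_one]
      field_simp
    calc _ ≤ (1 - 2 / ((t : ℝ) + 1)) * (F * ((t : ℝ) + 1) ^ θ / 2)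
          + 1 / ((t : ℝ) + 1) ^ (1 - θ) * F := by gcongr
      _ = F * ((t + 1 : ℕ) : ℝ) ^ θ / 2 := by
          rw [h6]
          push_cast
          field_simp
          ring

lemma mixed_bounds (hq : DualIteration W θ F q v) (hn : 0 < n) (hθ : 0 ≤ θ) {t : ℕ} (ht : 1 ≤ t)
    (i : Fin n) :
    0 ≤ (W t).mulVec (q t) i ∧ (W t).mulVec (q t) i ≤ F * (t : ℝ) ^ θ / 2 :=
  hq.mulVec_mem ht (fun i => hq.bounds hn hθ ht i) i

/-- The direction `v - β q` of the dual step is bounded by `2 F`. -/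
lemma abs_direction_le (hq : DualIteration W θ F q v) (hn : 0 < n) (hθ : 0 ≤ θ) {t : ℕ}
    (ht : 1 ≤ t) (i : Fin n) :
    |v t i - 2 * ((t : ℝ) + 1) ^ (-θ) * (W t).mulVec (q t) i| ≤ 2 * F := by
  obtain ⟨h1, h2⟩ := hq.mixed_bounds hn hθ ht i
  have hv := _root_.abs_le.1 (hq.abs_le t ht i)
  have hF : 0 ≤ F := (abs_nonneg _).trans (hq.abs_le t ht i)
  have h0 : (0 : ℝ) < (t : ℝ) + 1 := by positivity
  have h3 : (W t).mulVec (q t) i ≤ F * ((t : ℝ) + 1) ^ θ / 2 := by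
    refine h2.trans ?_
    gcongr
    linarith
  have hB : 0 < ((t : ℝ) + 1) ^ (-θ) := by positivity
  have h4 : 2 * ((t : ℝ) + 1) ^ (-θ) * (W t).mulVec (q t) i ≤ F := by
    calc _ ≤ 2 * ((t : ℝ) + 1) ^ (-θ) * (F * ((t : ℝ) + 1) ^ θ / 2) := by gcongr
      _ = F * (((t : ℝ) + 1) ^ (-θ) * ((t : ℝ) + 1) ^ θ) := by ring
      _ = F := by rw [← Real.rpow_add h0]; simp
  have h5 : 0 ≤ 2 * ((t : ℝ) + 1) ^ (-θ) * (W t).mulVec (q t) i := by positivity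
  rw [_root_.abs_le]
  constructor <;> linarith

lemma step_eq_max (hq : DualIteration W θ F q v) {t : ℕ} (ht : 1 ≤ t) (i : Fin n) :
    q (t + 1) i = max ((W t).mulVec (q t) i + ((t : ℝ) + 1) ^ (-(1 - θ)) *
      (v t i - 2 * ((t : ℝ) + 1) ^ (-θ) * (W t).mulVec (q t) i)) 0 := by
  rw [hq.step t ht i, Real.rpow_neg (by positivity), Real.rpow_neg (by positivity)]
  congr 1
  ring

/-- The total disagreement of the mixed dual variables is of the order of the sum of the steps. -/
lemma sum_abs_sub_avg_le {G : ℕ → Digraph (Fin n)} {w : ℝ} {ι : ℕ}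
    (hG : GraphAssumption G W w ι) (hq : DualIteration W θ F q v) (hn : 0 < n) (hθ : 0 ≤ θ)
    (T : ℕ) :
    ∑ t ∈ Finset.Icc 1 T, ∑ i, |(W t).mulVec (q t) i - avg (q t)|
      ≤ 8 * n ^ 4 * ι / w * F * ∑ t ∈ Finset.Icc 1 T, ((t : ℝ) + 1) ^ (-(1 - θ)) := by
  have hw := hG.w_pos
  let ε : ℕ → Fin n → ℝ := fun t => q t - (W (t - 1)).mulVec (q (t - 1))
  have hε : ∀ t, 1 ≤ t → ∀ i, |ε (t + 1) i| ≤ 2 * F * ((t : ℝ) + 1) ^ (-(1 - θ)) := by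
    intro t ht i
    simp only [ε, Nat.add_sub_cancel, Pi.sub_apply]
    have h1 := (hq.mixed_bounds hn hθ ht i).1
    have h2 : q (t + 1) i - (W t).mulVec (q t) i = q (t + 1) i - max ((W t).mulVec (q t) i) 0 := by
      rw [max_eq_left h1]
    rw [h2, hq.step_eq_max ht i]
    refine (abs_max_sub_max_le_abs _ _ _).trans ?_
    rw [add_sub_cancel_left, abs_mul, abs_of_pos (show 0 < ((t : ℝ) + 1) ^ (-(1 - θ)) by positivity), mul_comm]
    gcongr
    exact hq.abs_direction_le hn hθ ht i
  have h := hG.sum_norm_disagreement_le hn (x := q) (ε := ε) hq.init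
    (fun t ht => by simp [ε]) T
  calc ∑ t ∈ Finset.Icc 1 T, ∑ i, |(W t).mulVec (q t) i - avg (q t)|
      ≤ ∑ t ∈ Finset.Icc 1 T, √n * ‖disagreement (q t)‖ := by
        refine Finset.sum_le_sum fun t ht => ?_
        have hW := hq.stochastic t (Finset.mem_Icc.1 ht).1
        rw [← avg_mulVec hW]
        refine (BanditOCO.sum_abs_sub_avg_le _).trans ?_
        gcongr
        exact norm_disagreement_mulVec_le hn hW _
    _ = √n * ∑ t ∈ Finset.Icc 1 T, ‖disagreement (q t)‖ := by rw [Finset.mul_sum]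
    _ ≤ √n * (4 * n ^ 3 * ι / w * ∑ t ∈ Finset.Icc 1 T, ‖disagreement (ε (t + 1))‖) := by gcongr
    _ ≤ √n * (4 * n ^ 3 * ι / w *
          ∑ t ∈ Finset.Icc 1 T, √n * (2 * F * ((t : ℝ) + 1) ^ (-(1 - θ)))) := by
        gcongr with t ht
        exact norm_disagreement_le hn fun i => hε t (Finset.mem_Icc.1 ht).1 i
    _ = (√n * √n) * (4 * n ^ 3 * ι / w) * (2 * F) *
          ∑ t ∈ Finset.Icc 1 T, ((t : ℝ) + 1) ^ (-(1 - θ)) := by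
        simp only [← Finset.mul_sum]
        ring
    _ = _ := by
        rw [Real.mul_self_sqrt (by positivity)]
        ring

lemma sum_sq_mulVec_sub_le {W : Matrix (Fin n) (Fin n) ℝ} (hW : W ∈ doublyStochastic ℝ (Fin n))
    (x : Fin n → ℝ) (c : ℝ) : ∑ i, (W.mulVec x i - c) ^ 2 ≤ ∑ i, (x i - c) ^ 2 := by
  obtain ⟨h0, hr, hc⟩ := mem_doublyStochastic_iff_sum.1 hW
  have h1 : ∀ i, (W.mulVec x i - c) ^ 2 ≤ ∑ j, W i j * (x j - c) ^ 2 := by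
    intro i
    have h := weighted_variance_nonneg (x := fun j => x j - c) (h0 i) (hr i)
    have h2 : ∑ j, W i j * (x j - c) = W.mulVec x i - c := by
      simp only [mul_sub, Finset.sum_sub_distrib, ← Finset.sum_mul, hr, one_mul]
      rfl
    rw [h2] at h
    linarith
  refine (Finset.sum_le_sum fun i _ => h1 i).trans_eq ?_
  rw [Finset.sum_comm]
  simp only [← Finset.sum_mul, hc, one_mul]

/-- One dual step moves towards every `c ≥ 0` as far as the constraint values allow. -/
lemma step_le (hq : DualIteration W θ F q v) (hn : 0 < n) (hθ : 0 ≤ θ) {c : ℝ} (hc : 0 ≤ c)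
    {t : ℕ} (ht : 1 ≤ t) (i : Fin n) :
    ((t : ℝ) + 1) ^ (1 - θ) / 2 * (q (t + 1) i - c) ^ 2
      ≤ (t : ℝ) ^ (1 - θ) / 2 * ((W t).mulVec (q t) i - c) ^ 2
        + ((W t).mulVec (q t) i - c) * v t i
        + 2 * ((t : ℝ) + 1) ^ (-θ) * ((W t).mulVec (q t) i * c - (W t).mulVec (q t) i ^ 2
            + ((W t).mulVec (q t) i - c) ^ 2 / 4)
        + 2 * F ^ 2 * ((t : ℝ) + 1) ^ (-(1 - θ)) := by
  have ht' : (1 : ℝ) ≤ t := by exact_mod_cast ht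
  have h0 : (0 : ℝ) < (t : ℝ) + 1 := by positivity
  have hd := hq.abs_direction_le hn hθ ht i
  have hs := hq.step_eq_max ht i
  set x := (W t).mulVec (q t) i
  set B := ((t : ℝ) + 1) ^ (-θ)
  set γ := ((t : ℝ) + 1) ^ (-(1 - θ)) with hγ
  set r := ((t : ℝ) + 1) ^ (1 - θ) with hr
  have hγr : r * γ = 1 := by rw [hγ, hr, ← Real.rpow_add h0]; simp
  have hγ0 : 0 < γ := by positivity
  have hr0 : 0 < r := by positivity
  have hinc : r - (t : ℝ) ^ (1 - θ) ≤ B := rpow_succ_sub_rpow_le ht' hθ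
  set d := v t i - 2 * B * x with hdd
  have hd2 : d ^ 2 ≤ (2 * F) ^ 2 := sq_le_sq' (_root_.abs_le.1 hd).1 (_root_.abs_le.1 hd).2
  have h1 : (q (t + 1) i - c) ^ 2 ≤ (x + γ * d - c) ^ 2 := by
    rw [hs]
    rcases le_total (x + γ * d) 0 with h | h
    · rw [max_eq_right h]; nlinarith
    · rw [max_eq_left h]
  have h2 : r / 2 * (q (t + 1) i - c) ^ 2 ≤ r / 2 * (x + γ * d - c) ^ 2 := by gcongr
  have h3 : r / 2 * (x + γ * d - c) ^ 2
      = r / 2 * (x - c) ^ 2 + (r * γ) * ((x - c) * d) + (r * γ) * γ * d ^ 2 / 2 := by ring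
  rw [hγr, one_mul, one_mul] at h3
  have h4 : γ * d ^ 2 ≤ γ * (2 * F) ^ 2 := by gcongr
  have h5 : (r - (t : ℝ) ^ (1 - θ)) * (x - c) ^ 2 ≤ B * (x - c) ^ 2 := by gcongr
  have h6 : (x - c) * d = (x - c) * v t i + 2 * B * (x * c - x ^ 2) := by rw [hdd]; ring
  linarith

/-- The dual regret inequality with respect to a constant `c ≥ 0`. In the quadratic term the
factor `1 + 7 / 10 * ∑ …`, smaller than the more obvious `1 + ∑ …`, comes from the slack left by
the quadratic terms of the dual variables. -/
lemma regret_le (hq : DualIteration W θ F q v) (hn : 0 < n) (hθ : 0 ≤ θ) {c : ℝ}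
    (hc : 0 ≤ c) {T : ℕ} (hT : 1 ≤ T) :
    ∑ t ∈ Finset.Icc 1 T, ∑ i, c * v t i
        + ∑ t ∈ Finset.Icc 1 T, ∑ i, ((t : ℝ) + 1) ^ (-θ) / 4 * (W t).mulVec (q t) i ^ 2
      ≤ ∑ t ∈ Finset.Icc 1 T, ∑ i, (W t).mulVec (q t) i * v t i
        + n * (1 + 7 / 10 * ∑ t ∈ Finset.Icc 2 T, ((t : ℝ) + 1) ^ (-θ)) * c ^ 2
        + 2 * n * F ^ 2 * ∑ t ∈ Finset.Icc 1 T, ((t : ℝ) + 1) ^ (-(1 - θ)) := by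
  suffices h : ∑ t ∈ Finset.Icc 1 T, ∑ i, c * v t i
        + ∑ t ∈ Finset.Icc 1 T, ∑ i, ((t : ℝ) + 1) ^ (-θ) / 4 * (W t).mulVec (q t) i ^ 2
        + ((T : ℝ) + 1) ^ (1 - θ) / 2 * ∑ i, (q (T + 1) i - c) ^ 2
      ≤ ∑ t ∈ Finset.Icc 1 T, ∑ i, (W t).mulVec (q t) i * v t i
        + n * (1 + 7 / 10 * ∑ t ∈ Finset.Icc 2 T, ((t : ℝ) + 1) ^ (-θ)) * c ^ 2
        + 2 * n * F ^ 2 * ∑ t ∈ Finset.Icc 1 T, ((t : ℝ) + 1) ^ (-(1 - θ)) by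
    have : 0 ≤ ((T : ℝ) + 1) ^ (1 - θ) / 2 * ∑ i, (q (T + 1) i - c) ^ 2 :=
      mul_nonneg (by positivity) (Finset.sum_nonneg fun i _ => sq_nonneg _)
    linarith
  induction T, hT using Nat.le_induction with
  | base =>
    simp only [Finset.Icc_self, Finset.sum_singleton]
    have hx : ∀ i, (W 1).mulVec (q 1) i = 0 := by intro i; simp [hq.init]
    have hstep := Finset.sum_le_sum fun i (_ : i ∈ Finset.univ) => hq.step_le hn hθ hc le_rfl i
    simp only [hx] at hstep ⊢
    have hB : (((1 : ℕ) : ℝ) + 1) ^ (-θ) ≤ 1 :=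
      Real.rpow_le_one_of_one_le_of_nonpos (by norm_num) (by linarith)
    simp only [Finset.sum_add_distrib, ← Finset.mul_sum, Finset.sum_const, Finset.card_univ,
      Fintype.card_fin, nsmul_eq_mul, zero_sub, zero_mul, Nat.cast_one, Real.one_rpow,
      Finset.sum_neg_distrib, neg_mul, even_two.neg_pow] at hstep hB ⊢
    have hnc : 0 ≤ (n : ℝ) * c ^ 2 := by positivity
    have := mul_le_mul_of_nonneg_right hB hnc
    norm_num at hstep this ⊢
    linarith
  | succ T hT ih =>
    rw [Finset.sum_Icc_succ_top (by omega), Finset.sum_Icc_succ_top (by omega),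
      Finset.sum_Icc_succ_top (by omega), Finset.sum_Icc_succ_top (by omega),
      Finset.sum_Icc_succ_top (by omega)]
    have hT1 : 1 ≤ T + 1 := by omega
    have hB : (0 : ℝ) < (((T + 1 : ℕ) : ℝ) + 1) ^ (-θ) := by positivity
    have hstep := Finset.sum_le_sum fun i (_ : i ∈ Finset.univ) => hq.step_le hn hθ hc hT1 i
    have hmix := mul_le_mul_of_nonneg_left (sum_sq_mulVec_sub_le (hq.stochastic (T + 1) hT1)
      (q (T + 1)) c) (show 0 ≤ ((T + 1 : ℕ) : ℝ) ^ (1 - θ) / 2 by positivity)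
    have hbr := Finset.sum_le_sum fun i (_ : i ∈ Finset.univ) =>
      mul_le_mul_of_nonneg_left (show (W (T + 1)).mulVec (q (T + 1)) i * c
          - (W (T + 1)).mulVec (q (T + 1)) i ^ 2
          + ((W (T + 1)).mulVec (q (T + 1)) i - c) ^ 2 / 4
          ≤ 7 / 20 * c ^ 2 - (W (T + 1)).mulVec (q (T + 1)) i ^ 2 / 8 by
        nlinarith [sq_nonneg ((W (T + 1)).mulVec (q (T + 1)) i - 2 / 5 * c)])
      (show (0 : ℝ) ≤ 2 * (((T + 1 : ℕ) : ℝ) + 1) ^ (-θ) by positivity)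
    simp only [Finset.sum_add_distrib, Finset.sum_sub_distrib, ← Finset.mul_sum, Finset.sum_const,
      Finset.card_univ, Fintype.card_fin, nsmul_eq_mul, sub_mul, ← Finset.sum_div]
      at hstep hmix hbr ih ⊢
    push_cast at hstep hmix hbr ih ⊢
    linarith

end DualIteration

/-! ### Projections onto closed convex sets -/

section Projection

variable {p : ℕ} {K : Set (Vec p)}

lemma proj_spec (hne : K.Nonempty) (hc : IsClosed K) (hK : Convex ℝ K) (x : Vec p) :
    proj K x ∈ K ∧ ∀ w ∈ K, ‖x - proj K x‖ ≤ ‖x - w‖ := by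
  refine Classical.epsilon_spec (p := fun y => y ∈ K ∧ ∀ w ∈ K, ‖x - y‖ ≤ ‖x - w‖) ?_
  obtain ⟨v, hv, h⟩ := exists_norm_eq_iInf_of_complete_convex hne hc.isComplete hK x
  refine ⟨v, hv, fun w hw => h.trans_le ?_⟩
  exact ciInf_le (f := fun w : K => ‖x - w‖) ⟨0, by rintro _ ⟨w, rfl⟩; exact norm_nonneg _⟩ ⟨w, hw⟩

lemma inner_sub_proj_le (hne : K.Nonempty) (hc : IsClosed K) (hK : Convex ℝ K) (x : Vec p)
    {w : Vec p} (hw : w ∈ K) : inner ℝ (x - proj K x) (w - proj K x) ≤ 0 := by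
  obtain ⟨h1, h2⟩ := proj_spec hne hc hK x
  refine (norm_eq_iInf_iff_real_inner_le_zero hK h1).1 ?_ w hw
  have : Nonempty K := hne.to_subtype
  exact le_antisymm (le_ciInf fun w => h2 w w.2)
    (ciInf_le (f := fun w : K => ‖x - w‖) ⟨0, by rintro _ ⟨w, rfl⟩; exact norm_nonneg _⟩ ⟨_, h1⟩)

lemma norm_proj_sub_proj_le (hne : K.Nonempty) (hc : IsClosed K) (hK : Convex ℝ K) (x y : Vec p) :
    ‖proj K x - proj K y‖ ≤ ‖x - y‖ := by
  have h1 := inner_sub_proj_le hne hc hK x (proj_spec hne hc hK y).1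
  have h2 := inner_sub_proj_le hne hc hK y (proj_spec hne hc hK x).1
  set a := proj K x
  set b := proj K y
  have h3 : inner ℝ (x - a) (b - a) + inner ℝ (y - b) (a - b)
      = ‖a - b‖ ^ 2 - inner ℝ (x - y) (a - b) := by
    rw [← real_inner_self_eq_norm_sq]
    simp only [inner_sub_left, inner_sub_right]
    ring
  have h4 := real_inner_le_norm (x - y) (a - b)
  by_contra! h
  nlinarith [norm_nonneg (x - y), norm_nonneg (a - b)]

lemma continuous_proj (hne : K.Nonempty) (hc : IsClosed K) (hK : Convex ℝ K) :
    Continuous (proj K) :=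
  (LipschitzWith.of_dist_le_mul (K := 1) fun x y => by
    simpa [dist_eq_norm] using norm_proj_sub_proj_le hne hc hK x y).continuous

lemma proj_eq_self (hne : K.Nonempty) (hc : IsClosed K) (hK : Convex ℝ K) {x : Vec p}
    (hx : x ∈ K) : proj K x = x := by
  have := (proj_spec hne hc hK x).2 x hx
  rw [sub_self, norm_zero] at this
  exact (sub_eq_zero.1 (norm_le_zero_iff.1 this)).symm

lemma norm_proj_sub_le (hne : K.Nonempty) (hc : IsClosed K) (hK : Convex ℝ K) (x : Vec p)
    {y : Vec p} (hy : y ∈ K) : ‖proj K x - y‖ ≤ ‖x - y‖ := by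
  simpa [proj_eq_self hne hc hK hy] using norm_proj_sub_proj_le hne hc hK x y

end Projection

/-! ### Shrunk decision sets -/

section Shrinkage

/-- The shrinkage coefficient `ξ_t` lies strictly between `0` and `1`. -/
lemma shrink_mem {θ : ℝ} (hθ : 0 < θ) {t : ℕ} (ht : 1 ≤ t) :
    0 < 1 / ((t : ℝ) + 1) ^ θ ∧ 1 / ((t : ℝ) + 1) ^ θ < 1 := by
  have ht' : (1 : ℝ) ≤ t := by exact_mod_cast ht
  refine ⟨by positivity, ?_⟩
  rw [div_lt_one (by positivity)]
  exact Real.one_lt_rpow (by linarith) hθ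

lemma shrink_antitone {θ : ℝ} (hθ : 0 ≤ θ) {t : ℕ} :
    1 / (((t + 1 : ℕ) : ℝ) + 1) ^ θ ≤ 1 / ((t : ℝ) + 1) ^ θ := by
  gcongr
  simp

lemma smul_subset_smul_of_le {E : Type*} [AddCommGroup E] [Module ℝ E] {X : Set E}
    (hX : Convex ℝ X) (h0 : (0 : E) ∈ X) {a b : ℝ} (ha : 0 ≤ a) (hab : a ≤ b) :
    a • X ⊆ b • X := by
  rintro _ ⟨x, hx, rfl⟩
  rcases (ha.trans hab).eq_or_lt with hb | hb
  · have : a = 0 := le_antisymm (hab.trans hb.ge) ha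
    exact ⟨x, hx, by simp [← hb, this]⟩
  · refine ⟨(a / b) • x, ?_, ?_⟩
    · exact hX.smul_mem_of_zero_mem h0 hx ⟨by positivity, div_le_one_of_le₀ hab hb.le⟩
    · simp only [smul_smul]
      congr 1
      field_simp

end Shrinkage

/-! ### Projected gradient descent over shrunk sets -/

section Primal

variable {p : ℕ} {X : Set (Vec p)} {R κ θ₁ θ₃ : ℝ} {z y a : ℕ → Vec p}

/-- The standard estimate of one projected gradient step. -/
lemma inner_le_of_proj_step {K : Set (Vec p)} (hne : K.Nonempty) (hc : IsClosed K)
    (hK : Convex ℝ K) {z a y : Vec p} (hy : y ∈ K) {α : ℝ} (hα : 0 < α) :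
    inner ℝ a (z - y) + 1 / (2 * α) * ‖proj K (z - α • a) - y‖ ^ 2
      ≤ 1 / (2 * α) * ‖z - y‖ ^ 2 + α / 2 * ‖a‖ ^ 2 := by
  have h1 : ‖proj K (z - α • a) - y‖ ^ 2 ≤ ‖z - α • a - y‖ ^ 2 :=
    pow_le_pow_left₀ (norm_nonneg _) (norm_proj_sub_le hne hc hK _ hy) 2
  have h2 : ‖z - α • a - y‖ ^ 2 = ‖z - y‖ ^ 2 - 2 * α * inner ℝ a (z - y) + α ^ 2 * ‖a‖ ^ 2 := by
    rw [show z - α • a - y = (z - y) - α • a by abel, norm_sub_sq_real, inner_smul_right,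
      norm_smul, real_inner_comm, mul_pow, Real.norm_eq_abs, sq_abs]
    ring
  rw [h2] at h1
  have h3 := mul_le_mul_of_nonneg_left h1 (show 0 ≤ 1 / (2 * α) by positivity)
  have h4 : 1 / (2 * α) * (‖z - y‖ ^ 2 - 2 * α * inner ℝ a (z - y) + α ^ 2 * ‖a‖ ^ 2)
      = 1 / (2 * α) * ‖z - y‖ ^ 2 - inner ℝ a (z - y) + α / 2 * ‖a‖ ^ 2 := by
    field_simp
  linarith

lemma mem_shrink_of_proj_step (hX : Convex ℝ X) (hXc : IsClosed X) (h0 : (0 : Vec p) ∈ X)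
    (hθ₃ : 0 < θ₃)
    (hz1 : z 1 ∈ (1 - 1 / (((1 : ℕ) : ℝ) + 1) ^ θ₃) • X)
    (hz : ∀ t, 1 ≤ t → z (t + 1) = proj ((1 - 1 / (((t + 1 : ℕ) : ℝ) + 1) ^ θ₃) • X)
      (z t - (κ / ((t : ℝ) + 1) ^ θ₁) • a t)) {t : ℕ} (ht : 1 ≤ t) :
    z t ∈ (1 - 1 / ((t : ℝ) + 1) ^ θ₃) • X := by
  induction t, ht using Nat.le_induction with
  | base => exact hz1
  | succ t ht _ =>
    have h := (shrink_mem hθ₃ (show 1 ≤ t + 1 by omega)).2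
    rw [hz t ht]
    exact (proj_spec ⟨0, Set.zero_mem_smul_set h0⟩
      (hXc.smul_of_ne_zero (by linarith)) (hX.smul _) _).1

/-- The regret inequality of projected gradient descent over shrunk decision sets, with step sizes
`κ / (t + 1) ^ θ₁` and a time-varying comparator. -/
lemma primal_regret_le (hX : Convex ℝ X) (hXc : IsClosed X) (h0 : (0 : Vec p) ∈ X)
    (hR : X ⊆ Metric.closedBall 0 R) (hκ : 0 < κ) (hθ₁ : 0 < θ₁) (hθ₁' : θ₁ < 1) (hθ₃ : 0 < θ₃)
    (hz1 : z 1 ∈ (1 - 1 / (((1 : ℕ) : ℝ) + 1) ^ θ₃) • X)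
    (hz : ∀ t, 1 ≤ t → z (t + 1) = proj ((1 - 1 / (((t + 1 : ℕ) : ℝ) + 1) ^ θ₃) • X)
      (z t - (κ / ((t : ℝ) + 1) ^ θ₁) • a t))
    {T : ℕ} (hT : 1 ≤ T) (hy : ∀ t ∈ Finset.Icc 1 T, y t ∈ X) :
    ∑ t ∈ Finset.Icc 1 T, inner ℝ (a t) (z t - (1 - 1 / ((t : ℝ) + 1) ^ θ₃) • y t)
      ≤ ∑ t ∈ Finset.Icc 1 T, κ / ((t : ℝ) + 1) ^ θ₁ / 2 * ‖a t‖ ^ 2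
        + 2 * R / κ * (T : ℝ) ^ θ₁ * ∑ t ∈ Finset.Icc 1 (T - 1), ‖y (t + 1) - y t‖
        + (2 * R ^ 2 / κ + 4 * R ^ 2 / κ) * (T : ℝ) ^ θ₁ := by
  set ξ : ℕ → ℝ := fun t => 1 / ((t : ℝ) + 1) ^ θ₃ with hξ
  set yh : ℕ → Vec p := fun t => (1 - ξ t) • y t with hyh
  have hξ01 : ∀ t, 1 ≤ t → 0 < ξ t ∧ ξ t < 1 := fun t ht => shrink_mem hθ₃ ht
  have hξanti : ∀ t, ξ (t + 1) ≤ ξ t := fun t => shrink_antitone hθ₃.le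
  have hR0 : 0 ≤ R := by simpa using hR h0
  have hXR : ∀ v ∈ X, ‖v‖ ≤ R := fun v hv => by simpa using hR hv
  have hzmem : ∀ t, 1 ≤ t → z t ∈ (1 - ξ t) • X := fun t ht =>
    mem_shrink_of_proj_step hX hXc h0 hθ₃ hz1 hz ht
  have hsmul : ∀ t, 1 ≤ t → ∀ v ∈ (1 - ξ t) • X, ‖v‖ ≤ R := by
    rintro t ht _ ⟨v, hv, rfl⟩
    have h := hξ01 t ht
    simp only [norm_smul, Real.norm_eq_abs]
    rw [abs_of_pos (by linarith)]
    nlinarith [hXR v hv, norm_nonneg v]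
  have hzR : ∀ t, 1 ≤ t → ‖z t‖ ≤ R := fun t ht => hsmul t ht _ (hzmem t ht)
  have hymem : ∀ t ∈ Finset.Icc 1 T, yh t ∈ (1 - ξ t) • X := fun t ht => ⟨_, hy t ht, rfl⟩
  have hyR : ∀ t ∈ Finset.Icc 1 T, ‖yh t‖ ≤ R := fun t ht =>
    hsmul t (Finset.mem_Icc.1 ht).1 _ (hymem t ht)
  have hstep : ∀ t ∈ Finset.Icc 1 T, inner ℝ (a t) (z t - yh t)
      + ((t : ℝ) + 1) ^ θ₁ / (2 * κ) * ‖z (t + 1) - yh t‖ ^ 2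
      ≤ ((t : ℝ) + 1) ^ θ₁ / (2 * κ) * ‖z t - yh t‖ ^ 2
        + κ / ((t : ℝ) + 1) ^ θ₁ / 2 * ‖a t‖ ^ 2 := by
    intro t ht
    have ht1 := (Finset.mem_Icc.1 ht).1
    have h1 := hξ01 t ht1
    have h2 := hξ01 (t + 1) (by omega)
    have h := inner_le_of_proj_step (K := (1 - ξ (t + 1)) • X) ⟨0, Set.zero_mem_smul_set h0⟩
      (hXc.smul_of_ne_zero (by linarith)) (hX.smul _) (z := z t) (a := a t)
      (smul_subset_smul_of_le hX h0 (by linarith) (by linarith [hξanti t]) (hymem t ht))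
      (α := κ / ((t : ℝ) + 1) ^ θ₁) (by positivity)
    rw [← hz t ht1] at h
    have h3 : 1 / (2 * (κ / ((t : ℝ) + 1) ^ θ₁)) = ((t : ℝ) + 1) ^ θ₁ / (2 * κ) := by
      field_simp
    rwa [h3] at h
  have hdist : ∀ t, 1 ≤ t → ∀ v, ‖v‖ ≤ R → ‖z t - v‖ ≤ 2 * R := fun t ht v hv =>
    (norm_sub_le _ _).trans (by linarith [hzR t ht])
  have hsq : ∀ t, 1 ≤ t → ∀ v, ‖v‖ ≤ R → ‖z t - v‖ ^ 2 ≤ 4 * R ^ 2 := fun t ht v hv => by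
    have := pow_le_pow_left₀ (norm_nonneg _) (hdist t ht v hv) 2
    linarith
  have hshift : ∀ t, 1 ≤ t → t + 1 ≤ T →
      ‖yh (t + 1) - yh t‖ ≤ ‖y (t + 1) - y t‖ + R * (ξ t - ξ (t + 1)) := by
    intro t ht htT
    have h1 := hξ01 (t + 1) (by omega)
    have h : yh (t + 1) - yh t = (1 - ξ (t + 1)) • (y (t + 1) - y t) + (ξ t - ξ (t + 1)) • y t := by
      simp only [hyh]
      module
    rw [h]
    refine (norm_add_le _ _).trans (add_le_add ?_ ?_)
    · rw [norm_smul, Real.norm_eq_abs, abs_of_pos (by linarith)]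
      nlinarith [norm_nonneg (y (t + 1) - y t)]
    · rw [norm_smul, Real.norm_eq_abs, abs_of_nonneg (by linarith [hξanti t]), mul_comm]
      exact mul_le_mul_of_nonneg_right (hXR _ (hy t (Finset.mem_Icc.2 ⟨ht, by omega⟩)))
        (by linarith [hξanti t])
  have main : ∀ S, 1 ≤ S → S ≤ T → ∑ t ∈ Finset.Icc 1 S, inner ℝ (a t) (z t - yh t)
      + ((S : ℝ) + 1) ^ θ₁ / (2 * κ) * ‖z (S + 1) - yh S‖ ^ 2
      ≤ ∑ t ∈ Finset.Icc 1 S, κ / ((t : ℝ) + 1) ^ θ₁ / 2 * ‖a t‖ ^ 2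
        + ∑ t ∈ Finset.Icc 1 (S - 1), 2 * R / κ * ((t : ℝ) + 1) ^ θ₁ *
            (‖y (t + 1) - y t‖ + R * (ξ t - ξ (t + 1)))
        + 2 * R ^ 2 / κ * ((S : ℝ) + 1) ^ θ₁ := by
    intro S hS
    induction S, hS using Nat.le_induction with
    | base =>
      intro h1T
      have h1 := hstep 1 (Finset.mem_Icc.2 ⟨le_rfl, h1T⟩)
      have h2 := mul_le_mul_of_nonneg_left
        (hsq 1 le_rfl (yh 1) (hyR 1 (Finset.mem_Icc.2 ⟨le_rfl, h1T⟩)))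
        (show 0 ≤ (((1 : ℕ) : ℝ) + 1) ^ θ₁ / (2 * κ) by positivity)
      have h3 : (((1 : ℕ) : ℝ) + 1) ^ θ₁ / (2 * κ) * (4 * R ^ 2)
          = 2 * R ^ 2 / κ * (((1 : ℕ) : ℝ) + 1) ^ θ₁ := by field_simp; norm_num
      simp only [Finset.Icc_self, Finset.sum_singleton, Nat.sub_self]
      simp only [Finset.Icc_eq_empty (show ¬ (1 ≤ 0) by omega), Finset.sum_empty, add_zero]
      linarith
    | succ S hS ih =>
      intro hST
      have ih := ih (by omega)
      have hmem : S + 1 ∈ Finset.Icc 1 T := Finset.mem_Icc.2 ⟨by omega, hST⟩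
      have hmem' : S ∈ Finset.Icc 1 T := Finset.mem_Icc.2 ⟨by omega, by omega⟩
      have h1 := hstep (S + 1) hmem
      have e1 : ∀ φ : ℕ → ℝ, ∑ t ∈ Finset.Icc 1 (S + 1 - 1), φ t
          = ∑ t ∈ Finset.Icc 1 (S - 1), φ t + φ S := by
        intro φ
        obtain ⟨S', rfl⟩ : ∃ S', S = S' + 1 := ⟨S - 1, by omega⟩
        simp only [Nat.add_sub_cancel]
        rw [Finset.sum_Icc_succ_top (by omega)]
      rw [Finset.sum_Icc_succ_top (by omega), Finset.sum_Icc_succ_top (by omega), e1]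
      set A := ((S : ℝ) + 1) ^ θ₁ with hA
      set B := (((S + 1 : ℕ) : ℝ) + 1) ^ θ₁ with hB
      have hAB : A ≤ B := by
        rw [hA, hB]
        push_cast
        gcongr
        linarith
      have hA0 : 0 < A := by positivity
      have h2 := mul_le_mul_of_nonneg_left (hsq (S + 1) (by omega) _ (hyR _ hmem))
        (show 0 ≤ (B - A) / (2 * κ) by
          apply div_nonneg <;> linarith)
      have h3 : ‖z (S + 1) - yh (S + 1)‖ ^ 2 - ‖z (S + 1) - yh S‖ ^ 2
          ≤ 4 * R * (‖y (S + 1) - y S‖ + R * (ξ S - ξ (S + 1))) := by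
        have k1 := hdist (S + 1) (by omega) _ (hyR _ hmem)
        have k2 := hdist (S + 1) (by omega) _ (hyR _ hmem')
        have k3 : ‖z (S + 1) - yh (S + 1)‖ - ‖z (S + 1) - yh S‖ ≤ ‖yh (S + 1) - yh S‖ := by
          refine (norm_sub_norm_le _ _).trans ?_
          rw [sub_sub_sub_cancel_left, norm_sub_rev]
        have k4 := hshift S hS hST
        have k5 := norm_nonneg (z (S + 1) - yh (S + 1))
        have k6 := norm_nonneg (z (S + 1) - yh S)
        have k7 := norm_nonneg (yh (S + 1) - yh S)
        calc _ = (‖z (S + 1) - yh (S + 1)‖ - ‖z (S + 1) - yh S‖)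
              * (‖z (S + 1) - yh (S + 1)‖ + ‖z (S + 1) - yh S‖) := by ring
          _ ≤ ‖yh (S + 1) - yh S‖ * (4 * R) := by
              refine mul_le_mul k3 (by linarith) (by linarith) k7
          _ ≤ _ := by
              rw [mul_comm]
              gcongr
      have h4 := mul_le_mul_of_nonneg_left h3 (show 0 ≤ A / (2 * κ) by positivity)
      have e2 : A / (2 * κ) * (4 * R * (‖y (S + 1) - y S‖ + R * (ξ S - ξ (S + 1))))
          = 2 * R / κ * A * (‖y (S + 1) - y S‖ + R * (ξ S - ξ (S + 1))) := by field_simp; norm_num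
      have e3 : (B - A) / (2 * κ) * (4 * R ^ 2) = 2 * R ^ 2 / κ * B - 2 * R ^ 2 / κ * A := by
        field_simp; ring
      have e4 : (B - A) / (2 * κ) * ‖z (S + 1) - yh (S + 1)‖ ^ 2
          = B / (2 * κ) * ‖z (S + 1) - yh (S + 1)‖ ^ 2
            - A / (2 * κ) * ‖z (S + 1) - yh (S + 1)‖ ^ 2 := by ring
      rw [e2] at h4
      rw [e3, e4] at h2
      rw [mul_sub] at h4
      linarith
  have hmain := main T hT le_rfl
  have hT' : (1 : ℝ) ≤ T := by exact_mod_cast hT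
  have hlast : 0 ≤ ((T : ℝ) + 1) ^ θ₁ / (2 * κ) * ‖z (T + 1) - yh T‖ ^ 2 := by positivity
  have hT2 : ((T : ℝ) + 1) ^ θ₁ ≤ 2 * (T : ℝ) ^ θ₁ := by
    calc ((T : ℝ) + 1) ^ θ₁ ≤ (2 * T) ^ θ₁ := by gcongr; linarith
      _ = 2 ^ θ₁ * (T : ℝ) ^ θ₁ := Real.mul_rpow (by norm_num) (by linarith)
      _ ≤ 2 * (T : ℝ) ^ θ₁ := by
          gcongr
          calc (2 : ℝ) ^ θ₁ ≤ 2 ^ (1 : ℝ) := by gcongr; linarith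
            _ = 2 := Real.rpow_one 2
  have h5 : 2 * R ^ 2 / κ * ((T : ℝ) + 1) ^ θ₁ ≤ 4 * R ^ 2 / κ * (T : ℝ) ^ θ₁ := by
    calc 2 * R ^ 2 / κ * ((T : ℝ) + 1) ^ θ₁ ≤ 2 * R ^ 2 / κ * (2 * (T : ℝ) ^ θ₁) := by gcongr
      _ = _ := by ring
  have htel : ∑ t ∈ Finset.Icc 1 (T - 1), (ξ t - ξ (t + 1)) ≤ 1 := by
    have : ∀ S, ∑ t ∈ Finset.Icc 1 S, (ξ t - ξ (t + 1)) = ξ 1 - ξ (S + 1) := by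
      intro S
      induction S with
      | zero => simp
      | succ S ih => rw [Finset.sum_Icc_succ_top (by omega), ih]; ring
    rw [this]
    linarith [(hξ01 1 le_rfl).2, (hξ01 (T - 1 + 1) (by omega)).1]
  have h6 : ∑ t ∈ Finset.Icc 1 (T - 1), 2 * R / κ * ((t : ℝ) + 1) ^ θ₁ *
            (‖y (t + 1) - y t‖ + R * (ξ t - ξ (t + 1)))
      ≤ 2 * R / κ * (T : ℝ) ^ θ₁ * ∑ t ∈ Finset.Icc 1 (T - 1), ‖y (t + 1) - y t‖
        + 2 * R ^ 2 / κ * (T : ℝ) ^ θ₁ := by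
    calc _ ≤ ∑ t ∈ Finset.Icc 1 (T - 1), 2 * R / κ * (T : ℝ) ^ θ₁ *
            (‖y (t + 1) - y t‖ + R * (ξ t - ξ (t + 1))) := by
          refine Finset.sum_le_sum fun t ht => ?_
          have htT := Finset.mem_Icc.1 ht
          have : (t : ℝ) + 1 ≤ T := by exact_mod_cast (by omega : t + 1 ≤ T)
          have h7 : 0 ≤ ‖y (t + 1) - y t‖ + R * (ξ t - ξ (t + 1)) :=
            add_nonneg (norm_nonneg _) (mul_nonneg hR0 (by linarith [hξanti t]))
          gcongr
      _ = 2 * R / κ * (T : ℝ) ^ θ₁ * ∑ t ∈ Finset.Icc 1 (T - 1), ‖y (t + 1) - y t‖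
          + 2 * R ^ 2 / κ * (T : ℝ) ^ θ₁ * ∑ t ∈ Finset.Icc 1 (T - 1), (ξ t - ξ (t + 1)) := by
          rw [← Finset.mul_sum, Finset.sum_add_distrib, ← Finset.mul_sum]
          ring
      _ ≤ _ := by
          have := mul_le_mul_of_nonneg_left htel
            (show 0 ≤ 2 * R ^ 2 / κ * (T : ℝ) ^ θ₁ by positivity)
          linarith
  rw [add_mul]
  linarith

end Primal

/-! ### The size of the gradient estimators -/

section GradientEstimator

variable {p m : ℕ}

lemma norm_gradEst_le {δ F : ℝ} (hδ : 0 < δ) {h : Vec p → ℝ} {z u : Vec p} (hu : ‖u‖ = 1)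
    (hF : |h (z + δ • u)| ≤ F) : ‖gradEst δ h z u‖ ≤ p / δ * F := by
  rw [gradEst, norm_smul, hu, mul_one, Real.norm_eq_abs, abs_mul, abs_of_nonneg (by positivity)]
  gcongr

/-- The second moment of the gradient estimator of the Lagrangian `f + ∑ k, c k * g k`. -/
lemma norm_sq_gradEst_add_le {δ Ff Fg : ℝ} (hδ : 0 < δ) {f : Vec p → ℝ} {g : Vec p → Vec m}
    {z u : Vec p} (hu : ‖u‖ = 1) (hf : |f (z + δ • u)| ≤ Ff)
    (hg : ∀ k, |g (z + δ • u) k| ≤ Fg) {c : Fin m → ℝ} (hc : ∀ k, 0 ≤ c k) :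
    ‖gradEst δ f z u + ∑ k, c k • gradEst δ (fun v => g v k) z u‖ ^ 2
      ≤ 2 * (p / δ) ^ 2 * (Ff ^ 2 + m * Fg ^ 2 * ∑ k, c k ^ 2) := by
  have h1 : ‖gradEst δ f z u + ∑ k, c k • gradEst δ (fun v => g v k) z u‖
      ≤ p / δ * (Ff + Fg * ∑ k, c k) := by
    calc _ ≤ ‖gradEst δ f z u‖ + ∑ k, ‖c k • gradEst δ (fun v => g v k) z u‖ :=
          (norm_add_le _ _).trans (by gcongr; exact norm_sum_le _ _)
      _ ≤ p / δ * Ff + ∑ k, c k * (p / δ * Fg) := by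
          gcongr with k
          · exact norm_gradEst_le hδ hu hf
          · rw [norm_smul, Real.norm_eq_abs, abs_of_nonneg (hc k)]
            exact mul_le_mul_of_nonneg_left (norm_gradEst_le hδ hu (hg k)) (hc k)
      _ = _ := by rw [← Finset.sum_mul]; ring
  have h2 := pow_le_pow_left₀ (norm_nonneg _) h1 2
  have h3 : (∑ k, c k) ^ 2 ≤ m * ∑ k, c k ^ 2 := by
    simpa using sq_sum_le_card_mul_sum_sq (s := (Finset.univ : Finset (Fin m))) (f := c)
  refine h2.trans ?_
  rw [mul_pow]
  have h4 : (Ff + Fg * ∑ k, c k) ^ 2 ≤ 2 * (Ff ^ 2 + m * Fg ^ 2 * ∑ k, c k ^ 2) := by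
    nlinarith [sq_nonneg (Ff - Fg * ∑ k, c k), mul_le_mul_of_nonneg_left h3 (sq_nonneg Fg)]
  nlinarith [mul_le_mul_of_nonneg_left h4 (sq_nonneg ((p : ℝ) / δ))]

end GradientEstimator

/-! ### The uniform distribution on the sphere -/

section Sphere

variable {p : ℕ}

lemma isProbabilityMeasure_uniformSphere (hp : 0 < p) :
    IsProbabilityMeasure (uniformSphere p) := by
  have : Nontrivial (Vec p) := Module.nontrivial_of_finrank_pos (R := ℝ) (by simpa using hp)
  constructor
  rw [uniformSphere, Measure.smul_apply, smul_eq_mul]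
  refine ENNReal.inv_mul_cancel ?_ (measure_ne_top _ _)
  exact fun h => Measure.toSphere_ne_zero _ (Measure.measure_univ_eq_zero.1 h)

/-- The action of a linear isometry on the unit sphere. -/
noncomputable def sphereEquiv (L : Vec p ≃ₗᵢ[ℝ] Vec p) : USphere p ≃ₜ USphere p where
  toFun u := ⟨L u, by simp⟩
  invFun u := ⟨L.symm u, by simp⟩
  left_inv u := by simp
  right_inv u := by simp
  continuous_toFun := by fun_prop
  continuous_invFun := by fun_prop

lemma coe_sphereEquiv (L : Vec p ≃ₗᵢ[ℝ] Vec p) (u : USphere p) :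
    (sphereEquiv L u : Vec p) = L u := rfl

/-- The uniform distribution on the sphere is invariant under linear isometries. -/
lemma measurePreserving_sphereEquiv (L : Vec p ≃ₗᵢ[ℝ] Vec p) :
    MeasurePreserving (sphereEquiv L) (uniformSphere p) (uniformSphere p) := by
  refine ⟨(sphereEquiv L).continuous.measurable, ?_⟩
  ext s hs
  have hs' : MeasurableSet (sphereEquiv L ⁻¹' s) := (sphereEquiv L).continuous.measurable hs
  rw [Measure.map_apply (sphereEquiv L).continuous.measurable hs]
  simp only [uniformSphere, Measure.smul_apply]
  rw [Measure.toSphere_apply' _ hs, Measure.toSphere_apply' _ hs',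
    ← L.measurePreserving.measure_preimage_equiv (f := L.toMeasurableEquiv)
      (Set.Ioo (0 : ℝ) 1 • ((fun u : USphere p => (u : Vec p)) '' s))]
  congr 3
  ext v
  simp only [Set.mem_smul, Set.mem_image, Set.mem_preimage]
  constructor
  · rintro ⟨r, hr, _, ⟨u, hu, rfl⟩, rfl⟩
    exact ⟨r, hr, _, ⟨_, hu, rfl⟩, by simp [coe_sphereEquiv]⟩
  · rintro ⟨r, hr, _, ⟨u, hu, rfl⟩, h⟩
    refine ⟨r, hr, _, ⟨(sphereEquiv L).symm u, by simpa using hu, rfl⟩, ?_⟩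
    apply L.injective
    rw [map_smul]
    have : L ((sphereEquiv L).symm u : Vec p) = u := by
      rw [← coe_sphereEquiv, Homeomorph.apply_symm_apply]
    rw [this]
    exact h

lemma integral_sphereEquiv (L : Vec p ≃ₗᵢ[ℝ] Vec p) (φ : USphere p → ℝ) :
    ∫ u, φ (sphereEquiv L u) ∂uniformSphere p = ∫ u, φ u ∂uniformSphere p :=
  (measurePreserving_sphereEquiv L).integral_comp (sphereEquiv L).measurableEmbedding φ

lemma integrable_of_continuous (hp : 0 < p) {φ : USphere p → ℝ} (hφ : Continuous φ) :
    Integrable φ (uniformSphere p) :=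
  have := isProbabilityMeasure_uniformSphere hp
  hφ.integrable_of_hasCompactSupport (HasCompactSupport.of_compactSpace φ)

/-- The uniform distribution on the sphere is isotropic. -/
lemma integral_inner_sq (hp : 0 < p) (e : Vec p) :
    ∫ u : USphere p, (inner ℝ (u : Vec p) e) ^ 2 ∂uniformSphere p = ‖e‖ ^ 2 / p := by
  have := isProbabilityMeasure_uniformSphere hp
  have hp' : (p : ℝ) ≠ 0 := by positivity
  have h1 : ∀ k : Fin p, ∫ u : USphere p, (inner ℝ (u : Vec p) e) ^ 2 ∂uniformSphere p
      = ‖e‖ ^ 2 * ∫ u : USphere p, ((u : Vec p) k) ^ 2 ∂uniformSphere p := by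
    intro k
    set b : Vec p := ‖e‖ • EuclideanSpace.single k 1
    have hb : ‖e‖ = ‖b‖ := by simp [b, norm_smul]
    have hL : (ℝ ∙ (e - b))ᗮ.reflection e = b := Submodule.reflection_sub hb
    rw [← integral_const_mul, ← integral_sphereEquiv ((ℝ ∙ (e - b))ᗮ.reflection)
      (fun u => ‖e‖ ^ 2 * ((u : Vec p) k) ^ 2)]
    refine integral_congr_ae (Filter.Eventually.of_forall fun u => ?_)
    have h : inner ℝ (u : Vec p) e
        = inner ℝ ((ℝ ∙ (e - b))ᗮ.reflection (u : Vec p)) b := by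
      have := LinearIsometryEquiv.inner_map_map ((ℝ ∙ (e - b))ᗮ.reflection) (u : Vec p) e
      rw [hL] at this
      exact this.symm
    simp only [h, coe_sphereEquiv, b, inner_smul_right, EuclideanSpace.inner_single_right]
    simp
    ring
  have h2 := Finset.sum_congr (rfl : (Finset.univ : Finset (Fin p)) = _) fun k _ => h1 k
  rw [← Finset.mul_sum, Finset.sum_const, ← integral_finsetSum _ fun k _ =>
    integrable_of_continuous hp (by fun_prop)] at h2
  have h3 : ∀ u : USphere p, ∑ k, ((u : Vec p) k) ^ 2 = 1 := by
    intro u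
    rw [← EuclideanSpace.real_norm_sq_eq]
    simp
  simp only [h3, integral_const, probReal_univ, smul_eq_mul, Finset.card_univ,
    Fintype.card_fin, nsmul_eq_mul, mul_one] at h2
  rw [eq_div_iff hp', mul_comm]
  exact h2

end Sphere

/-! ### The one-point gradient estimate of a convex function -/

section OnePoint

/-- A discrete form of the comparison between the increment of a convex function over `[-c, c]`
and its mean decrease under a unit shift to the left. -/
lemma convex_increment_ge {S : Set ℝ} {ℓ : ℝ → ℝ} (hℓ : ConvexOn ℝ S ℓ) {c M : ℝ} (hc : 0 ≤ c)
    (h1 : -c - 1 ∈ S) (h2 : c ∈ S) (hM1 : ℓ (-c - 1) ≤ M) (hM2 : ℓ (c - 1) ≤ M) :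
    2 * c * (ℓ 0 - M) ≤ ℓ c - ℓ (-c) := by
  have hmem : ∀ s, -c - 1 ≤ s → s ≤ c → s ∈ S := fun s hs hs' =>
    hℓ.1.ordConnected.out h1 h2 ⟨hs, hs'⟩
  -- convexity between three points, without denominators
  have key : ∀ x y v, -c - 1 ≤ x → x ≤ y → y ≤ v → v ≤ c →
      (v - x) * ℓ y ≤ (v - y) * ℓ x + (y - x) * ℓ v := by
    intro x y v hx hxy hyv hv
    rcases (hxy.trans hyv).eq_or_lt with h | h
    · have h3 : y = x := le_antisymm (hyv.trans h.ge) hxy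
      subst h3; subst h; simp
    · have hpos : 0 < v - x := by linarith
      have h3 := hℓ.2 (hmem x hx (by linarith)) (hmem v (by linarith) hv)
        (show 0 ≤ (v - y) / (v - x) from div_nonneg (by linarith) hpos.le)
        (show 0 ≤ (y - x) / (v - x) from div_nonneg (by linarith) hpos.le)
        (by field_simp; ring)
      have h4 : ((v - y) / (v - x)) • x + ((y - x) / (v - x)) • v = y := by
        simp only [smul_eq_mul]; field_simp; ring
      rw [h4] at h3
      have h5 := mul_le_mul_of_nonneg_left h3 hpos.le
      refine h5.trans_eq ?_
      simp only [smul_eq_mul]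
      field_simp
  have k0 := key (-c) 0 c (by linarith) (by linarith) hc le_rfl
  rcases hc.eq_or_lt with rfl | hc0
  · simp
  have hmid : 2 * ℓ 0 ≤ ℓ (-c) + ℓ c := by
    by_contra! h
    nlinarith
  rcases le_or_gt (ℓ 0) (ℓ (-c)) with hle | hlt
  · have k1 := key (-c - 1) (-c) c le_rfl (by linarith) (by linarith) le_rfl
    nlinarith
  rcases le_or_gt 1 c with h1c | h1c
  · have k2 := key (-c) 0 (c - 1) (by linarith) (by linarith) (by linarith) (by linarith)
    have : ℓ 0 ≤ ℓ (c - 1) := by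
      by_contra! h
      nlinarith
    nlinarith
  rcases le_or_gt (1 / 2) c with h2c | h2c
  · have k2 := key (c - 1) 0 c (by linarith) (by linarith) (by linarith) le_rfl
    nlinarith
  · have k2 := key (c - 1) (-c) c (by linarith) (by linarith) (by linarith) le_rfl
    nlinarith

variable {p : ℕ} {X : Set (Vec p)} {h : Vec p → ℝ} {δ M : ℝ} {z y : Vec p}

/-- The pointwise inequality behind the one-point gradient estimate: `u - (2 * c) • (z - y)` is the
reflection of `u` in the hyperplane orthogonal to `z - y`. -/
lemma reflected_increment_ge (hh : ConvexOn ℝ X h) (hδ : 0 < δ)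
    (hz : ∀ v : Vec p, ‖v‖ ≤ 1 → z + δ • v ∈ X) (hy : ∀ v : Vec p, ‖v‖ ≤ 1 → y + δ • v ∈ X)
    (hM : ∀ v : Vec p, ‖v‖ ≤ 1 → h (y + δ • v) ≤ M) {u : Vec p} {c : ℝ} (hu : ‖u‖ ≤ 1)
    (hu' : ‖u - (2 * c) • (z - y)‖ ≤ 1) :
    2 * δ * c ^ 2 * (h (z + δ • (u - c • (z - y))) - M)
      ≤ c * (h (z + δ • u) - h (z + δ • (u - (2 * c) • (z - y)))) := by
  -- by symmetry `c` may be assumed nonnegative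
  wlog hc : 0 ≤ c generalizing u c
  · have h1 := this (u := u - (2 * c) • (z - y)) (c := -c) hu' (by
      convert hu using 2
      module) (by linarith)
    have e1 : u - (2 * c) • (z - y) - -c • (z - y) = u - c • (z - y) := by module
    have e2 : u - (2 * c) • (z - y) - (2 * -c) • (z - y) = u := by module
    rw [e1, e2] at h1
    linarith
  set e := z - y with he
  set mid := z + δ • (u - c • e) with hmid
  let ψ : ℝ →ᵃ[ℝ] Vec p := AffineMap.lineMap mid (mid + e)
  have hψ : ∀ s, ψ s = mid + s • e := by
    intro s
    simp [ψ, AffineMap.lineMap_apply, add_comm]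
  have hconv : ConvexOn ℝ (ψ ⁻¹' X) (h ∘ ψ) := hh.comp_affineMap ψ
  have e1 : ψ (-(δ * c) - 1) = y + δ • (u - (2 * c) • e) := by
    rw [hψ, hmid]
    have : z = e + y := by rw [he]; abel
    rw [this]
    module
  have e2 : ψ (δ * c) = z + δ • u := by
    rw [hψ, hmid]; module
  have e3 : ψ (δ * c - 1) = y + δ • u := by
    rw [hψ, hmid]
    have : z = e + y := by rw [he]; abel
    rw [this]
    module
  have e4 : ψ (-(δ * c)) = z + δ • (u - (2 * c) • e) := by
    rw [hψ, hmid]; module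
  have e5 : ψ 0 = mid := by rw [hψ]; simp
  have h1 := convex_increment_ge hconv (c := δ * c) (M := M) (by positivity)
    (by rw [Set.mem_preimage, e1]; exact hy _ hu')
    (by rw [Set.mem_preimage, e2]; exact hz _ hu)
    (by simp only [Function.comp_apply, e1]; exact hM _ hu')
    (by simp only [Function.comp_apply, e3]; exact hM _ hu)
  simp only [Function.comp_apply, e2, e4, e5] at h1
  calc 2 * δ * c ^ 2 * (h mid - M) = c * (2 * (δ * c) * (h mid - M)) := by ring
    _ ≤ _ := mul_le_mul_of_nonneg_left h1 hc

/-- The one-point gradient estimator of a convex function is, in expectation, at least as good as a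
subgradient at `z`, up to the oscillation of the function on the ball of radius `δ` around the
comparator `y`. -/
lemma le_integral_inner_gradEst (hp : 0 < p) (hh : ConvexOn ℝ X h) (hcont : ContinuousOn h X)
    (hδ : 0 < δ) (hz : ∀ v : Vec p, ‖v‖ ≤ 1 → z + δ • v ∈ X)
    (hy : ∀ v : Vec p, ‖v‖ ≤ 1 → y + δ • v ∈ X)
    (hM : ∀ v : Vec p, ‖v‖ ≤ 1 → h (y + δ • v) ≤ M) :
    h z - M ≤ ∫ u : USphere p, inner ℝ (gradEst δ h z u) (z - y) ∂uniformSphere p := by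
  have := isProbabilityMeasure_uniformSphere hp
  have hp' : (0 : ℝ) < p := by positivity
  by_cases hzy : z = y
  · have h1 := hM 0 (by simp)
    subst hzy
    simp at h1 ⊢
    exact h1
  set e := z - y with he
  have he0 : 0 < ‖e‖ := norm_pos_iff.2 (sub_ne_zero.2 hzy)
  let ρ : Vec p ≃ₗᵢ[ℝ] Vec p := (ℝ ∙ e)ᗮ.reflection
  let c : Vec p → ℝ := fun u => inner ℝ u e / ‖e‖ ^ 2
  have hρ : ∀ u, ρ u = u - (2 * c u) • e := by
    intro u
    simp only [ρ, c, Submodule.reflection_orthogonal_apply, Submodule.reflection_singleton_apply]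
    rw [real_inner_comm]
    simp
    module
  have hce : ∀ u, c u * ‖e‖ ^ 2 = inner ℝ u e := by
    intro u; simp only [c]; field_simp
  have hρn : ∀ u : USphere p, ‖(u : Vec p) - (2 * c u) • e‖ ≤ 1 := by
    intro u; rw [← hρ]; simp
  have hmidn : ∀ u : USphere p, ‖(u : Vec p) - c u • e‖ ≤ 1 := by
    intro u
    have h1 : (u : Vec p) - c u • e = (1 / 2 : ℝ) • ((u : Vec p) + (u - (2 * c u) • e)) := by module
    rw [h1, norm_smul]
    have h2 := norm_add_le (u : Vec p) (u - (2 * c u) • e)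
    have h3 : ‖(u : Vec p)‖ = 1 := by simp
    have h4 := hρn u
    rw [Real.norm_eq_abs, abs_of_pos (by norm_num)]
    linarith
  have hun : ∀ u : USphere p, ‖(u : Vec p)‖ ≤ 1 := fun u => by simp
  have hc_cont : Continuous fun u : USphere p => c u := by simp only [c]; fun_prop
  have hA : Continuous fun u : USphere p => h (z + δ • (u : Vec p)) :=
    hcont.comp_continuous (by fun_prop) fun u => hz _ (hun u)
  have hA' : Continuous fun u : USphere p => h (z + δ • ((u : Vec p) - (2 * c u) • e)) :=
    hcont.comp_continuous (by fun_prop) fun u => hz _ (hρn u)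
  have hB : Continuous fun u : USphere p => h (z + δ • ((u : Vec p) - c u • e)) :=
    hcont.comp_continuous (by fun_prop) fun u => hz _ (hmidn u)
  have hB' : Continuous fun u : USphere p => h (z - δ • ((u : Vec p) - c u • e)) :=
    hcont.comp_continuous (by fun_prop) fun u => by
      rw [sub_eq_add_neg, ← smul_neg]
      exact hz _ (by rw [norm_neg]; exact hmidn u)
  have hcA : Continuous fun u : USphere p => c u * h (z + δ • (u : Vec p)) := hc_cont.mul hA
  have hcA' : Continuous fun u : USphere p =>
      c u * h (z + δ • ((u : Vec p) - (2 * c u) • e)) := hc_cont.mul hA'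
  have hcB : Continuous fun u : USphere p =>
      c u ^ 2 * h (z + δ • ((u : Vec p) - c u • e)) := (hc_cont.pow 2).mul hB
  have hcB' : Continuous fun u : USphere p =>
      c u ^ 2 * h (z - δ • ((u : Vec p) - c u • e)) := (hc_cont.pow 2).mul hB'
  -- reflecting `u` changes the sign of `c u`
  have hrefl : ∫ u : USphere p, c u * h (z + δ • ((u : Vec p) - (2 * c u) • e)) ∂uniformSphere p
      = - ∫ u : USphere p, c u * h (z + δ • (u : Vec p)) ∂uniformSphere p := by
    rw [← integral_sphereEquiv ρ, ← integral_neg]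
    refine integral_congr_ae (Filter.Eventually.of_forall fun u => ?_)
    have h1 : c (ρ u) = - c u := by
      rw [hρ]
      simp only [c, inner_sub_left, inner_smul_left, real_inner_self_eq_norm_sq]
      simp
      field_simp
      ring
    simp only [coe_sphereEquiv, h1]
    have h2 : ρ (u : Vec p) - (2 * - c u) • e = u := by rw [hρ]; module
    rw [h2]
    ring
  have hneg : ∫ u : USphere p, c u ^ 2 * h (z - δ • ((u : Vec p) - c u • e)) ∂uniformSphere p
      = ∫ u : USphere p, c u ^ 2 * h (z + δ • ((u : Vec p) - c u • e)) ∂uniformSphere p := by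
    rw [← integral_sphereEquiv (LinearIsometryEquiv.neg ℝ)]
    refine integral_congr_ae (Filter.Eventually.of_forall fun u => ?_)
    have h1 : c (-u) = - c u := by simp only [c, inner_neg_left]; ring
    simp only [coe_sphereEquiv, LinearIsometryEquiv.coe_neg, h1]
    have h2 : z - δ • (-(u : Vec p) - -c u • e) = z + δ • ((u : Vec p) - c u • e) := by module
    rw [h2]
    ring
  have hsq : ∫ u : USphere p, c u ^ 2 ∂uniformSphere p = 1 / (p * ‖e‖ ^ 2) := by
    have : ∀ u : USphere p, c u ^ 2 = (inner ℝ (u : Vec p) e) ^ 2 / (‖e‖ ^ 2) ^ 2 := by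
      intro u; simp only [c, div_pow]
    simp only [this]
    rw [integral_div, integral_inner_sq hp]
    field_simp
  -- Jensen's inequality for the pair of opposite points
  have hJ : 1 / (p * ‖e‖ ^ 2) * h z
      ≤ ∫ u : USphere p, c u ^ 2 * h (z + δ • ((u : Vec p) - c u • e)) ∂uniformSphere p := by
    have h1 : ∫ u : USphere p, c u ^ 2 * (2 * h z) ∂uniformSphere p
        ≤ ∫ u : USphere p, (c u ^ 2 * h (z + δ • ((u : Vec p) - c u • e))
          + c u ^ 2 * h (z - δ • ((u : Vec p) - c u • e))) ∂uniformSphere p := by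
      refine integral_mono (integrable_of_continuous hp (by fun_prop))
        (integrable_of_continuous hp (hcB.add hcB')) fun u => ?_
      have hm1 : z + δ • ((u : Vec p) - c u • e) ∈ X := hz _ (hmidn u)
      have hm2 : z - δ • ((u : Vec p) - c u • e) ∈ X := by
        rw [sub_eq_add_neg, ← smul_neg]
        exact hz _ (by rw [norm_neg]; exact hmidn u)
      have h2 := hh.2 hm1 hm2 (show (0 : ℝ) ≤ 1 / 2 by norm_num)
        (show (0 : ℝ) ≤ 1 / 2 by norm_num) (by norm_num)
      have h3 : (1 / 2 : ℝ) • (z + δ • ((u : Vec p) - c u • e))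
          + (1 / 2 : ℝ) • (z - δ • ((u : Vec p) - c u • e)) = z := by module
      rw [h3] at h2
      simp only [smul_eq_mul] at h2
      have h4 := mul_le_mul_of_nonneg_left h2 (sq_nonneg (c u))
      dsimp only
      linarith
    rw [integral_mul_const, hsq, integral_add (integrable_of_continuous hp hcB)
      (integrable_of_continuous hp hcB'), hneg] at h1
    linarith
  have hmain : ∫ u : USphere p, 2 * δ * (c u ^ 2 * h (z + δ • ((u : Vec p) - c u • e)) - c u ^ 2 * M)
        ∂uniformSphere p
      ≤ ∫ u : USphere p, (c u * h (z + δ • (u : Vec p))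
        - c u * h (z + δ • ((u : Vec p) - (2 * c u) • e))) ∂uniformSphere p := by
    refine integral_mono (integrable_of_continuous hp
        (continuous_const.mul (hcB.sub ((hc_cont.pow 2).mul continuous_const))))
      (integrable_of_continuous hp (hcA.sub hcA')) fun u => ?_
    have := reflected_increment_ge hh hδ hz hy hM (hun u) (hρn u)
    dsimp only
    linarith
  rw [integral_const_mul, integral_sub (integrable_of_continuous hp hcB)
    (integrable_of_continuous hp (by fun_prop)), integral_mul_const, hsq, integral_sub
    (integrable_of_continuous hp hcA) (integrable_of_continuous hp hcA'),
    hrefl] at hmain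
  have hfin : ∫ u : USphere p, inner ℝ (gradEst δ h z u) e ∂uniformSphere p
      = p / δ * ‖e‖ ^ 2 * ∫ u : USphere p, c u * h (z + δ • (u : Vec p)) ∂uniformSphere p := by
    rw [← integral_const_mul]
    refine integral_congr_ae (Filter.Eventually.of_forall fun u => ?_)
    simp only [gradEst]
    rw [real_inner_smul_left, ← hce]
    ring
  rw [hfin]
  have h6 : δ * (1 / (p * ‖e‖ ^ 2) * h z - 1 / (p * ‖e‖ ^ 2) * M)
      ≤ ∫ u : USphere p, c u * h (z + δ • (u : Vec p)) ∂uniformSphere p := by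
    nlinarith
  have h7 := mul_le_mul_of_nonneg_left h6 (show 0 ≤ p / δ * ‖e‖ ^ 2 by positivity)
  refine le_trans (le_of_eq ?_) h7
  field_simp

end OnePoint

/-! ### The expected excess of one round -/

section Smoothing

variable {p : ℕ} {X : Set (Vec p)} {h : Vec p → ℝ} {F G : ℝ}

lemma NiceOn.sub_le (hh : NiceOn X h F G) {x y : Vec p} (hx : x ∈ X) (hy : y ∈ X) :
    h x - h y ≤ G * ‖x - y‖ :=
  (le_abs_self _).trans
    (hh.convex.1.norm_image_sub_le_of_norm_fderivWithin_le hh.differentiable hh.grad_bounded hy hx)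

/-- Points of the shrunk set `(1 - ξ) X` are centres of balls of radius `r ξ` inside `X`. -/
lemma add_smul_mem_of_mem_shrink {r ξ : ℝ} (hX : Convex ℝ X) (hr : 0 < r)
    (hball : Metric.closedBall 0 r ⊆ X) (hξ0 : 0 < ξ) (hξ1 : ξ < 1) {z v : Vec p}
    (hz : z ∈ (1 - ξ) • X) (hv : ‖v‖ ≤ 1) : z + (r * ξ) • v ∈ X := by
  obtain ⟨x, hx, rfl⟩ := hz
  have hrv : r • v ∈ X := hball (by
    rw [mem_closedBall_zero_iff, norm_smul, Real.norm_eq_abs, abs_of_pos hr]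
    exact mul_le_of_le_one_right hr.le hv)
  have := hX hx hrv (show 0 ≤ 1 - ξ by linarith) hξ0.le (by ring)
  rwa [smul_smul, mul_comm ξ r] at this

/-- The expected excess of one bandit round: playing `z + δ u` instead of `y` costs at most the
linearized loss of the gradient estimator plus the errors of exploration, smoothing and
shrinking. -/
lemma NiceOn.integral_le (hp : 0 < p) (hh : NiceOn X h F G) {r R ξ : ℝ} (hr : 0 < r)
    (hball : Metric.closedBall 0 r ⊆ X) (hR : X ⊆ Metric.closedBall 0 R) (hξ0 : 0 < ξ)
    (hξ1 : ξ < 1) (hG : 0 ≤ G) {z y : Vec p} (hz : z ∈ (1 - ξ) • X) (hy : y ∈ X) :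
    ∫ u : USphere p, (h (z + (r * ξ) • (u : Vec p)) - h y
      - inner ℝ (gradEst (r * ξ) h z u) (z - (1 - ξ) • y) - G * (2 * r + R) * ξ)
        ∂uniformSphere p ≤ 0 := by
  have := isProbabilityMeasure_uniformSphere hp
  have hX := hh.convex.1
  have hδ : 0 < r * ξ := by positivity
  have hcont : ContinuousOn h X := hh.differentiable.continuousOn
  have hzb : ∀ v : Vec p, ‖v‖ ≤ 1 → z + (r * ξ) • v ∈ X := fun v hv =>
    add_smul_mem_of_mem_shrink hX hr hball hξ0 hξ1 hz hv
  have hyb : ∀ v : Vec p, ‖v‖ ≤ 1 → (1 - ξ) • y + (r * ξ) • v ∈ X := fun v hv =>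
    add_smul_mem_of_mem_shrink hX hr hball hξ0 hξ1 ⟨y, hy, rfl⟩ hv
  have hzX : z ∈ X := by simpa using hzb 0 (by simp)
  have hyX : (1 - ξ) • y ∈ X := by simpa using hyb 0 (by simp)
  have hyR : ‖y‖ ≤ R := by simpa using hR hy
  have hsm := le_integral_inner_gradEst (M := h ((1 - ξ) • y) + G * (r * ξ)) hp hh.convex hcont hδ
    hzb hyb (fun v hv => by
      have h1 := hh.sub_le (hyb v hv) hyX
      rw [add_sub_cancel_left, norm_smul, Real.norm_eq_abs, abs_of_pos hδ] at h1
      have h2 : G * (r * ξ * ‖v‖) ≤ G * (r * ξ) :=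
        mul_le_mul_of_nonneg_left (mul_le_of_le_one_right hδ.le hv) hG
      linarith)
  have hshr : h ((1 - ξ) • y) - h y ≤ G * (R * ξ) := by
    refine (hh.sub_le hyX hy).trans ?_
    have h1 : (1 - ξ) • y - y = -(ξ • y) := by module
    rw [h1, norm_neg, norm_smul, Real.norm_eq_abs, abs_of_pos hξ0, mul_comm ξ]
    gcongr
  have hun : ∀ u : USphere p, ‖(u : Vec p)‖ ≤ 1 := fun u => by simp
  have hA : Continuous fun u : USphere p => h (z + (r * ξ) • (u : Vec p)) :=
    hcont.comp_continuous (by fun_prop) fun u => hzb _ (hun u)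
  have hB : Continuous fun u : USphere p =>
      inner ℝ (gradEst (r * ξ) h z u) (z - (1 - ξ) • y) := by
    simp only [gradEst]
    exact ((continuous_const.mul hA).smul continuous_subtype_val).inner continuous_const
  calc ∫ u : USphere p, (h (z + (r * ξ) • (u : Vec p)) - h y
      - inner ℝ (gradEst (r * ξ) h z u) (z - (1 - ξ) • y) - G * (2 * r + R) * ξ)
        ∂uniformSphere p
      ≤ ∫ u : USphere p, (h z + G * (r * ξ) - h y - G * (2 * r + R) * ξ
        - inner ℝ (gradEst (r * ξ) h z u) (z - (1 - ξ) • y)) ∂uniformSphere p := by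
        refine integral_mono (integrable_of_continuous hp
            (((hA.sub continuous_const).sub hB).sub continuous_const))
          (integrable_of_continuous hp (continuous_const.sub hB)) fun u => ?_
        have h1 := hh.sub_le (hzb _ (hun u)) hzX
        rw [add_sub_cancel_left, norm_smul, Real.norm_eq_abs, abs_of_pos hδ] at h1
        have h3 : ‖(u : Vec p)‖ = 1 := by simp
        rw [h3, mul_one] at h1
        dsimp only
        linarith
    _ = h z + G * (r * ξ) - h y - G * (2 * r + R) * ξ
        - ∫ u : USphere p, inner ℝ (gradEst (r * ξ) h z u) (z - (1 - ξ) • y)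
          ∂uniformSphere p := by
        rw [integral_sub (integrable_const _) (integrable_of_continuous hp hB)]
        simp
    _ ≤ 0 := by
        have : G * (2 * r + R) * ξ = G * (r * ξ) + G * (r * ξ) + G * (R * ξ) := by ring
        linarith

end Smoothing

/-! ### Random functions and independence -/

section Measurability

/-- A random function that is continuous on `X` and pointwise measurable may be evaluated at a
random point of `X`. -/
lemma measurable_comp_of_continuousOn {Ω : Type*} [MeasurableSpace Ω] {p : ℕ} {X : Set (Vec p)}
    {F : Ω → Vec p → ℝ} (hF : ∀ ω, ContinuousOn (F ω) X)
    (hm : ∀ x ∈ X, Measurable fun ω => F ω x) {ζ : Ω → Vec p} (hζ : Measurable ζ)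
    (hX : ∀ ω, ζ ω ∈ X) : Measurable fun ω => F ω (ζ ω) := by
  have h1 : Measurable (Function.uncurry fun (x : X) (ω : Ω) => F ω x) :=
    measurable_uncurry_of_continuous_of_measurable
      (fun ω => continuousOn_iff_continuous_domRestrict.1 (hF ω)) fun x => hm x x.2
  exact h1.comp ((hζ.subtype_mk (h := hX)).prodMk measurable_id)

/-- A function of two independent random variables has nonpositive expectation if all its
expectations with respect to the second variable are nonpositive. -/
lemma integral_nonpos_of_indepFun {Ω Ω' S : Type*} [MeasurableSpace Ω] [MeasurableSpace Ω']
    [MeasurableSpace S] {P : Measure Ω} [IsProbabilityMeasure P] {Y : Ω → Ω'} {U : Ω → S}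
    (hY : Measurable Y) (hU : Measurable U) (hind : IndepFun Y U P) {Φ : Ω' × S → ℝ}
    (hΦ : Measurable Φ) {C : ℝ} (hC : ∀ x, |Φ x| ≤ C)
    (hneg : ∀ x, ∫ s, Φ (x, s) ∂(P.map U) ≤ 0) : ∫ ω, Φ (Y ω, U ω) ∂P ≤ 0 := by
  have := Measure.isProbabilityMeasure_map hY.aemeasurable (μ := P)
  have := Measure.isProbabilityMeasure_map hU.aemeasurable (μ := P)
  rw [← integral_map (φ := fun ω => (Y ω, U ω)) (hY.prodMk hU).aemeasurable
    hΦ.aestronglyMeasurable,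
    (indepFun_iff_map_prod_eq_prod_map_map hY.aemeasurable hU.aemeasurable).1 hind,
    integral_prod _ (Integrable.of_bound hΦ.aestronglyMeasurable C
      (Filter.Eventually.of_forall hC))]
  exact integral_nonpos hneg

end Measurability

section Past

variable {Ω : Type*} {n : ℕ} {p : Fin n → ℕ} {u : ∀ i, ℕ → Ω → USphere (p i)}

lemma past_le [mΩ : MeasurableSpace Ω] (hu : ∀ i t, 1 ≤ t → Measurable (u i t)) (t : ℕ) :
    past u t ≤ mΩ :=
  iSup_le fun i => iSup_le fun s => iSup_le fun hs => (hu i s hs.1).comap_le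

lemma past_mono {s t : ℕ} (hst : s ≤ t) : past u s ≤ past u t :=
  iSup_le fun i => iSup_le fun k => iSup_le fun hk =>
    le_iSup_of_le i (le_iSup_of_le k (le_iSup_of_le ⟨hk.1, hk.2.trans_le hst⟩ le_rfl))

lemma measurable_past_succ {t : ℕ} (ht : 1 ≤ t) (i : Fin n) :
    Measurable[past u (t + 1)] (u i t) := by
  refine measurable_iff_comap_le.2 ?_
  exact le_iSup_of_le i (le_iSup_of_le t (le_iSup_of_le ⟨ht, Nat.lt_succ_self t⟩ le_rfl))

/-- The direction of round `t` is independent of the past. -/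
lemma indep_past [mΩ : MeasurableSpace Ω] {P : Measure Ω}
    (hu : ∀ i t, 1 ≤ t → Measurable (u i t))
    (hind : iIndepFun (fun (k : Fin n × ℕ+) (ω : Ω) => u k.1 (k.2 : ℕ) ω) P)
    {t : ℕ} (ht : 1 ≤ t) (i : Fin n) :
    Indep (past u t) (MeasurableSpace.comap (u i t) inferInstance) P := by
  have h := indep_iSup_of_disjoint (S := {k : Fin n × ℕ+ | (k.2 : ℕ) < t})
    (T := {k : Fin n × ℕ+ | k = (i, ⟨t, ht⟩)})
    (fun k => (hu k.1 k.2 k.2.2).comap_le) ((iIndepFun_iff_iIndep _ _ _).1 hind)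
    (by
      rw [Set.disjoint_left]
      rintro k hk rfl
      exact lt_irrefl t hk)
  refine indep_of_indep_of_le_left (indep_of_indep_of_le_right h ?_) ?_
  · exact le_iSup₂_of_le (i, ⟨t, ht⟩) rfl le_rfl
  · refine iSup_le fun j => iSup_le fun s => iSup_le fun hs => ?_
    exact le_iSup₂_of_le (f := fun (k : Fin n × ℕ+) (_ : k ∈ {k : Fin n × ℕ+ | (k.2 : ℕ) < t}) =>
      MeasurableSpace.comap (fun ω => u k.1 (k.2 : ℕ) ω) inferInstance) (j, ⟨s, hs.1⟩) hs.2 le_rfl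

end Past

/-! ### The excess of a round as a random variable -/

/-- The excess of one bandit round for the function `h`: the loss difference between `z + δ • u` and
`y`, minus its linearization by the gradient estimator at the shrunk comparator `(1 - ξ) • y`, minus
an allowance `K` for errors. -/
noncomputable def excess {p : ℕ} (h : Vec p → ℝ) (δ ξ K : ℝ) (z y u : Vec p) : ℝ :=
  h (z + δ • u) - h y - inner ℝ (gradEst δ h z u) (z - (1 - ξ) • y) - K

section Excess

variable {p : ℕ} {X : Set (Vec p)} {F G r R ξ : ℝ}

lemma abs_excess_le {h : Vec p → ℝ} (hh : NiceOn X h F G) (hr : 0 < r)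
    (hball : Metric.closedBall 0 r ⊆ X) (hR : X ⊆ Metric.closedBall 0 R) (hξ0 : 0 < ξ)
    (hξ1 : ξ < 1) {K : ℝ} {z y u : Vec p} (hz : z ∈ (1 - ξ) • X) (hy : y ∈ X) (hu : ‖u‖ = 1) :
    |excess h (r * ξ) ξ K z y u| ≤ 2 * F + p / (r * ξ) * F * (2 * R) + |K| := by
  have hδ : 0 < r * ξ := by positivity
  have hmem := add_smul_mem_of_mem_shrink hh.convex.1 hr hball hξ0 hξ1 hz hu.le
  have h1 := hh.bounded _ hmem
  have h2 := hh.bounded _ hy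
  have h3 := norm_gradEst_le hδ hu h1
  have hshr : ∀ v ∈ X, ‖(1 - ξ) • v‖ ≤ R := by
    intro v hv
    have hvR : ‖v‖ ≤ R := by simpa using hR hv
    rw [norm_smul, Real.norm_eq_abs, abs_of_pos (by linarith)]
    nlinarith [norm_nonneg v]
  have hzR : ‖z‖ ≤ R := by
    obtain ⟨v, hv, rfl⟩ := hz
    exact hshr v hv
  have h4 : ‖z - (1 - ξ) • y‖ ≤ 2 * R := (norm_sub_le _ _).trans (by linarith [hshr y hy])
  have h5 := (abs_real_inner_le_norm (gradEst (r * ξ) h z u) (z - (1 - ξ) • y)).trans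
    (mul_le_mul h3 h4 (norm_nonneg _) ((norm_nonneg _).trans h3))
  rw [excess]
  refine (abs_sub _ _).trans (add_le_add ((abs_sub _ _).trans (add_le_add
    ((abs_sub _ _).trans (by linarith)) h5)) le_rfl)

lemma measurable_excess {Ω : Type*} [MeasurableSpace Ω] {h : Ω → Vec p → ℝ}
    (hh : ∀ ω, NiceOn X (h ω) F G) (hm : ∀ x ∈ X, Measurable fun ω => h ω x) (hr : 0 < r)
    (hball : Metric.closedBall 0 r ⊆ X) (hξ0 : 0 < ξ)
    (hξ1 : ξ < 1) {K : ℝ} {z y u : Ω → Vec p} (hz : ∀ ω, z ω ∈ (1 - ξ) • X) (hy : ∀ ω, y ω ∈ X)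
    (hu : ∀ ω, ‖u ω‖ = 1) (hzm : Measurable z) (hym : Measurable y) (hum : Measurable u) :
    Measurable fun ω => excess (h ω) (r * ξ) ξ K (z ω) (y ω) (u ω) := by
  have hc : ∀ ω, ContinuousOn (h ω) X := fun ω => (hh ω).differentiable.continuousOn
  have h1 : Measurable fun ω => h ω (z ω + (r * ξ) • u ω) :=
    measurable_comp_of_continuousOn hc hm (by fun_prop) fun ω =>
      add_smul_mem_of_mem_shrink (hh ω).convex.1 hr hball hξ0 hξ1 (hz ω) (hu ω).le
  have h2 : Measurable fun ω => h ω (y ω) := measurable_comp_of_continuousOn hc hm hym hy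
  simp only [excess, gradEst]
  exact ((h1.sub h2).sub (((h1.const_mul _).smul hum).inner
    (hzm.sub (hym.const_smul (1 - ξ))))).sub_const K

/-- The excess of round `t`, weighted with a nonnegative quantity known before the round, has
nonpositive expectation. -/
lemma integral_mul_excess_nonpos {Ω : Type*} {m : MeasurableSpace Ω} [mΩ : MeasurableSpace Ω]
    {P : Measure Ω} [IsProbabilityMeasure P] (hmΩ : m ≤ mΩ) (hp : 0 < p)
    {u : Ω → USphere p} (hu : Measurable u) (hunif : P.map u = uniformSphere p)
    (hind : Indep m (MeasurableSpace.comap u inferInstance) P)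
    {h : Ω → Vec p → ℝ} (hh : ∀ ω, NiceOn X (h ω) F G) (hm : ∀ x ∈ X, Measurable[m] fun ω => h ω x)
    (hr : 0 < r) (hball : Metric.closedBall 0 r ⊆ X) (hR : X ⊆ Metric.closedBall 0 R)
    (hξ0 : 0 < ξ) (hξ1 : ξ < 1) (hG : 0 ≤ G) {z y : Ω → Vec p} (hz : ∀ ω, z ω ∈ (1 - ξ) • X)
    (hy : ∀ ω, y ω ∈ X) (hzm : Measurable[m] z) (hym : Measurable[m] y)
    {φ : Ω → ℝ} {C : ℝ} (hφm : Measurable[m] φ) (hφ : ∀ ω, 0 ≤ φ ω ∧ φ ω ≤ C) :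
    Integrable (fun ω => φ ω * excess (h ω) (r * ξ) ξ (G * (2 * r + R) * ξ) (z ω) (y ω) (u ω)) P ∧
    ∫ ω, φ ω * excess (h ω) (r * ξ) ξ (G * (2 * r + R) * ξ) (z ω) (y ω) (u ω) ∂P ≤ 0 := by
  set Φ : Ω × USphere p → ℝ := fun x =>
    φ x.1 * excess (h x.1) (r * ξ) ξ (G * (2 * r + R) * ξ) (z x.1) (y x.1) x.2 with hΦ
  set B := C * (2 * F + p / (r * ξ) * F * (2 * R) + |G * (2 * r + R) * ξ|) with hB
  have hΦm : Measurable[m.prod inferInstance] Φ := by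
    have h1 : Measurable[m.prod inferInstance] fun x : Ω × USphere p => φ x.1 :=
      hφm.comp (@measurable_fst _ _ m _)
    have h2 := @measurable_excess p X F G r ξ (Ω × USphere p) (m.prod inferInstance)
      (fun x => h x.1) (fun x => hh x.1) (fun x hx => (hm x hx).comp (@measurable_fst _ _ m _)) hr
      hball hξ0 hξ1 (G * (2 * r + R) * ξ) (fun x => z x.1) (fun x => y x.1) (fun x => (x.2 : Vec p))
      (fun x => hz x.1) (fun x => hy x.1) (fun x => by simp) (hzm.comp (@measurable_fst _ _ m _))
      (hym.comp (@measurable_fst _ _ m _))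
      (measurable_subtype_coe.comp (@measurable_snd _ _ m _))
    exact h1.mul h2
  have hΦB : ∀ x, |Φ x| ≤ B := by
    intro x
    rw [hΦ, hB]
    dsimp only
    rw [abs_mul, abs_of_nonneg (hφ x.1).1]
    exact mul_le_mul (hφ x.1).2 (abs_excess_le (hh x.1) hr hball hR hξ0 hξ1 (hz x.1) (hy x.1)
      (by simp)) (abs_nonneg _) ((hφ x.1).1.trans (hφ x.1).2)
  have hcomp : Measurable fun ω => Φ (ω, u ω) :=
    hΦm.comp ((measurable_id'' hmΩ).prodMk hu)
  refine ⟨Integrable.of_bound hcomp.aestronglyMeasurable B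
    (Filter.Eventually.of_forall fun ω => hΦB (ω, u ω)), ?_⟩
  refine @integral_nonpos_of_indepFun Ω Ω (USphere p) mΩ m _ P _ id u (measurable_id'' hmΩ) hu ?_
    Φ hΦm B hΦB ?_
  · have h : Indep (MeasurableSpace.comap id m) (MeasurableSpace.comap u inferInstance) P := by
      rwa [MeasurableSpace.comap_id]
    exact h
  · intro ω
    rw [hunif]
    simp only [hΦ]
    rw [integral_const_mul]
    exact mul_nonpos_of_nonneg_of_nonpos (hφ ω).1
      ((hh ω).integral_le hp hr hball hR hξ0 hξ1 hG (hz ω) (hy ω))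

end Excess

/-! ### The pathwise regret inequality -/

section Play

variable {n m : ℕ} {p : Fin n → ℕ}

/-- The gradient estimator of the Lagrangian `f + ∑ k, c k * g k`. -/
noncomputable def lagrEst {p : ℕ} (δ : ℝ) (f : Vec p → ℝ) (g : Vec p → Vec m) (c : Fin m → ℝ)
    (z u : Vec p) : Vec p :=
  gradEst δ f z u + ∑ k, c k • gradEst δ (fun v => g v k) z u

/-- The numerator of the step size of agent `i`. -/
noncomputable def stepCoeff (m : ℕ) (p : Fin n → ℕ) (b : Bounds n) (i : Fin n) : ℝ :=
  b.r i ^ 2 / (4 * m * (p i : ℝ) ^ 2 * b.Fg i ^ 2)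

/-- The sequences `z` (primal) and `q` (dual, indexed first by the constraint) obey the recursions
of the algorithm, along one realization of the functions and of the directions `u`. -/
structure IsPlay (b : Bounds n) (X : ∀ i, Set (Vec (p i))) (W : ℕ → Matrix (Fin n) (Fin n) ℝ)
    (f : ∀ i, ℕ → Vec (p i) → ℝ) (g : ∀ i, ℕ → Vec (p i) → Vec m) (u : ∀ i, ℕ → Vec (p i))
    (θ₁ θ₂ θ₃ : ℝ) (z : ∀ i, ℕ → Vec (p i)) (q : Fin m → ℕ → Fin n → ℝ) : Prop where
  dual : ∀ k, DualIteration W θ₂ (FgMax b) (q k)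
    fun t i => g i t (z i t + (b.r i * (1 / ((t : ℝ) + 1) ^ θ₃)) • u i t) k
  init_mem : ∀ i, z i 1 ∈ (1 - 1 / (((1 : ℕ) : ℝ) + 1) ^ θ₃) • X i
  primal : ∀ i t, 1 ≤ t → z i (t + 1) = proj ((1 - 1 / (((t + 1 : ℕ) : ℝ) + 1) ^ θ₃) • X i)
    (z i t - (stepCoeff m p b i / ((t : ℝ) + 1) ^ θ₁) •
      lagrEst (b.r i * (1 / ((t : ℝ) + 1) ^ θ₃)) (f i t) (g i t)
        (fun k => (W t).mulVec (q k t) i) (z i t) (u i t))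
  norm_dir : ∀ i t, ‖u i t‖ = 1

lemma Fg_le_FgMax (b : Bounds n) (i : Fin n) : b.Fg i ≤ FgMax b :=
  le_ciSup (Set.finite_range _).bddAbove i

variable {b : Bounds n} {X : ∀ i, Set (Vec (p i))} {W : ℕ → Matrix (Fin n) (Fin n) ℝ}
  {f : ∀ i, ℕ → Vec (p i) → ℝ} {g : ∀ i, ℕ → Vec (p i) → Vec m} {u : ∀ i, ℕ → Vec (p i)}
  {θ₁ θ₂ θ₃ : ℝ} {z : ∀ i, ℕ → Vec (p i)} {q : Fin m → ℕ → Fin n → ℝ}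

lemma FunctionAssumption.zero_mem (hfg : FunctionAssumption b X f g) (i : Fin n) :
    (0 : Vec (p i)) ∈ X i :=
  hfg.ball_subset i (by simpa using (hfg.r_pos i).le)

lemma FunctionAssumption.FgMax_pos (hfg : FunctionAssumption b X f g) (hn : 0 < n) :
    0 < FgMax b :=
  (hfg.Fg_pos ⟨0, hn⟩).trans_le (Fg_le_FgMax b _)

lemma FunctionAssumption.stepCoeff_pos (hfg : FunctionAssumption b X f g) (hm : 0 < m)
    (hp : ∀ i, 0 < p i) (i : Fin n) : 0 < stepCoeff m p b i := by
  have h1 := hfg.r_pos i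
  have h2 := hfg.Fg_pos i
  have h3 : (0 : ℝ) < p i := by exact_mod_cast hp i
  rw [stepCoeff]
  positivity

lemma IsPlay.mem_shrink (hP : IsPlay b X W f g u θ₁ θ₂ θ₃ z q)
    (hfg : FunctionAssumption b X f g) (hθ₃ : 0 < θ₃) (i : Fin n) {t : ℕ} (ht : 1 ≤ t) :
    z i t ∈ (1 - 1 / ((t : ℝ) + 1) ^ θ₃) • X i :=
  mem_shrink_of_proj_step (hfg.convex_set i) (hfg.closed_set i) (hfg.zero_mem i) hθ₃
    (hP.init_mem i) (hP.primal i) ht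

lemma IsPlay.decision_mem (hP : IsPlay b X W f g u θ₁ θ₂ θ₃ z q)
    (hfg : FunctionAssumption b X f g) (hθ₃ : 0 < θ₃) (i : Fin n) {t : ℕ} (ht : 1 ≤ t) :
    z i t + (b.r i * (1 / ((t : ℝ) + 1) ^ θ₃)) • u i t ∈ X i := by
  have h := shrink_mem hθ₃ ht
  exact add_smul_mem_of_mem_shrink (hfg.convex_set i) (hfg.r_pos i) (hfg.ball_subset i) h.1 h.2
    (hP.mem_shrink hfg hθ₃ i ht) (hP.norm_dir i t).le

/-- The primal part of the regret. The exponents are such that the dual variables contribute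
no more than the dual iteration can absorb. -/
lemma IsPlay.sum_inner_le (hP : IsPlay b X W f g u θ₁ θ₂ θ₃ z q)
    (hfg : FunctionAssumption b X f g) (hn : 0 < n) (hm : 0 < m) (hp : ∀ i, 0 < p i)
    (hθ₁ : θ₁ ∈ Set.Ioo (0 : ℝ) 1) (hθ₂ : θ₂ ∈ Set.Ioo (0 : ℝ) (θ₁ / 3))
    (hθ₃ : θ₃ ∈ Set.Ioc θ₂ ((θ₁ - θ₂) / 2)) {T : ℕ} (hT : 1 ≤ T) {y : ℕ → ∀ i, Vec (p i)}
    (i : Fin n) (hy : ∀ t ∈ Finset.Icc 1 T, y t i ∈ X i) :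
    ∑ t ∈ Finset.Icc 1 T, inner ℝ (lagrEst (b.r i * (1 / ((t : ℝ) + 1) ^ θ₃)) (f i t) (g i t)
        (fun k => (W t).mulVec (q k t) i) (z i t) (u i t))
        (z i t - (1 - 1 / ((t : ℝ) + 1) ^ θ₃) • y t i)
      ≤ b.Ff i ^ 2 / (4 * m * b.Fg i ^ 2 * (1 - θ₁ + 2 * θ₃)) * (T : ℝ) ^ (1 - θ₁ + 2 * θ₃)
        + ∑ t ∈ Finset.Icc 1 T, ∑ k, ((t : ℝ) + 1) ^ (-θ₂) / 4 * (W t).mulVec (q k t) i ^ 2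
        + 8 * m * (p i : ℝ) ^ 2 * b.Fg i ^ 2 * b.R i / b.r i ^ 2 * (T : ℝ) ^ θ₁
          * ∑ t ∈ Finset.Icc 1 (T - 1), ‖y (t + 1) i - y t i‖
        + (8 * m * (p i : ℝ) ^ 2 * b.Fg i ^ 2 * b.R i ^ 2 / b.r i ^ 2
          + 16 * m * (p i : ℝ) ^ 2 * b.Fg i ^ 2 * b.R i ^ 2 / b.r i ^ 2) * (T : ℝ) ^ θ₁ := by
  obtain ⟨h10, h11⟩ := hθ₁
  obtain ⟨h20, h21⟩ := hθ₂
  obtain ⟨h30, h31⟩ := hθ₃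
  have hr := hfg.r_pos i
  have hFg := hfg.Fg_pos i
  have hm' : (0 : ℝ) < m := by exact_mod_cast hm
  have hp' : (0 : ℝ) < p i := by exact_mod_cast hp i
  have hκ := hfg.stepCoeff_pos hm hp i
  have hθ₃' : 0 < θ₃ := h20.trans h30
  have hprimal := primal_regret_le (y := fun t => y t i) (hfg.convex_set i) (hfg.closed_set i)
    (hfg.zero_mem i) (hfg.subset_ball i) hκ h10 h11 hθ₃' (hP.init_mem i) (hP.primal i) hT hy
  have e1 : 2 * b.R i / stepCoeff m p b i
      = 8 * m * (p i : ℝ) ^ 2 * b.Fg i ^ 2 * b.R i / b.r i ^ 2 := by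
    rw [stepCoeff]; field_simp; ring
  have e2 : 2 * b.R i ^ 2 / stepCoeff m p b i
      = 8 * m * (p i : ℝ) ^ 2 * b.Fg i ^ 2 * b.R i ^ 2 / b.r i ^ 2 := by
    rw [stepCoeff]; field_simp; ring
  have e3 : 4 * b.R i ^ 2 / stepCoeff m p b i
      = 16 * m * (p i : ℝ) ^ 2 * b.Fg i ^ 2 * b.R i ^ 2 / b.r i ^ 2 := by
    rw [stepCoeff]; field_simp; ring
  rw [e1, e2, e3] at hprimal
  refine hprimal.trans ?_
  gcongr ?_ + _ + _
  have hterm : ∀ t ∈ Finset.Icc 1 T, stepCoeff m p b i / ((t : ℝ) + 1) ^ θ₁ / 2 *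
      ‖lagrEst (b.r i * (1 / ((t : ℝ) + 1) ^ θ₃)) (f i t) (g i t)
        (fun k => (W t).mulVec (q k t) i) (z i t) (u i t)‖ ^ 2
      ≤ b.Ff i ^ 2 / (4 * m * b.Fg i ^ 2) * ((t : ℝ) + 1) ^ (-(θ₁ - 2 * θ₃))
        + ∑ k, ((t : ℝ) + 1) ^ (-θ₂) / 4 * (W t).mulVec (q k t) i ^ 2 := by
    intro t ht
    have ht1 := (Finset.mem_Icc.1 ht).1
    have h0 : (0 : ℝ) < (t : ℝ) + 1 := by positivity
    have hmem := hP.decision_mem hfg hθ₃' i ht1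
    have h := norm_sq_gradEst_add_le (f := f i t) (g := g i t) (z := z i t) (u := u i t)
      (c := fun k => (W t).mulVec (q k t) i) (δ := b.r i * (1 / ((t : ℝ) + 1) ^ θ₃))
      (by positivity) (hP.norm_dir i t) ((hfg.loss i t ht1).bounded _ hmem)
      (fun k => (hfg.constr i t ht1 k).bounded _ hmem)
      (fun k => ((hP.dual k).mixed_bounds hn h20.le ht1 i).1)
    set Q := ∑ k, (W t).mulVec (q k t) i ^ 2 with hQ
    have hQ0 : 0 ≤ Q := Finset.sum_nonneg fun k _ => sq_nonneg _
    have hpow : ((t : ℝ) + 1) ^ (-(θ₁ - 2 * θ₃))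
        = ((t : ℝ) + 1) ^ θ₃ * ((t : ℝ) + 1) ^ θ₃ / ((t : ℝ) + 1) ^ θ₁ := by
      rw [← Real.rpow_add h0, ← Real.rpow_sub h0]
      congr 1
      ring
    have hle : ((t : ℝ) + 1) ^ (-(θ₁ - 2 * θ₃)) ≤ ((t : ℝ) + 1) ^ (-θ₂) :=
      Real.rpow_le_rpow_of_exponent_le (by linarith [(Nat.cast_nonneg t : (0 : ℝ) ≤ t)])
        (by linarith)
    rw [← Finset.mul_sum, ← hQ]
    calc _ ≤ stepCoeff m p b i / ((t : ℝ) + 1) ^ θ₁ / 2 *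
          (2 * (p i / (b.r i * (1 / ((t : ℝ) + 1) ^ θ₃))) ^ 2
            * (b.Ff i ^ 2 + m * b.Fg i ^ 2 * Q)) := by
          gcongr
          exact h
      _ = b.Ff i ^ 2 / (4 * m * b.Fg i ^ 2) * ((t : ℝ) + 1) ^ (-(θ₁ - 2 * θ₃))
          + ((t : ℝ) + 1) ^ (-(θ₁ - 2 * θ₃)) / 4 * Q := by
          rw [hpow, stepCoeff]
          field_simp
      _ ≤ _ := by gcongr
  refine (Finset.sum_le_sum hterm).trans ?_
  rw [Finset.sum_add_distrib, ← Finset.mul_sum]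
  gcongr ?_ + _
  have hs := sum_rpow_neg_le (a := θ₁ - 2 * θ₃) (by linarith) (by linarith) hT
  calc _ ≤ b.Ff i ^ 2 / (4 * m * b.Fg i ^ 2)
        * ((T : ℝ) ^ (1 - (θ₁ - 2 * θ₃)) / (1 - (θ₁ - 2 * θ₃))) := by gcongr
    _ = _ := by
        rw [show 1 - (θ₁ - 2 * θ₃) = 1 - θ₁ + 2 * θ₃ by ring]
        have : 0 < 1 - θ₁ + 2 * θ₃ := by linarith
        field_simp

/-- The error terms of the constraint functions, weighted with the dual variables. -/
lemma IsPlay.sum_mul_error_le (hP : IsPlay b X W f g u θ₁ θ₂ θ₃ z q)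
    (hfg : FunctionAssumption b X f g) (hn : 0 < n) (h20 : 0 < θ₂) (h30 : θ₂ < θ₃) (h31 : θ₃ < 1)
    {T : ℕ} (hT : 1 ≤ T) (i : Fin n) (k : Fin m) :
    ∑ t ∈ Finset.Icc 1 T, (W t).mulVec (q k t) i *
        (b.Gg i * (2 * b.r i + b.R i) * (1 / ((t : ℝ) + 1) ^ θ₃))
      ≤ FgMax b * b.Gg i * (2 * b.r i + b.R i) / (1 - θ₃ + θ₂) * (T : ℝ) ^ (1 - θ₃ + θ₂) := by
  have hr := hfg.r_pos i
  have hR := hfg.R_pos i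
  have hG := hfg.Gg_pos i
  have hF := hfg.FgMax_pos hn
  have hterm : ∀ t ∈ Finset.Icc 1 T, (W t).mulVec (q k t) i *
        (b.Gg i * (2 * b.r i + b.R i) * (1 / ((t : ℝ) + 1) ^ θ₃))
      ≤ FgMax b * b.Gg i * (2 * b.r i + b.R i) * ((t : ℝ) + 1) ^ (-(θ₃ - θ₂)) := by
    intro t ht
    have h0 : (0 : ℝ) < (t : ℝ) + 1 := by positivity
    have hpow : ((t : ℝ) + 1) ^ (-(θ₃ - θ₂)) = ((t : ℝ) + 1) ^ θ₂ * (1 / ((t : ℝ) + 1) ^ θ₃) := by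
      rw [neg_sub, Real.rpow_sub h0]; ring
    have hq : (W t).mulVec (q k t) i ≤ FgMax b * ((t : ℝ) + 1) ^ θ₂ := by
      refine ((hP.dual k).mixed_bounds hn h20.le (Finset.mem_Icc.1 ht).1 i).2.trans ?_
      have : (t : ℝ) ^ θ₂ ≤ ((t : ℝ) + 1) ^ θ₂ := by gcongr; linarith
      have h2 := mul_le_mul_of_nonneg_left this hF.le
      have h3 : 0 ≤ FgMax b * (t : ℝ) ^ θ₂ := by positivity
      linarith
    rw [hpow]
    calc _ ≤ FgMax b * ((t : ℝ) + 1) ^ θ₂ *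
          (b.Gg i * (2 * b.r i + b.R i) * (1 / ((t : ℝ) + 1) ^ θ₃)) := by gcongr
      _ = _ := by ring
  refine (Finset.sum_le_sum hterm).trans ?_
  rw [← Finset.mul_sum]
  have hs := sum_rpow_neg_le (a := θ₃ - θ₂) (by linarith) (by linarith) hT
  calc _ ≤ FgMax b * b.Gg i * (2 * b.r i + b.R i)
        * ((T : ℝ) ^ (1 - (θ₃ - θ₂)) / (1 - (θ₃ - θ₂))) := by gcongr
    _ = _ := by
        rw [show 1 - (θ₃ - θ₂) = 1 - θ₃ + θ₂ by ring]
        have : 0 < 1 - θ₃ + θ₂ := by linarith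
        field_simp

lemma sum_loss_error_le (hfg : FunctionAssumption b X f g) (h30 : 0 < θ₃) (h31 : θ₃ < 1)
    {T : ℕ} (hT : 1 ≤ T) (i : Fin n) :
    ∑ t ∈ Finset.Icc 1 T, b.Gf i * (2 * b.r i + b.R i) * (1 / ((t : ℝ) + 1) ^ θ₃)
      ≤ b.Gf i * (2 * b.r i + b.R i) / (1 - θ₃) * (T : ℝ) ^ (1 - θ₃) := by
  have hr := hfg.r_pos i
  have hR := hfg.R_pos i
  have hG := hfg.Gf_pos i
  have hs := sum_rpow_neg_le h30.le h31 hT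
  rw [← Finset.mul_sum]
  have e : ∀ t : ℕ, 1 / ((t : ℝ) + 1) ^ θ₃ = ((t : ℝ) + 1) ^ (-θ₃) := fun t => by
    rw [Real.rpow_neg (by positivity), one_div]
  simp only [e]
  calc _ ≤ b.Gf i * (2 * b.r i + b.R i) * ((T : ℝ) ^ (1 - θ₃) / (1 - θ₃)) := by gcongr
    _ = _ := by
        have : 0 < 1 - θ₃ := by linarith
        field_simp

/-- At a feasible point the constraint values, weighted with the dual variables, are controlled by
the disagreement of the latter. -/
lemma IsPlay.sum_mul_feasible_le {G : ℕ → Digraph (Fin n)} {w : ℝ} {ι : ℕ}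
    (hG : GraphAssumption G W w ι) (hP : IsPlay b X W f g u θ₁ θ₂ θ₃ z q)
    (hfg : FunctionAssumption b X f g) (hn : 0 < n) (h20 : 0 < θ₂) {T : ℕ}
    {y : ℕ → ∀ i, Vec (p i)} (hy : y ∈ feasibleSeqs X g T) (k : Fin m) :
    ∑ t ∈ Finset.Icc 1 T, ∑ i, (W t).mulVec (q k t) i * g i t (y t i) k
      ≤ 8 * n ^ 4 * ι / w * FgMax b ^ 2 *
        ∑ t ∈ Finset.Icc 1 T, ((t : ℝ) + 1) ^ (-(1 - θ₂)) := by
  have hF := hfg.FgMax_pos hn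
  have hterm : ∀ t ∈ Finset.Icc 1 T, ∑ i, (W t).mulVec (q k t) i * g i t (y t i) k
      ≤ FgMax b * ∑ i, |(W t).mulVec (q k t) i - avg (q k t)| := by
    intro t ht
    have ht1 := (Finset.mem_Icc.1 ht).1
    obtain ⟨hyX, hyg⟩ := hy t ht
    have havg : 0 ≤ avg (q k t) :=
      div_nonneg (Finset.sum_nonneg fun i _ => ((hP.dual k).bounds hn h20.le ht1 i).1)
        (Nat.cast_nonneg n)
    have hsum : ∑ i, g i t (y t i) k ≤ 0 := by simpa using hyg k
    have h1 : ∀ i, (W t).mulVec (q k t) i * g i t (y t i) k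
        ≤ FgMax b * |(W t).mulVec (q k t) i - avg (q k t)| + avg (q k t) * g i t (y t i) k := by
      intro i
      have h2 := ((hfg.constr i t ht1 k).bounded _ (hyX i)).trans (Fg_le_FgMax b i)
      have h3 : ((W t).mulVec (q k t) i - avg (q k t)) * g i t (y t i) k
          ≤ |(W t).mulVec (q k t) i - avg (q k t)| * FgMax b := by
        refine (le_abs_self _).trans ?_
        rw [abs_mul]
        gcongr
      linarith
    refine (Finset.sum_le_sum fun i _ => h1 i).trans ?_
    rw [Finset.sum_add_distrib, ← Finset.mul_sum, ← Finset.mul_sum]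
    nlinarith
  refine (Finset.sum_le_sum hterm).trans ?_
  rw [← Finset.mul_sum]
  have := mul_le_mul_of_nonneg_left ((hP.dual k).sum_abs_sub_avg_le hG hn h20.le T) hF.le
  refine this.trans_eq ?_
  ring

/-- The consensus error fits into the constant `C0`, by Bernoulli's inequality for the root in
`lambdaConst`. -/
lemma consensus_le_C0 (m : ℕ) (b : Bounds n) {G : ℕ → Digraph (Fin n)} {w : ℝ} {ι : ℕ}
    (hG : GraphAssumption G W w ι) (hn : 0 < n) :
    m * (8 * n ^ 4 * ι / w * FgMax b ^ 2) + m * (2 * n * FgMax b ^ 2) ≤ C0 m b w ι := by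
  have hw0 := hG.w_pos
  have hw1 := hG.w_lt_one
  have hι : (0 : ℝ) < ι := by exact_mod_cast hG.ι_pos
  have hn' : (1 : ℝ) ≤ n := by exact_mod_cast hn
  set η : ℝ := w / (2 * (n : ℝ) ^ 2) with hη
  have hη0 : 0 < η := by positivity
  have hη1 : η < 1 := by
    rw [hη, div_lt_one (by positivity)]
    nlinarith
  have h1η : 0 < 1 - η := by linarith
  set l := lambdaConst n w ι with hl
  have hl' : l = (1 - η) ^ (1 / (ι : ℝ)) := rfl
  have hl1 : l < 1 := by
    rw [hl']
    exact Real.rpow_lt_one h1η.le (by linarith) (by positivity)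
  have hl0 : 0 < l := by rw [hl']; positivity
  have hbern := rpow_one_add_le_one_add_mul_self (s := η / (1 - η)) (p := 1 / (ι : ℝ))
    (by have : 0 ≤ η / (1 - η) := by positivity
        linarith) (by positivity)
    (by rw [div_le_one hι]; exact_mod_cast hG.ι_pos)
  have e1 : 1 + η / (1 - η) = (1 - η)⁻¹ := by field_simp; ring
  rw [e1, Real.inv_rpow h1η.le, ← hl'] at hbern
  have hlow : 1 - l ≤ η / (ι * (1 - η)) := by
    have h1 : 1 ≤ l * (1 + 1 / ι * (η / (1 - η))) := by
      calc 1 = l * l⁻¹ := by field_simp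
        _ ≤ _ := by gcongr
    have h2 : l * (1 / ι * (η / (1 - η))) ≤ 1 * (1 / ι * (η / (1 - η))) := by gcongr
    have h3 : 1 / ι * (η / (1 - η)) = η / (ι * (1 - η)) := by field_simp
    rw [h3] at h1 h2
    linarith
  have hτ : ι / η ≤ tauConst n w / (1 - l) := by
    have hτ' : tauConst n w = ((1 - η) ^ 2)⁻¹ := rfl
    rw [hτ', le_div_iff₀ (by linarith), div_mul_eq_mul_div, div_le_iff₀ hη0]
    calc ι * (1 - l) ≤ ι * (η / (ι * (1 - η))) := by gcongr
      _ = (1 - η)⁻¹ * η := by field_simp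
      _ ≤ ((1 - η) ^ 2)⁻¹ * η := by
          gcongr
          nlinarith
  have e2 : (ι : ℝ) / η = 2 * n ^ 2 * ι / w := by rw [hη]; field_simp
  rw [e2] at hτ
  have h6 := mul_le_mul_of_nonneg_left hτ (show 0 ≤ 6 * m * (n : ℝ) ^ 2 * FgMax b ^ 2 by positivity)
  have e3 : 6 * m * (n : ℝ) ^ 2 * FgMax b ^ 2 * (2 * n ^ 2 * ι / w)
      = m * (8 * n ^ 4 * ι / w * FgMax b ^ 2) + m * (4 * n ^ 4 * ι / w * FgMax b ^ 2) := by ring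
  have e4 : 0 ≤ m * (4 * (n : ℝ) ^ 4 * ι / w * FgMax b ^ 2) := by positivity
  rw [e3, ← mul_div_assoc] at h6
  rw [C0, ← hl]
  linarith

/-- The sum of the excesses of all rounds and agents, the only random part of the regret bound. -/
noncomputable def totalExcess (b : Bounds n) (W : ℕ → Matrix (Fin n) (Fin n) ℝ)
    (f : ∀ i, ℕ → Vec (p i) → ℝ) (g : ∀ i, ℕ → Vec (p i) → Vec m) (u : ∀ i, ℕ → Vec (p i))
    (θ₃ : ℝ) (z : ∀ i, ℕ → Vec (p i)) (q : Fin m → ℕ → Fin n → ℝ) (T : ℕ)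
    (y : ℕ → ∀ i, Vec (p i)) : ℝ :=
  ∑ i, ∑ t ∈ Finset.Icc 1 T,
    (excess (f i t) (b.r i * (1 / ((t : ℝ) + 1) ^ θ₃)) (1 / ((t : ℝ) + 1) ^ θ₃)
        (b.Gf i * (2 * b.r i + b.R i) * (1 / ((t : ℝ) + 1) ^ θ₃)) (z i t) (y t i) (u i t)
      + ∑ k, (W t).mulVec (q k t) i *
        excess (fun v => g i t v k) (b.r i * (1 / ((t : ℝ) + 1) ^ θ₃)) (1 / ((t : ℝ) + 1) ^ θ₃)
          (b.Gg i * (2 * b.r i + b.R i) * (1 / ((t : ℝ) + 1) ^ θ₃)) (z i t) (y t i) (u i t))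

/-- The Lagrangian of one agent in one round, in terms of excess, linearized loss and errors. -/
lemma lagrangian_eq {p : ℕ} (f : Vec p → ℝ) (g : Vec p → Vec m) (c : Fin m → ℝ)
    (δ ξ K : ℝ) (L : ℝ) (z y u : Vec p) :
    f (z + δ • u) - f y + ∑ k, c k * g (z + δ • u) k
      = (excess f δ ξ K z y u + ∑ k, c k * excess (fun v => g v k) δ ξ L z y u)
        + inner ℝ (lagrEst δ f g c z u) (z - (1 - ξ) • y)
        + K + ∑ k, c k * L + ∑ k, c k * g y k := by
  have h : ∀ k, c k * g (z + δ • u) k = c k * excess (fun v => g v k) δ ξ L z y u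
      + c k * inner ℝ (gradEst δ (fun v => g v k) z u) (z - (1 - ξ) • y) + c k * L
      + c k * g y k := by
    intro k
    simp only [excess]
    ring
  simp only [h, Finset.sum_add_distrib, lagrEst, inner_add_left, sum_inner, inner_smul_left]
  simp only [excess]
  simp
  ring

/-- The pathwise regret inequality: `c` is any nonnegative vector of multipliers. -/
theorem IsPlay.regret_add_le {G : ℕ → Digraph (Fin n)} {w : ℝ} {ι : ℕ}
    (hG : GraphAssumption G W w ι) (hP : IsPlay b X W f g u θ₁ θ₂ θ₃ z q)
    (hfg : FunctionAssumption b X f g) (hn : 0 < n) (hm : 0 < m) (hp : ∀ i, 0 < p i)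
    (hθ₁ : θ₁ ∈ Set.Ioo (0 : ℝ) 1) (hθ₂ : θ₂ ∈ Set.Ioo (0 : ℝ) (θ₁ / 3))
    (hθ₃ : θ₃ ∈ Set.Ioc θ₂ ((θ₁ - θ₂) / 2)) {T : ℕ} (hT : 1 ≤ T) {x y : ℕ → ∀ i, Vec (p i)}
    (hx : ∀ t i, x t i = z i t + (b.r i * (1 / ((t : ℝ) + 1) ^ θ₃)) • u i t)
    (hy : y ∈ feasibleSeqs X g T) {c : Fin m → ℝ} (hc : ∀ k, 0 ≤ c k) :
    regret f T x y + ∑ k, c k * ∑ t ∈ Finset.Icc 1 T, ∑ i, g i t (x t i) k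
      ≤ n * (1 + 7 / 10 * ∑ t ∈ Finset.Icc 2 T, ((t : ℝ) + 1) ^ (-θ₂)) * ∑ k, c k ^ 2
        + totalExcess b W f g u θ₃ z q T y
        + C1 m p b w ι θ₁ θ₂ θ₃ * (T : ℝ) ^ (max θ₁ (max (1 - θ₁ + 2 * θ₃) (1 - θ₃ + θ₂)))
        + pathCoeff m p b * (T : ℝ) ^ θ₁ * pathLength T y := by
  obtain ⟨h10, h11⟩ := id hθ₁
  obtain ⟨h20, h21⟩ := id hθ₂
  obtain ⟨h30, h31⟩ := id hθ₃
  have hT' : (1 : ℝ) ≤ T := by exact_mod_cast hT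
  have hF := hfg.FgMax_pos hn
  have hm' : (0 : ℝ) < m := by exact_mod_cast hm
  set E := max θ₁ (max (1 - θ₁ + 2 * θ₃) (1 - θ₃ + θ₂)) with hE
  have hE1 : θ₁ ≤ E := le_max_left _ _
  have hE2 : 1 - θ₁ + 2 * θ₃ ≤ E := (le_max_left _ _).trans (le_max_right _ _)
  have hE3 : 1 - θ₃ + θ₂ ≤ E := (le_max_right _ _).trans (le_max_right _ _)
  have hTE : ∀ a ≤ E, (T : ℝ) ^ a ≤ (T : ℝ) ^ E := fun a ha =>
    Real.rpow_le_rpow_of_exponent_le hT' ha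
  set Sγ := ∑ t ∈ Finset.Icc 1 T, ((t : ℝ) + 1) ^ (-(1 - θ₂)) with hSγ
  have hcomm : ∀ φ : Fin n → ℕ → Fin m → ℝ, ∑ k, ∑ t ∈ Finset.Icc 1 T, ∑ i, φ i t k
      = ∑ i, ∑ t ∈ Finset.Icc 1 T, ∑ k, φ i t k := by
    intro φ
    rw [Finset.sum_comm, Finset.sum_comm (s := Finset.univ (α := Fin n))]
    exact Finset.sum_congr rfl fun t _ => Finset.sum_comm
  -- the dual iterations of all constraints
  have hdual : ∑ k, c k * ∑ t ∈ Finset.Icc 1 T, ∑ i, g i t (x t i) k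
      + ∑ i, ∑ t ∈ Finset.Icc 1 T, ∑ k, ((t : ℝ) + 1) ^ (-θ₂) / 4 * (W t).mulVec (q k t) i ^ 2
      ≤ ∑ i, ∑ t ∈ Finset.Icc 1 T, ∑ k, (W t).mulVec (q k t) i * g i t (x t i) k
        + n * (1 + 7 / 10 * ∑ t ∈ Finset.Icc 2 T, ((t : ℝ) + 1) ^ (-θ₂)) * ∑ k, c k ^ 2
        + m * (2 * n * FgMax b ^ 2) * Sγ := by
    rw [← hcomm, ← hcomm, Finset.mul_sum _ _ ((n : ℝ) * _)]
    have hconst : m * (2 * n * FgMax b ^ 2) * Sγ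
        = ∑ _k : Fin m, 2 * n * FgMax b ^ 2 * Sγ := by
      simp only [Finset.sum_const, Finset.card_univ, Fintype.card_fin, nsmul_eq_mul]
      ring
    rw [hconst, ← Finset.sum_add_distrib, ← Finset.sum_add_distrib, ← Finset.sum_add_distrib]
    refine Finset.sum_le_sum fun k _ => ?_
    have h := (hP.dual k).regret_le hn h20.le (hc k) hT
    simp only [← hx, ← Finset.mul_sum] at h ⊢
    exact h
  -- the Lagrangians of all agents
  have hlag : ∑ i, ∑ t ∈ Finset.Icc 1 T, (f i t (x t i) - f i t (y t i))
        + ∑ i, ∑ t ∈ Finset.Icc 1 T, ∑ k, (W t).mulVec (q k t) i * g i t (x t i) k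
      = totalExcess b W f g u θ₃ z q T y
        + ∑ i, ∑ t ∈ Finset.Icc 1 T, inner ℝ (lagrEst (b.r i * (1 / ((t : ℝ) + 1) ^ θ₃)) (f i t)
            (g i t) (fun k => (W t).mulVec (q k t) i) (z i t) (u i t))
            (z i t - (1 - 1 / ((t : ℝ) + 1) ^ θ₃) • y t i)
        + ∑ i, ∑ t ∈ Finset.Icc 1 T, b.Gf i * (2 * b.r i + b.R i) * (1 / ((t : ℝ) + 1) ^ θ₃)
        + ∑ i, ∑ t ∈ Finset.Icc 1 T, ∑ k, (W t).mulVec (q k t) i *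
            (b.Gg i * (2 * b.r i + b.R i) * (1 / ((t : ℝ) + 1) ^ θ₃))
        + ∑ i, ∑ t ∈ Finset.Icc 1 T, ∑ k, (W t).mulVec (q k t) i * g i t (y t i) k := by
    simp only [totalExcess, ← Finset.sum_add_distrib (s := Finset.univ (α := Fin n)),
      ← Finset.sum_add_distrib (s := Finset.Icc 1 T)]
    refine Finset.sum_congr rfl fun i _ => Finset.sum_congr rfl fun t _ => ?_
    rw [hx]
    exact lagrangian_eq _ _ _ _ _ _ _ _ _ _
  have hreg : regret f T x y = ∑ i, ∑ t ∈ Finset.Icc 1 T, (f i t (x t i) - f i t (y t i)) := by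
    rw [regret, ← Finset.sum_sub_distrib, Finset.sum_comm]
    simp only [Finset.sum_sub_distrib]
  have hpath : pathLength T y = ∑ i, ∑ t ∈ Finset.Icc 1 (T - 1), ‖y (t + 1) i - y t i‖ :=
    Finset.sum_comm
  have hfeas : ∑ i, ∑ t ∈ Finset.Icc 1 T, ∑ k, (W t).mulVec (q k t) i * g i t (y t i) k
      ≤ m * (8 * n ^ 4 * ι / w * FgMax b ^ 2) * Sγ := by
    rw [← hcomm]
    refine (Finset.sum_le_sum fun k _ => hP.sum_mul_feasible_le hG hfg hn h20 hy k).trans_eq ?_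
    simp only [Finset.sum_const, Finset.card_univ, Fintype.card_fin, nsmul_eq_mul]
    ring
  have hC0 : m * (8 * n ^ 4 * ι / w * FgMax b ^ 2) * Sγ + m * (2 * n * FgMax b ^ 2) * Sγ
      ≤ C0 m b w ι / θ₂ * (T : ℝ) ^ E := by
    have h1 := consensus_le_C0 m b hG hn
    have hw := hG.w_pos
    have h2 : 0 ≤ C0 m b w ι := le_trans (by positivity) h1
    have h3 : Sγ ≤ (T : ℝ) ^ E / θ₂ := by
      have h := sum_rpow_neg_le (a := 1 - θ₂) (by linarith) (by linarith) hT
      rw [sub_sub_cancel] at h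
      refine h.trans ?_
      gcongr
      linarith
    have h4 : 0 ≤ Sγ := Finset.sum_nonneg fun t _ => by positivity
    calc _ = (m * (8 * n ^ 4 * ι / w * FgMax b ^ 2) + m * (2 * n * FgMax b ^ 2)) * Sγ := by ring
      _ ≤ C0 m b w ι * ((T : ℝ) ^ E / θ₂) := by gcongr
      _ = _ := by ring
  have hagent : ∀ i, ∑ t ∈ Finset.Icc 1 T, inner ℝ (lagrEst (b.r i * (1 / ((t : ℝ) + 1) ^ θ₃))
            (f i t) (g i t) (fun k => (W t).mulVec (q k t) i) (z i t) (u i t))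
            (z i t - (1 - 1 / ((t : ℝ) + 1) ^ θ₃) • y t i)
        + ∑ t ∈ Finset.Icc 1 T, b.Gf i * (2 * b.r i + b.R i) * (1 / ((t : ℝ) + 1) ^ θ₃)
        + ∑ t ∈ Finset.Icc 1 T, ∑ k, (W t).mulVec (q k t) i *
            (b.Gg i * (2 * b.r i + b.R i) * (1 / ((t : ℝ) + 1) ^ θ₃))
      ≤ (m * FgMax b * b.Gg i * (2 * b.r i + b.R i) / (1 - θ₃ + θ₂)
          + b.Gf i * (2 * b.r i + b.R i) / (1 - θ₃)
          + 8 * m * (p i : ℝ) ^ 2 * b.Fg i ^ 2 * b.R i ^ 2 / b.r i ^ 2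
          + b.Ff i ^ 2 / (4 * m * b.Fg i ^ 2 * (1 - θ₁ + 2 * θ₃))
          + 16 * m * (p i : ℝ) ^ 2 * b.Fg i ^ 2 * b.R i ^ 2 / b.r i ^ 2) * (T : ℝ) ^ E
        + ∑ t ∈ Finset.Icc 1 T, ∑ k, ((t : ℝ) + 1) ^ (-θ₂) / 4 * (W t).mulVec (q k t) i ^ 2
        + pathCoeff m p b * (T : ℝ) ^ θ₁
          * ∑ t ∈ Finset.Icc 1 (T - 1), ‖y (t + 1) i - y t i‖ := by
    intro i
    have hr := hfg.r_pos i
    have hR := hfg.R_pos i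
    have hGf := hfg.Gf_pos i
    have hGg := hfg.Gg_pos i
    have hFg := hfg.Fg_pos i
    have d1 : 0 < 1 - θ₃ + θ₂ := by linarith
    have d2 : 0 < 1 - θ₃ := by linarith
    have d3 : 0 < 1 - θ₁ + 2 * θ₃ := by linarith
    have h1 := hP.sum_inner_le hfg hn hm hp hθ₁ hθ₂ hθ₃ hT i fun t ht => (hy t ht).1 i
    have h2 := sum_loss_error_le hfg (h20.trans h30) (by linarith) hT i
    have h3 : ∑ t ∈ Finset.Icc 1 T, ∑ k, (W t).mulVec (q k t) i *
            (b.Gg i * (2 * b.r i + b.R i) * (1 / ((t : ℝ) + 1) ^ θ₃))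
        ≤ m * FgMax b * b.Gg i * (2 * b.r i + b.R i) / (1 - θ₃ + θ₂)
            * (T : ℝ) ^ (1 - θ₃ + θ₂) := by
      rw [Finset.sum_comm]
      refine (Finset.sum_le_sum fun k _ => hP.sum_mul_error_le hfg hn h20 h30 (by linarith) hT i
        k).trans_eq ?_
      simp only [Finset.sum_const, Finset.card_univ, Fintype.card_fin, nsmul_eq_mul]
      ring
    have k1 := mul_le_mul_of_nonneg_left (hTE _ hE2) (show 0 ≤ b.Ff i ^ 2 /
      (4 * m * b.Fg i ^ 2 * (1 - θ₁ + 2 * θ₃)) by positivity)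
    have k2 := mul_le_mul_of_nonneg_left (hTE (1 - θ₃) (by linarith)) (show 0 ≤ b.Gf i *
      (2 * b.r i + b.R i) / (1 - θ₃) by positivity)
    have k3 := mul_le_mul_of_nonneg_left (hTE _ hE3) (show 0 ≤ m * FgMax b * b.Gg i *
      (2 * b.r i + b.R i) / (1 - θ₃ + θ₂) by positivity)
    have k4 := mul_le_mul_of_nonneg_left (hTE _ hE1) (show 0 ≤
      8 * m * (p i : ℝ) ^ 2 * b.Fg i ^ 2 * b.R i ^ 2 / b.r i ^ 2
        + 16 * m * (p i : ℝ) ^ 2 * b.Fg i ^ 2 * b.R i ^ 2 / b.r i ^ 2 by positivity)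
    have k5 : 8 * m * (p i : ℝ) ^ 2 * b.Fg i ^ 2 * b.R i / b.r i ^ 2 ≤ pathCoeff m p b :=
      le_ciSup (f := fun i => 8 * m * (p i : ℝ) ^ 2 * b.Fg i ^ 2 * b.R i / b.r i ^ 2)
        (Set.finite_range _).bddAbove i
    have k6 := mul_le_mul_of_nonneg_right k5 (show 0 ≤ (T : ℝ) ^ θ₁ *
      ∑ t ∈ Finset.Icc 1 (T - 1), ‖y (t + 1) i - y t i‖ from
      mul_nonneg (by positivity) (Finset.sum_nonneg fun t _ => norm_nonneg _))
    generalize (∑ t ∈ Finset.Icc 1 T, ∑ k, (W t).mulVec (q k t) i *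
      (b.Gg i * (2 * b.r i + b.R i) * (1 / ((t : ℝ) + 1) ^ θ₃))) = A₁ at h3 ⊢
    generalize (∑ t ∈ Finset.Icc 1 T,
      b.Gf i * (2 * b.r i + b.R i) * (1 / ((t : ℝ) + 1) ^ θ₃)) = A₂ at h2 ⊢
    linarith
  have hall := Finset.sum_le_sum fun i (_ : i ∈ Finset.univ) => hagent i
  rw [Finset.sum_add_distrib, Finset.sum_add_distrib, Finset.sum_add_distrib,
    Finset.sum_add_distrib, ← Finset.sum_mul, ← Finset.mul_sum] at hall
  rw [hreg, hpath, C1, add_mul]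
  linarith

end Play

/-! ### The algorithm as a play -/

section Run

variable {n m : ℕ} {p : Fin n → ℕ}

lemma run_succ (c : Params n) (X : ∀ i, Set (Vec (p i))) (W : ℕ → Matrix (Fin n) (Fin n) ℝ)
    (f : ∀ i, ℕ → Vec (p i) → ℝ) (g : ∀ i, ℕ → Vec (p i) → Vec m) (u : ∀ i, ℕ → Vec (p i))
    (z1 : ∀ i, Vec (p i)) {t : ℕ} (ht : 1 ≤ t) :
    run c X W f g u z1 (t + 1) = step c X (W t) (fun i => f i t) (fun i => g i t)
      (fun i => u i t) t (run c X W f g u z1 t) := by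
  obtain ⟨s, rfl⟩ := Nat.exists_eq_add_of_le' ht
  rfl

lemma sum_smul_apply (W : Matrix (Fin n) (Fin n) ℝ) (q : Fin n → Vec m) (i : Fin n) (k : Fin m) :
    (∑ j, W i j • q j) k = W.mulVec (fun j => q j k) i := by
  simp [Matrix.mulVec, dotProduct]

/-- The algorithm produces a play in the sense of `IsPlay`. -/
lemma isPlay_run {b : Bounds n} {X : ∀ i, Set (Vec (p i))} {W : ℕ → Matrix (Fin n) (Fin n) ℝ}
    {f : ∀ i, ℕ → Vec (p i) → ℝ} {g : ∀ i, ℕ → Vec (p i) → Vec m} {u : ∀ i, ℕ → Vec (p i)}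
    {θ₁ θ₂ θ₃ : ℝ} {z1 : ∀ i, Vec (p i)} {G : ℕ → Digraph (Fin n)} {w : ℝ} {ι : ℕ}
    (hG : GraphAssumption G W w ι) (hfg : FunctionAssumption b X f g)
    (hu : ∀ i t, ‖u i t‖ = 1) (hθ₃ : 0 < θ₃)
    (hz1 : ∀ i, z1 i ∈ (1 - (params m p b θ₁ θ₂ θ₃).ξ i 1) • X i) :
    IsPlay b X W f g u θ₁ θ₂ θ₃
      (fun i t => (run (params m p b θ₁ θ₂ θ₃) X W f g u z1 t).z i)
      (fun k t i => (run (params m p b θ₁ θ₂ θ₃) X W f g u z1 t).q i k) := by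
  have hprimal : ∀ i t, 1 ≤ t → (run (params m p b θ₁ θ₂ θ₃) X W f g u z1 (t + 1)).z i
      = proj ((1 - 1 / (((t + 1 : ℕ) : ℝ) + 1) ^ θ₃) • X i)
        ((run (params m p b θ₁ θ₂ θ₃) X W f g u z1 t).z i
          - (stepCoeff m p b i / ((t : ℝ) + 1) ^ θ₁) •
          lagrEst (b.r i * (1 / ((t : ℝ) + 1) ^ θ₃)) (f i t) (g i t)
            (fun k => (W t).mulVec (fun j => (run (params m p b θ₁ θ₂ θ₃) X W f g u z1 t).q j k) i)
            ((run (params m p b θ₁ θ₂ θ₃) X W f g u z1 t).z i) (u i t)) := by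
    intro i t ht
    rw [run_succ _ _ _ _ _ _ _ ht]
    simp only [step, sum_smul_apply, lagrEst, params, stepCoeff, mul_one_div, div_div,
      Nat.cast_add, Nat.cast_one]
  have hmem : ∀ i t, 1 ≤ t → (run (params m p b θ₁ θ₂ θ₃) X W f g u z1 t).z i
      + (b.r i * (1 / ((t : ℝ) + 1) ^ θ₃)) • u i t ∈ X i := by
    intro i t ht
    have h := shrink_mem hθ₃ ht
    exact add_smul_mem_of_mem_shrink (hfg.convex_set i) (hfg.r_pos i) (hfg.ball_subset i) h.1 h.2
      (mem_shrink_of_proj_step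
        (z := fun t => (run (params m p b θ₁ θ₂ θ₃) X W f g u z1 t).z i) (hfg.convex_set i)
        (hfg.closed_set i) (hfg.zero_mem i) hθ₃ (hz1 i) (hprimal i) ht) (hu i t).le
  refine ⟨fun k => ⟨fun t ht => hG.doublyStochastic ht, rfl, fun t ht i => ?_, fun t ht i => ?_⟩,
    hz1, hprimal, hu⟩
  · simp only [run_succ _ _ _ _ _ _ _ ht, step, posPart, params, PiLp.add_apply, PiLp.smul_apply,
      sum_smul_apply, smul_eq_mul, mul_one_div, Nat.cast_add, Nat.cast_one]
  · exact ((hfg.constr i t ht k).bounded _ (hmem i t ht)).trans (Fg_le_FgMax b i)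

end Run

/-! ### The expectation of the total excess -/

section RandomPlay

lemma measurable_mulVec {n : ℕ} {Ω : Type*} [MeasurableSpace Ω] (A : Matrix (Fin n) (Fin n) ℝ)
    {v : Ω → Fin n → ℝ} (hv : ∀ j, Measurable fun ω => v ω j) (i : Fin n) :
    Measurable fun ω => A.mulVec (v ω) i := by
  simp only [Matrix.mulVec, dotProduct]
  exact Finset.measurable_sum _ fun j _ => (hv j).const_mul _

variable {n m : ℕ} {p : Fin n → ℕ} {b : Bounds n} {X : ∀ i, Set (Vec (p i))}
  {W : ℕ → Matrix (Fin n) (Fin n) ℝ} {θ₁ θ₂ θ₃ : ℝ} {Ω : Type*}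
  {u : ∀ i, ℕ → Ω → USphere (p i)} {f : ∀ i, ℕ → Ω → Vec (p i) → ℝ}
  {g : ∀ i, ℕ → Ω → Vec (p i) → Vec m} {z : Ω → ∀ i, ℕ → Vec (p i)}
  {q : Ω → Fin m → ℕ → Fin n → ℝ}

/-- The primal and dual variables of round `t` depend only on the directions of the rounds before
`t`. -/
lemma measurable_play (hfg : ∀ ω, FunctionAssumption b X (fun i t => f i t ω) (fun i t => g i t ω))
    (hf : ∀ i t, 1 ≤ t → ∀ x ∈ X i, Measurable[past u t] fun ω => f i t ω x)
    (hg : ∀ i t, 1 ≤ t → ∀ x ∈ X i, Measurable[past u t] fun ω => g i t ω x)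
    (hP : ∀ ω, IsPlay b X W (fun i t => f i t ω) (fun i t => g i t ω)
      (fun i t => (u i t ω : Vec (p i))) θ₁ θ₂ θ₃ (z ω) (q ω)) (hθ₃ : 0 < θ₃)
    {z1 : ∀ i, Vec (p i)} (hz1 : ∀ ω i, z ω i 1 = z1 i) {t : ℕ} (ht : 1 ≤ t) :
    (∀ i, Measurable[past u t] fun ω => z ω i t) ∧
      ∀ k i, Measurable[past u t] fun ω => q ω k t i := by
  induction t, ht using Nat.le_induction with
  | base =>
    refine ⟨fun i => ?_, fun k i => ?_⟩
    · simp only [hz1]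
      exact measurable_const
    · have : (fun ω => q ω k 1 i) = fun _ => 0 :=
        funext fun ω => congrFun ((hP ω).dual k).init i
      rw [this]
      exact measurable_const
  | succ t ht ih =>
    obtain ⟨hz, hq⟩ := ih
    let _ : MeasurableSpace Ω := past u (t + 1)
    have hle : past u t ≤ past u (t + 1) := past_mono t.le_succ
    have hz' : ∀ i, Measurable fun ω => z ω i t := fun i => (hz i).mono hle le_rfl
    have hq' : ∀ k i, Measurable fun ω => q ω k t i := fun k i => (hq k i).mono hle le_rfl
    have hu : ∀ i, Measurable fun ω => (u i t ω : Vec (p i)) := fun i =>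
      measurable_subtype_coe.comp (measurable_past_succ ht i)
    have hx : ∀ i, Measurable fun ω =>
        z ω i t + (b.r i * (1 / ((t : ℝ) + 1) ^ θ₃)) • (u i t ω : Vec (p i)) := by
      fun_prop
    have hxX : ∀ i ω, z ω i t + (b.r i * (1 / ((t : ℝ) + 1) ^ θ₃)) • (u i t ω : Vec (p i)) ∈ X i :=
      fun i ω => (hP ω).decision_mem (hfg ω) hθ₃ i ht
    have hfx : ∀ i, Measurable fun ω => f i t ω
        (z ω i t + (b.r i * (1 / ((t : ℝ) + 1) ^ θ₃)) • (u i t ω : Vec (p i))) := fun i =>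
      measurable_comp_of_continuousOn
        (fun ω => ((hfg ω).loss i t ht).differentiable.continuousOn)
        (fun x hx => (hf i t ht x hx).mono hle le_rfl) (hx i) (hxX i)
    have hgx : ∀ i k, Measurable fun ω => g i t ω
        (z ω i t + (b.r i * (1 / ((t : ℝ) + 1) ^ θ₃)) • (u i t ω : Vec (p i))) k := fun i k =>
      measurable_comp_of_continuousOn (F := fun ω v => g i t ω v k)
        (fun ω => ((hfg ω).constr i t ht k).differentiable.continuousOn)
        (fun x hx => (EuclideanSpace.proj (𝕜 := ℝ) k).continuous.measurable.comp
          ((hg i t ht x hx).mono hle le_rfl)) (hx i) (hxX i)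
    have hmix : ∀ k i, Measurable fun ω => (W t).mulVec (q ω k t) i := fun k i =>
      measurable_mulVec (W t) (hq' k) i
    refine ⟨fun i => ?_, fun k i => ?_⟩
    · rw [funext fun ω => (hP ω).primal i t ht]
      by_cases hΩ : Nonempty Ω
      · obtain ⟨ω₀⟩ := hΩ
        have hX := hfg ω₀
        have hs := shrink_mem hθ₃ (Nat.le_add_left 1 t)
        have hcont := continuous_proj (K := (1 - 1 / (((t + 1 : ℕ) : ℝ) + 1) ^ θ₃) • X i)
          ⟨_, Set.smul_mem_smul_set (hX.zero_mem i)⟩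
          ((hX.closed_set i).smul_of_ne_zero (by linarith [hs.2])) ((hX.convex_set i).smul _)
        refine hcont.measurable.comp ((hz' i).sub (Measurable.fun_const_smul ?_ _))
        simp only [lagrEst, gradEst]
        exact (((hfx i).const_mul _).smul (hu i)).add (Finset.measurable_sum _ fun k _ =>
          (hmix k i).smul (((hgx i k).const_mul _).smul (hu i)))
      · have := not_nonempty_iff.1 hΩ
        exact measurable_of_empty _
    · rw [funext fun ω => ((hP ω).dual k).step t ht i]
      exact (((hmix k i).const_mul _).add ((hgx i k).const_mul _)).max measurable_const

lemma integral_sum_nonpos {Ω κ : Type*} [MeasurableSpace Ω] {P : Measure Ω} {s : Finset κ}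
    {F : κ → Ω → ℝ} (h : ∀ i ∈ s, Integrable (F i) P ∧ ∫ ω, F i ω ∂P ≤ 0) :
    Integrable (fun ω => ∑ i ∈ s, F i ω) P ∧ ∫ ω, ∑ i ∈ s, F i ω ∂P ≤ 0 := by
  refine ⟨integrable_finsetSum _ fun i hi => (h i hi).1, ?_⟩
  rw [integral_finsetSum _ fun i hi => (h i hi).1]
  exact Finset.sum_nonpos fun i hi => (h i hi).2

/-- The directions of a round are independent of the past, so the expected excess is nonpositive
round by round. -/
lemma integral_totalExcess_nonpos [MeasurableSpace Ω] {P : Measure Ω} [IsProbabilityMeasure P]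
    (hn : 0 < n) (hp : ∀ i, 0 < p i)
    (hu_meas : ∀ i t, 1 ≤ t → Measurable (u i t))
    (hu_unif : ∀ i t, 1 ≤ t → P.map (u i t) = uniformSphere (p i))
    (hu_indep : iIndepFun (fun (k : Fin n × ℕ+) (ω : Ω) => u k.1 (k.2 : ℕ) ω) P)
    (hfg : ∀ ω, FunctionAssumption b X (fun i t => f i t ω) (fun i t => g i t ω))
    (hf : ∀ i t, 1 ≤ t → ∀ x ∈ X i, Measurable[past u t] fun ω => f i t ω x)
    (hg : ∀ i t, 1 ≤ t → ∀ x ∈ X i, Measurable[past u t] fun ω => g i t ω x)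
    (hP : ∀ ω, IsPlay b X W (fun i t => f i t ω) (fun i t => g i t ω)
      (fun i t => (u i t ω : Vec (p i))) θ₁ θ₂ θ₃ (z ω) (q ω)) (hθ₂ : 0 < θ₂) (hθ₃ : 0 < θ₃)
    {z1 : ∀ i, Vec (p i)} (hz1 : ∀ ω i, z ω i 1 = z1 i) {T : ℕ}
    {y : Ω → ℕ → ∀ i, Vec (p i)} (hyX : ∀ ω t i, y ω t i ∈ X i)
    (hym : ∀ t ∈ Finset.Icc 1 T, ∀ i, Measurable[past u t] fun ω => y ω t i) :
    Integrable (fun ω => totalExcess b W (fun i t => f i t ω) (fun i t => g i t ω)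
      (fun i t => (u i t ω : Vec (p i))) θ₃ (z ω) (q ω) T (y ω)) P ∧
    ∫ ω, totalExcess b W (fun i t => f i t ω) (fun i t => g i t ω)
      (fun i t => (u i t ω : Vec (p i))) θ₃ (z ω) (q ω) T (y ω) ∂P ≤ 0 := by
  have hX : FunctionAssumption b X _ _ := hfg (nonempty_of_isProbabilityMeasure P).some
  simp only [totalExcess]
  refine integral_sum_nonpos fun i _ => integral_sum_nonpos fun t ht => ?_
  have ht1 := (Finset.mem_Icc.1 ht).1
  have hs := shrink_mem hθ₃ ht1
  obtain ⟨hzm, hqm⟩ := measurable_play hfg hf hg hP hθ₃ hz1 ht1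
  have hL := integral_mul_excess_nonpos (past_le hu_meas t) (hp i) (hu_meas i t ht1)
    (hu_unif i t ht1) (indep_past hu_meas hu_indep ht1 i) (fun ω => (hfg ω).loss i t ht1)
    (hf i t ht1) (hX.r_pos i) (hX.ball_subset i) (hX.subset_ball i) hs.1 hs.2 (hX.Gf_pos i).le
    (fun ω => (hP ω).mem_shrink (hfg ω) hθ₃ i ht1) (fun ω => hyX ω t i) (hzm i) (hym t ht i)
    (φ := fun _ => 1) (C := 1) (@measurable_const _ _ _ (past u t) _) (fun _ => ⟨zero_le_one, le_rfl⟩)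
  simp only [one_mul] at hL
  have hC : Integrable (fun ω => ∑ k, (W t).mulVec (q ω k t) i *
        excess (fun v => g i t ω v k) (b.r i * (1 / ((t : ℝ) + 1) ^ θ₃)) (1 / ((t : ℝ) + 1) ^ θ₃)
          (b.Gg i * (2 * b.r i + b.R i) * (1 / ((t : ℝ) + 1) ^ θ₃)) (z ω i t) (y ω t i)
          (u i t ω)) P ∧
      ∫ ω, ∑ k, (W t).mulVec (q ω k t) i *
        excess (fun v => g i t ω v k) (b.r i * (1 / ((t : ℝ) + 1) ^ θ₃)) (1 / ((t : ℝ) + 1) ^ θ₃)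
          (b.Gg i * (2 * b.r i + b.R i) * (1 / ((t : ℝ) + 1) ^ θ₃)) (z ω i t) (y ω t i)
          (u i t ω) ∂P ≤ 0 :=
    integral_sum_nonpos fun k _ => integral_mul_excess_nonpos (past_le hu_meas t) (hp i)
      (hu_meas i t ht1) (hu_unif i t ht1) (indep_past hu_meas hu_indep ht1 i)
      (fun ω => (hfg ω).constr i t ht1 k)
      (fun x hx => (EuclideanSpace.proj (𝕜 := ℝ) k).continuous.measurable.comp (hg i t ht1 x hx))
      (hX.r_pos i) (hX.ball_subset i) (hX.subset_ball i) hs.1 hs.2 (hX.Gg_pos i).le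
      (fun ω => (hP ω).mem_shrink (hfg ω) hθ₃ i ht1) (fun ω => hyX ω t i) (hzm i) (hym t ht i)
      (@measurable_mulVec _ _ (past u t) (W t) _ (hqm k) i)
      (fun ω => ((hP ω).dual k).mixed_bounds hn hθ₂.le ht1 i)
  refine ⟨hL.1.add hC.1, ?_⟩
  rw [integral_add hL.1 hC.1]
  linarith [hL.2, hC.2]

end RandomPlay

/-! ### The pathwise bound of the violation -/

section Violation

variable {n m : ℕ} {p : Fin n → ℕ}

lemma sq_violation (g : ∀ i, ℕ → Vec (p i) → Vec m) (T : ℕ) (x : ℕ → ∀ i, Vec (p i)) :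
    violation g T x ^ 2 = ∑ k, max (∑ t ∈ Finset.Icc 1 T, ∑ i, g i t (x t i) k) 0 ^ 2 := by
  rw [violation, EuclideanSpace.real_norm_sq_eq]
  simp [posPart]

lemma C1_nonneg {b : Bounds n} {X : ∀ i, Set (Vec (p i))} {W : ℕ → Matrix (Fin n) (Fin n) ℝ}
    {f : ∀ i, ℕ → Vec (p i) → ℝ} {g : ∀ i, ℕ → Vec (p i) → Vec m} {θ₁ θ₂ θ₃ : ℝ}
    {G : ℕ → Digraph (Fin n)} {w : ℝ} {ι : ℕ}
    (hG : GraphAssumption G W w ι) (hfg : FunctionAssumption b X f g) (hn : 0 < n)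
    (h2 : 0 ≤ θ₂) (h31 : 0 ≤ 1 - θ₃) (h32 : 0 ≤ 1 - θ₁ + 2 * θ₃) :
    0 ≤ C1 m p b w ι θ₁ θ₂ θ₃ := by
  have hw := hG.w_pos
  have hC0 : 0 ≤ C0 m b w ι := le_trans (by positivity) (consensus_le_C0 m b hG hn)
  have hF := hfg.FgMax_pos hn
  refine add_nonneg (Finset.sum_nonneg fun i _ => ?_) (div_nonneg hC0 h2)
  have hr := hfg.r_pos i
  have hR := hfg.R_pos i
  have hGf := hfg.Gf_pos i
  have hGg := hfg.Gg_pos i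
  have d : 0 ≤ 1 - θ₃ + θ₂ := by linarith
  positivity

/-- The weight of the squared multipliers in `IsPlay.regret_add_le` fits into the constant `C21`. -/
lemma four_mul_multiplier_weight_le {b : Bounds n} {θ₁ θ₂ θ₃ : ℝ} (h20 : 0 ≤ θ₂)
    (h21 : θ₂ ≤ 1 / 3) (hd : 0 ≤ 1 - θ₁ + 2 * θ₃) {T : ℕ} (hT : 1 ≤ T) :
    4 * (n * (1 + 7 / 10 * ∑ t ∈ Finset.Icc 2 T, ((t : ℝ) + 1) ^ (-θ₂)))
      ≤ C21 b θ₁ θ₂ θ₃ * (T : ℝ) ^ (1 - θ₂) := by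
  have hs := sum_Icc_two_rpow_neg_le h20 (by linarith) hT
  have hA : 1 ≤ (T : ℝ) ^ (1 - θ₂) :=
    Real.one_le_rpow (by exact_mod_cast hT) (by linarith)
  have hsup : 0 ≤ ⨆ i, b.Ff i ^ 2 / (b.Fg i ^ 2 * (1 - θ₁ + 2 * θ₃)) :=
    Real.iSup_nonneg fun i => by positivity
  set A := (T : ℝ) ^ (1 - θ₂)
  set S := ∑ t ∈ Finset.Icc 2 T, ((t : ℝ) + 1) ^ (-θ₂)
  set c := 1 / (1 - θ₂) with hc
  have hc1 : 1 ≤ c := by rw [hc, le_div_iff₀ (by linarith)]; linarith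
  have hc2 : c ≤ 3 / 2 := by rw [hc, div_le_iff₀ (by linarith)]; linarith
  have hs' : S ≤ (A - 1) * c := by rw [hc, mul_one_div]; exact hs
  have key : 2 * (1 + 7 / 10 * S) ≤ (1 + c) * A := by
    nlinarith [mul_nonneg (sub_nonneg.2 hA) (show 0 ≤ 1 - 2 / 5 * c by linarith)]
  calc 4 * (n * (1 + 7 / 10 * S)) = 2 * n * (2 * (1 + 7 / 10 * S)) := by ring
    _ ≤ 2 * n * ((1 + c) * A) := by gcongr
    _ = 2 * n * (1 + 0 + c) * A := by ring
    _ ≤ _ := by rw [C21]; gcongr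

/-- The squared violation is bounded through the regret inequality against a static comparator,
with multipliers proportional to the positive parts of the accumulated constraint values. -/
lemma IsPlay.sq_violation_le {b : Bounds n} {X : ∀ i, Set (Vec (p i))}
    {W : ℕ → Matrix (Fin n) (Fin n) ℝ} {f : ∀ i, ℕ → Vec (p i) → ℝ}
    {g : ∀ i, ℕ → Vec (p i) → Vec m} {u : ∀ i, ℕ → Vec (p i)} {θ₁ θ₂ θ₃ : ℝ}
    {z : ∀ i, ℕ → Vec (p i)} {q : Fin m → ℕ → Fin n → ℝ} {G : ℕ → Digraph (Fin n)} {w : ℝ} {ι : ℕ}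
    (hG : GraphAssumption G W w ι) (hP : IsPlay b X W f g u θ₁ θ₂ θ₃ z q)
    (hfg : FunctionAssumption b X f g) (hn : 0 < n) (hm : 0 < m) (hp : ∀ i, 0 < p i)
    (hθ₁ : θ₁ ∈ Set.Ioo (0 : ℝ) 1) (hθ₂ : θ₂ ∈ Set.Ioo (0 : ℝ) (θ₁ / 3))
    (hθ₃ : θ₃ ∈ Set.Ioc θ₂ ((θ₁ - θ₂) / 2)) {T : ℕ} (hT : 1 ≤ T) {x : ℕ → ∀ i, Vec (p i)}
    (hx : ∀ t i, x t i = z i t + (b.r i * (1 / ((t : ℝ) + 1) ^ θ₃)) • u i t)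
    {y0 : ∀ i, Vec (p i)} (hy : (fun _ => y0) ∈ feasibleSeqs X g T) :
    violation g T x ^ 2 ≤ C21 b θ₁ θ₂ θ₃ * (T : ℝ) ^ (1 - θ₂) *
      ((2 * ∑ i, b.Ff i + C1 m p b w ι θ₁ θ₂ θ₃) * T
        + totalExcess b W f g u θ₃ z q T fun _ => y0) := by
  obtain ⟨h10, h11⟩ := id hθ₁
  obtain ⟨h20, h21⟩ := id hθ₂
  obtain ⟨h30, h31⟩ := id hθ₃
  have hT' : (1 : ℝ) ≤ T := by exact_mod_cast hT
  set Q := (n : ℝ) * (1 + 7 / 10 * ∑ t ∈ Finset.Icc 2 T, ((t : ℝ) + 1) ^ (-θ₂)) with hQ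
  have hQ0 : 0 < Q := by
    have h1 : (0 : ℝ) < n := by exact_mod_cast hn
    have h2 : 0 ≤ ∑ t ∈ Finset.Icc 2 T, ((t : ℝ) + 1) ^ (-θ₂) :=
      Finset.sum_nonneg fun t _ => by positivity
    positivity
  have hQle := four_mul_multiplier_weight_le (n := n) (b := b) (θ₁ := θ₁) (θ₃ := θ₃) h20.le
    (by linarith) (by linarith) hT
  rw [← hQ] at hQle
  -- this value maximizes `κ - Q * κ ^ 2`, the coefficient left for the squared violation
  set κ := 1 / (2 * Q) with hκ
  have hκ0 : 0 < κ := by positivity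
  have h := hP.regret_add_le hG hfg hn hm hp hθ₁ hθ₂ hθ₃ hT hx hy
    (c := fun k => κ * max (∑ t ∈ Finset.Icc 1 T, ∑ i, g i t (x t i) k) 0)
    (fun k => mul_nonneg hκ0.le (le_max_right _ _))
  have hpos : ∀ s : ℝ, max s 0 * s = max s 0 ^ 2 := by
    intro s
    rcases le_total s 0 with hs | hs
    · simp [hs]
    · rw [max_eq_left hs, sq]
  have e0 : pathLength T (fun _ => y0) = 0 := by simp [pathLength]
  simp only [mul_assoc κ, hpos, mul_pow, ← Finset.mul_sum, ← sq_violation, ← hQ, e0, mul_zero,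
    add_zero] at h
  set v := violation g T x
  have hreg : -(2 * (∑ i, b.Ff i) * T) ≤ regret f T x fun _ => y0 := by
    have hf : ∀ t ∈ Finset.Icc 1 T, ∀ i, f i t (y0 i) - f i t (x t i) ≤ 2 * b.Ff i := by
      intro t ht i
      have ht1 := (Finset.mem_Icc.1 ht).1
      have h1 := (hfg.loss i t ht1).bounded (x t i) (by
        rw [hx]; exact hP.decision_mem hfg (h20.trans h30) i ht1)
      have h2 := (hfg.loss i t ht1).bounded (y0 i) ((hy t ht).1 i)
      linarith [abs_le.1 h1, abs_le.1 h2]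
    have h3 := Finset.sum_le_sum fun t ht =>
      Finset.sum_le_sum fun i (_ : i ∈ Finset.univ) => hf t ht i
    simp only [Finset.sum_sub_distrib, Finset.sum_const, Nat.card_Icc, add_tsub_cancel_right,
      nsmul_eq_mul, ← Finset.mul_sum] at h3
    simp only [regret]
    linarith
  have hC1 := C1_nonneg (p := p) (θ₁ := θ₁) hG hfg hn h20.le (by linarith : 0 ≤ 1 - θ₃)
    (by linarith)
  have hpow : (T : ℝ) ^ (max θ₁ (max (1 - θ₁ + 2 * θ₃) (1 - θ₃ + θ₂))) ≤ T := by
    conv_rhs => rw [← Real.rpow_one (T : ℝ)]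
    exact Real.rpow_le_rpow_of_exponent_le hT'
      (max_le h11.le (max_le (by linarith) (by linarith)))
  have hC1T := mul_le_mul_of_nonneg_left hpow hC1
  set B := (2 * ∑ i, b.Ff i + C1 m p b w ι θ₁ θ₂ θ₃) * T
        + totalExcess b W f g u θ₃ z q T fun _ => y0 with hB
  have hv : v ^ 2 / (4 * Q) ≤ B := by
    have e1 : κ * v ^ 2 - Q * (κ ^ 2 * v ^ 2) = v ^ 2 / (4 * Q) := by
      rw [hκ]; field_simp; ring
    rw [hB]
    linarith
  have hB0 : 0 ≤ B := le_trans (by positivity) hv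
  rw [div_le_iff₀ (by positivity), mul_comm] at hv
  exact hv.trans (by gcongr)

end Violation

/-! ### Integrability -/

section Expectation

variable {Ω : Type*} [MeasurableSpace Ω] {P : Measure Ω} [IsProbabilityMeasure P]

lemma integrable_comp_of_niceOn {p : ℕ} {X : Set (Vec p)} {h : Ω → Vec p → ℝ} {F G : ℝ}
    (hh : ∀ ω, NiceOn X (h ω) F G) (hm : ∀ x ∈ X, Measurable fun ω => h ω x) {ζ : Ω → Vec p}
    (hζ : Measurable ζ) (hX : ∀ ω, ζ ω ∈ X) : Integrable (fun ω => h ω (ζ ω)) P :=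
  Integrable.of_bound (measurable_comp_of_continuousOn
    (fun ω => (hh ω).differentiable.continuousOn) hm hζ hX).aestronglyMeasurable F
    (Filter.Eventually.of_forall fun ω => (hh ω).bounded _ (hX ω))

/-- A special case of Jensen's inequality, from `2 * s * v ≤ v ^ 2 + s ^ 2`. -/
lemma integral_le_of_integral_sq_le {v : Ω → ℝ} (hv : Integrable v P)
    (hv2 : Integrable (fun ω => v ω ^ 2) P) {s : ℝ} (hs : 0 < s)
    (h : ∫ ω, v ω ^ 2 ∂P ≤ s ^ 2) : ∫ ω, v ω ∂P ≤ s := by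
  have h1 : 2 * s * ∫ ω, v ω ∂P ≤ ∫ ω, v ω ^ 2 ∂P + s ^ 2 := by
    rw [← integral_const_mul]
    calc ∫ ω, 2 * s * v ω ∂P ≤ ∫ ω, (v ω ^ 2 + s ^ 2) ∂P :=
          integral_mono (hv.const_mul _) (hv2.add (integrable_const _)) fun ω => by
            dsimp only
            linarith [two_mul_le_add_sq (v ω) s]
      _ = _ := by
          rw [integral_add hv2 (integrable_const _)]
          simp
  nlinarith

variable {n m : ℕ} {p : Fin n → ℕ} {b : Bounds n} {X : ∀ i, Set (Vec (p i))}
  {f : ∀ i, ℕ → Ω → Vec (p i) → ℝ} {g : ∀ i, ℕ → Ω → Vec (p i) → Vec m} {T : ℕ}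
  {x y : Ω → ℕ → ∀ i, Vec (p i)}

lemma integrable_regret
    (hfg : ∀ ω, FunctionAssumption b X (fun i t => f i t ω) (fun i t => g i t ω))
    (hf : ∀ i t, 1 ≤ t → ∀ v ∈ X i, Measurable fun ω => f i t ω v)
    (hxm : ∀ t ∈ Finset.Icc 1 T, ∀ i, Measurable fun ω => x ω t i)
    (hxX : ∀ t ∈ Finset.Icc 1 T, ∀ i ω, x ω t i ∈ X i)
    (hym : ∀ t ∈ Finset.Icc 1 T, ∀ i, Measurable fun ω => y ω t i)
    (hyX : ∀ t ∈ Finset.Icc 1 T, ∀ i ω, y ω t i ∈ X i) :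
    Integrable (fun ω => regret (fun i t => f i t ω) T (x ω) (y ω)) P := by
  have h : ∀ ζ : Ω → ℕ → ∀ i, Vec (p i),
      (∀ t ∈ Finset.Icc 1 T, ∀ i, Measurable fun ω => ζ ω t i) →
      (∀ t ∈ Finset.Icc 1 T, ∀ i ω, ζ ω t i ∈ X i) →
      Integrable (fun ω => ∑ t ∈ Finset.Icc 1 T, ∑ i, f i t ω (ζ ω t i)) P :=
    fun ζ hm hX => integrable_finsetSum _ fun t ht => integrable_finsetSum _ fun i _ =>
      have ht1 := (Finset.mem_Icc.1 ht).1
      integrable_comp_of_niceOn (fun ω => (hfg ω).loss i t ht1) (hf i t ht1) (hm t ht i) (hX t ht i)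
  exact (h x hxm hxX).sub (h y hym hyX)

lemma integrable_pathLength (hX : ∀ i, X i ⊆ Metric.closedBall 0 (b.R i))
    (hym : ∀ t ∈ Finset.Icc 1 T, ∀ i, Measurable fun ω => y ω t i)
    (hyX : ∀ t ∈ Finset.Icc 1 T, ∀ i ω, y ω t i ∈ X i) :
    Integrable (fun ω => pathLength T (y ω)) P := by
  refine integrable_finsetSum _ fun t ht => integrable_finsetSum _ fun i _ => ?_
  obtain ⟨h1, h2⟩ := Finset.mem_Icc.1 ht
  have hint : ∀ s ∈ Finset.Icc 1 T, Integrable (fun ω => y ω s i) P := fun s hs =>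
    Integrable.of_bound (hym s hs i).aestronglyMeasurable (b.R i)
      (Filter.Eventually.of_forall fun ω => by simpa using hX i (hyX s hs i ω))
  exact ((hint (t + 1) (Finset.mem_Icc.2 ⟨by omega, by omega⟩)).sub
    (hint t (Finset.mem_Icc.2 ⟨by omega, by omega⟩))).norm

lemma integrable_violation
    (hfg : ∀ ω, FunctionAssumption b X (fun i t => f i t ω) (fun i t => g i t ω))
    (hg : ∀ i t, 1 ≤ t → ∀ v ∈ X i, Measurable fun ω => g i t ω v)
    (hxm : ∀ t ∈ Finset.Icc 1 T, ∀ i, Measurable fun ω => x ω t i)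
    (hxX : ∀ t ∈ Finset.Icc 1 T, ∀ i ω, x ω t i ∈ X i) :
    Integrable (fun ω => violation (fun i t => g i t ω) T (x ω)) P ∧
      Integrable (fun ω => violation (fun i t => g i t ω) T (x ω) ^ 2) P := by
  have hmeas : ∀ k, Measurable fun ω => ∑ t ∈ Finset.Icc 1 T, ∑ i, g i t ω (x ω t i) k :=
    fun k => Finset.measurable_sum _ fun t ht => Finset.measurable_sum _ fun i _ =>
      have ht1 := (Finset.mem_Icc.1 ht).1
      measurable_comp_of_continuousOn (F := fun ω v => g i t ω v k)
        (fun ω => ((hfg ω).constr i t ht1 k).differentiable.continuousOn)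
        (fun v hv => (EuclideanSpace.proj (𝕜 := ℝ) k).continuous.measurable.comp
          (hg i t ht1 v hv)) (hxm t ht i) (hxX t ht i)
  have hbound : ∀ ω k, |max (∑ t ∈ Finset.Icc 1 T, ∑ i, g i t ω (x ω t i) k) 0|
      ≤ ∑ t ∈ Finset.Icc 1 T, ∑ i, b.Fg i := by
    intro ω k
    refine (abs_max_le_max_abs_abs).trans ?_
    rw [abs_zero, max_eq_left (abs_nonneg _)]
    refine (Finset.abs_sum_le_sum_abs _ _).trans (Finset.sum_le_sum fun t ht =>
      (Finset.abs_sum_le_sum_abs _ _).trans (Finset.sum_le_sum fun i _ => ?_))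
    exact ((hfg ω).constr i t (Finset.mem_Icc.1 ht).1 k).bounded _ (hxX t ht i ω)
  have hsqm : Measurable fun ω => violation (fun i t => g i t ω) T (x ω) ^ 2 := by
    simp only [sq_violation]
    exact Finset.measurable_sum _ fun k _ => ((hmeas k).max measurable_const).pow_const 2
  have hsqb : ∀ ω, violation (fun i t => g i t ω) T (x ω) ^ 2
      ≤ ∑ _k : Fin m, (∑ t ∈ Finset.Icc 1 T, ∑ i, b.Fg i) ^ 2 := by
    intro ω
    rw [sq_violation]
    refine Finset.sum_le_sum fun k _ => ?_
    rw [← sq_abs]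
    gcongr
    exact hbound ω k
  have hv0 : ∀ ω, 0 ≤ violation (fun i t => g i t ω) T (x ω) := fun ω => norm_nonneg _
  have hv : ∀ ω, violation (fun i t => g i t ω) T (x ω)
      = √(violation (fun i t => g i t ω) T (x ω) ^ 2) := fun ω => (Real.sqrt_sq (hv0 ω)).symm
  refine ⟨?_, Integrable.of_bound hsqm.aestronglyMeasurable _
    (Filter.Eventually.of_forall fun ω => by
      rw [Real.norm_of_nonneg (sq_nonneg _)]
      exact hsqb ω)⟩
  rw [funext hv]
  exact Integrable.of_bound hsqm.sqrt.aestronglyMeasurable _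
    (Filter.Eventually.of_forall fun ω => by
      rw [Real.norm_of_nonneg (Real.sqrt_nonneg _)]
      exact Real.sqrt_le_sqrt (hsqb ω))

end Expectation

end BanditOCO

/-! ### The bounds in expectation -/

theorem theorem1 {Ω : Type*} [MeasurableSpace Ω] (P : Measure Ω) [IsProbabilityMeasure P]
    (n m : ℕ) (p : Fin n → ℕ) (hn : 0 < n) (hm : 0 < m) (hp : ∀ i, 0 < p i)
    -- communication graphs and mixing matrices
    (G : ℕ → Digraph (Fin n)) (W : ℕ → Matrix (Fin n) (Fin n) ℝ) (w : ℝ) (ι : ℕ)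
    (hG : BanditOCO.GraphAssumption G W w ι)
    -- i.i.d. uniform random directions `u_{i,t}`, `t ≥ 1`
    (u : ∀ i, ℕ → Ω → BanditOCO.USphere (p i))
    (hu_meas : ∀ i t, 1 ≤ t → Measurable (u i t))
    (hu_unif : ∀ i t, 1 ≤ t → P.map (u i t) = BanditOCO.uniformSphere (p i))
    (hu_indep : iIndepFun (fun (k : Fin n × ℕ+) (ω : Ω) => u k.1 (k.2 : ℕ) ω) P)
    -- decision sets, loss and constraint functions; the functions of round `t` may be chosen by
    -- the adversary depending on what happened in the rounds before `t`
    (b : BanditOCO.Bounds n) (X : ∀ i, Set (BanditOCO.Vec (p i)))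
    (f : ∀ i, ℕ → Ω → BanditOCO.Vec (p i) → ℝ)
    (g : ∀ i, ℕ → Ω → BanditOCO.Vec (p i) → BanditOCO.Vec m)
    (hfg : ∀ ω, BanditOCO.FunctionAssumption b X (fun i t => f i t ω) (fun i t => g i t ω))
    (hf_past : ∀ i t, 1 ≤ t → ∀ x ∈ X i,
      Measurable[BanditOCO.past u t] (fun ω => f i t ω x))
    (hg_past : ∀ i t, 1 ≤ t → ∀ x ∈ X i,
      Measurable[BanditOCO.past u t] (fun ω => g i t ω x))
    -- exponents
    (θ₁ θ₂ θ₃ : ℝ) (hθ₁ : θ₁ ∈ Set.Ioo (0 : ℝ) 1) (hθ₂ : θ₂ ∈ Set.Ioo (0 : ℝ) (θ₁ / 3))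
    (hθ₃ : θ₃ ∈ Set.Ioc θ₂ ((θ₁ - θ₂) / 2))
    -- initialization, and the decisions generated by the algorithm
    (z1 : ∀ i, BanditOCO.Vec (p i))
    (hz1 : ∀ i, z1 i ∈ (1 - (BanditOCO.params m p b θ₁ θ₂ θ₃).ξ i 1) • X i)
    (x : Ω → ℕ → ∀ i, BanditOCO.Vec (p i))
    (hx : ∀ ω, x ω = BanditOCO.decision (BanditOCO.params m p b θ₁ θ₂ θ₃) X W
      (fun i t => f i t ω) (fun i t => g i t ω) (fun i t => (u i t ω : BanditOCO.Vec (p i))) z1)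
    -- horizon, and the standing assumption that a static feasible decision exists
    (T : ℕ) (hT : 1 ≤ T)
    (hfeas : ∃ y0 : ∀ i, BanditOCO.Vec (p i),
      ∀ᵐ ω ∂P, (fun _ => y0) ∈ BanditOCO.feasibleSeqs X (fun i t => g i t ω) T) :
    (∀ y : Ω → ℕ → ∀ i, BanditOCO.Vec (p i),
      (∀ t ∈ Finset.Icc 1 T, ∀ i, Measurable[BanditOCO.past u t] (fun ω => y ω t i)) →
      (∀ᵐ ω ∂P, y ω ∈ BanditOCO.feasibleSeqs X (fun i t => g i t ω) T) →
      Integrable (fun ω => BanditOCO.regret (fun i t => f i t ω) T (x ω) (y ω)) P ∧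
      Integrable (fun ω => BanditOCO.pathLength T (y ω)) P ∧
      ∫ ω, BanditOCO.regret (fun i t => f i t ω) T (x ω) (y ω) ∂P ≤
        BanditOCO.C1 m p b w ι θ₁ θ₂ θ₃
            * (T : ℝ) ^ (max θ₁ (max (1 - θ₁ + 2 * θ₃) (1 - θ₃ + θ₂)))
          + BanditOCO.pathCoeff m p b * (T : ℝ) ^ θ₁
            * ∫ ω, BanditOCO.pathLength T (y ω) ∂P) ∧
    (Integrable (fun ω => BanditOCO.violation (fun i t => g i t ω) T (x ω)) P ∧
      ∫ ω, BanditOCO.violation (fun i t => g i t ω) T (x ω) ∂P ≤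
        √(BanditOCO.C2 m p b w ι θ₁ θ₂ θ₃) * (T : ℝ) ^ (1 - θ₂ / 2)) := by
  obtain ⟨h10, h11⟩ := id hθ₁
  obtain ⟨h20, h21⟩ := id hθ₂
  obtain ⟨h30, h31⟩ := id hθ₃
  have hθ₃' : 0 < θ₃ := h20.trans h30
  have hX : BanditOCO.FunctionAssumption b X _ _ := hfg (nonempty_of_isProbabilityMeasure P).some
  set z : Ω → ∀ i, ℕ → BanditOCO.Vec (p i) := fun ω i t =>
    (BanditOCO.run (BanditOCO.params m p b θ₁ θ₂ θ₃) X W (fun i t => f i t ω)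
      (fun i t => g i t ω) (fun i t => (u i t ω : BanditOCO.Vec (p i))) z1 t).z i
  set q : Ω → Fin m → ℕ → Fin n → ℝ := fun ω k t i =>
    (BanditOCO.run (BanditOCO.params m p b θ₁ θ₂ θ₃) X W (fun i t => f i t ω)
      (fun i t => g i t ω) (fun i t => (u i t ω : BanditOCO.Vec (p i))) z1 t).q i k
  have hP : ∀ ω, BanditOCO.IsPlay b X W (fun i t => f i t ω) (fun i t => g i t ω)
      (fun i t => (u i t ω : BanditOCO.Vec (p i))) θ₁ θ₂ θ₃ (z ω) (q ω) := fun ω =>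
    BanditOCO.isPlay_run hG (hfg ω) (fun i t => by simp) hθ₃' hz1
  have hxz : ∀ ω t i, x ω t i = z ω i t
      + (b.r i * (1 / ((t : ℝ) + 1) ^ θ₃)) • (u i t ω : BanditOCO.Vec (p i)) := by
    intro ω t i
    rw [hx, mul_one_div]
    rfl
  have hzm : ∀ t, 1 ≤ t → _ := fun t ht =>
    BanditOCO.measurable_play hfg hf_past hg_past hP hθ₃' (fun ω i => rfl) ht
  have hxm : ∀ t ∈ Finset.Icc 1 T, ∀ i, Measurable fun ω => x ω t i := by
    intro t ht i
    have ht1 := (Finset.mem_Icc.1 ht).1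
    have h1 := ((hzm t ht1).1 i).mono (BanditOCO.past_le hu_meas t) le_rfl
    have h2 := hu_meas i t ht1
    simp only [hxz]
    fun_prop
  have hxX : ∀ t ∈ Finset.Icc 1 T, ∀ i ω, x ω t i ∈ X i := by
    intro t ht i ω
    rw [hxz]
    exact (hP ω).decision_mem (hfg ω) hθ₃' i (Finset.mem_Icc.1 ht).1
  have hf_meas : ∀ i t, 1 ≤ t → ∀ v ∈ X i, Measurable fun ω => f i t ω v := fun i t ht v hv =>
    (hf_past i t ht v hv).mono (BanditOCO.past_le hu_meas t) le_rfl
  have hg_meas : ∀ i t, 1 ≤ t → ∀ v ∈ X i, Measurable fun ω => g i t ω v := fun i t ht v hv =>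
    (hg_past i t ht v hv).mono (BanditOCO.past_le hu_meas t) le_rfl
  have hexcess : ∀ y : Ω → ℕ → ∀ i, BanditOCO.Vec (p i), (∀ ω t i, y ω t i ∈ X i) →
      (∀ t ∈ Finset.Icc 1 T, ∀ i, Measurable[BanditOCO.past u t] fun ω => y ω t i) → _ :=
    fun y hyX hym => BanditOCO.integral_totalExcess_nonpos hn hp hu_meas hu_unif hu_indep hfg
      hf_past hg_past hP h20 hθ₃' (fun ω i => rfl) hyX hym
  constructor
  · intro y hym hy
    -- outside of a null set, the comparator agrees with a sequence that never leaves `X`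
    set y' : Ω → ℕ → ∀ i, BanditOCO.Vec (p i) := fun ω t i =>
      (X i).indicator id (y ω t i) with hy'
    have hy'X : ∀ ω t i, y' ω t i ∈ X i := by
      intro ω t i
      by_cases h : y ω t i ∈ X i
      · simpa only [hy', Set.indicator_of_mem h, id_eq] using h
      · simpa only [hy', Set.indicator_of_notMem h] using hX.zero_mem i
    have hy'm : ∀ t ∈ Finset.Icc 1 T, ∀ i, Measurable[BanditOCO.past u t] fun ω => y' ω t i :=
      fun t ht i => (measurable_id.indicator (hX.closed_set i).measurableSet).comp (hym t ht i)
    have hy'm' : ∀ t ∈ Finset.Icc 1 T, ∀ i, Measurable fun ω => y' ω t i := fun t ht i =>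
      (hy'm t ht i).mono (BanditOCO.past_le hu_meas t) le_rfl
    have heq : ∀ᵐ ω ∂P, ∀ t ∈ Finset.Icc 1 T, y' ω t = y ω t := by
      filter_upwards [hy] with ω hω t ht
      funext i
      simp only [hy', Set.indicator_of_mem ((hω t ht).1 i), id_eq]
    have hreg : (fun ω => BanditOCO.regret (fun i t => f i t ω) T (x ω) (y' ω))
        =ᵐ[P] fun ω => BanditOCO.regret (fun i t => f i t ω) T (x ω) (y ω) := by
      filter_upwards [heq] with ω hω
      simp only [BanditOCO.regret]
      congr 1
      exact Finset.sum_congr rfl fun t ht => by rw [hω t ht]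
    have hpath : (fun ω => BanditOCO.pathLength T (y' ω))
        =ᵐ[P] fun ω => BanditOCO.pathLength T (y ω) := by
      filter_upwards [heq] with ω hω
      refine Finset.sum_congr rfl fun t ht => ?_
      obtain ⟨ht1, ht2⟩ := Finset.mem_Icc.1 ht
      rw [hω t (Finset.mem_Icc.2 ⟨by omega, by omega⟩),
        hω (t + 1) (Finset.mem_Icc.2 ⟨by omega, by omega⟩)]
    have hregint : Integrable (fun ω => BanditOCO.regret (fun i t => f i t ω) T (x ω) (y' ω)) P :=
      BanditOCO.integrable_regret hfg hf_meas hxm hxX hy'm' fun t _ i ω => hy'X ω t i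
    have hpathint : Integrable (fun ω => BanditOCO.pathLength T (y' ω)) P :=
      BanditOCO.integrable_pathLength hX.subset_ball hy'm' fun t _ i ω => hy'X ω t i
    refine ⟨hregint.congr hreg, hpathint.congr hpath, ?_⟩
    rw [← integral_congr_ae hreg, ← integral_congr_ae hpath]
    obtain ⟨hTEint, hTE⟩ := hexcess y' hy'X hy'm
    have hle : ∀ᵐ ω ∂P, BanditOCO.regret (fun i t => f i t ω) T (x ω) (y' ω)
        ≤ BanditOCO.totalExcess b W (fun i t => f i t ω) (fun i t => g i t ω)
            (fun i t => (u i t ω : BanditOCO.Vec (p i))) θ₃ (z ω) (q ω) T (y' ω)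
          + BanditOCO.C1 m p b w ι θ₁ θ₂ θ₃
            * (T : ℝ) ^ (max θ₁ (max (1 - θ₁ + 2 * θ₃) (1 - θ₃ + θ₂)))
          + BanditOCO.pathCoeff m p b * (T : ℝ) ^ θ₁ * BanditOCO.pathLength T (y' ω) := by
      filter_upwards [hy, heq] with ω hω hω'
      have hfeas' : y' ω ∈ BanditOCO.feasibleSeqs X (fun i t => g i t ω) T := by
        intro t ht
        rw [hω' t ht]
        exact hω t ht
      have h := (hP ω).regret_add_le hG (hfg ω) hn hm hp hθ₁ hθ₂ hθ₃ hT (hxz ω) hfeas'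
        (c := fun _ => 0) fun _ => le_rfl
      simpa using h
    refine (integral_mono_ae hregint ((hTEint.add (integrable_const _)).add
      (hpathint.const_mul _)) hle).trans ?_
    rw [integral_add' (hTEint.add (integrable_const _)) (hpathint.const_mul _),
      integral_add' hTEint (integrable_const _)]
    simp only [integral_const_mul, integral_const, probReal_univ, one_smul]
    linarith
  · obtain ⟨y0, hy0⟩ := hfeas
    have hy0X : ∀ i, y0 i ∈ X i := by
      obtain ⟨ω, hω⟩ := hy0.exists
      exact (hω 1 (Finset.mem_Icc.2 ⟨le_rfl, hT⟩)).1
    obtain ⟨hTEint, hTE⟩ := hexcess (fun _ _ => y0) (fun _ _ i => hy0X i) fun t _ i =>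
      @measurable_const _ _ _ (BanditOCO.past u t) _
    obtain ⟨hvint, hv2int⟩ := BanditOCO.integrable_violation (P := P) hfg hg_meas hxm hxX
    refine ⟨hvint, ?_⟩
    have hT0 : (0 : ℝ) < T := by exact_mod_cast hT
    have hd : 0 ≤ 1 - θ₁ + 2 * θ₃ := by linarith
    have hC1 := BanditOCO.C1_nonneg (p := p) (θ₁ := θ₁) hG hX hn h20.le
      (by linarith : 0 ≤ 1 - θ₃) hd
    have hFf : 0 < ∑ i, b.Ff i :=
      Finset.sum_pos (fun i _ => hX.Ff_pos i) ⟨⟨0, hn⟩, Finset.mem_univ _⟩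
    have hC21 : 0 < BanditOCO.C21 b θ₁ θ₂ θ₃ := by
      have h1 : 0 ≤ ⨆ i, b.Ff i ^ 2 / (b.Fg i ^ 2 * (1 - θ₁ + 2 * θ₃)) :=
        Real.iSup_nonneg fun i => by positivity
      have h2 : (0 : ℝ) < n := by exact_mod_cast hn
      have h3 : 0 < 1 - θ₂ := by linarith
      rw [BanditOCO.C21]
      positivity
    have hC2 : 0 < BanditOCO.C2 m p b w ι θ₁ θ₂ θ₃ := by
      rw [BanditOCO.C2]
      positivity
    refine BanditOCO.integral_le_of_integral_sq_le hvint hv2int (by positivity) ?_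
    rw [mul_pow, Real.sq_sqrt hC2.le]
    have hpow : ((T : ℝ) ^ (1 - θ₂ / 2)) ^ 2 = (T : ℝ) ^ (1 - θ₂) * T := by
      rw [← Real.rpow_natCast, ← Real.rpow_mul hT0.le, ← Real.rpow_add_one hT0.ne']
      congr 1
      push_cast
      ring
    rw [hpow]
    have hle := integral_mono_ae hv2int (((integrable_const _).add hTEint).const_mul
      (BanditOCO.C21 b θ₁ θ₂ θ₃ * (T : ℝ) ^ (1 - θ₂))) (hy0.mono fun ω hω =>
      (hP ω).sq_violation_le hG (hfg ω) hn hm hp hθ₁ hθ₂ hθ₃ hT (hxz ω) hω)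
    refine hle.trans ?_
    simp only [Pi.add_apply]
    rw [integral_const_mul, integral_add (integrable_const _) hTEint]
    simp only [integral_const, probReal_univ, one_smul]
    calc _ ≤ BanditOCO.C21 b θ₁ θ₂ θ₃ * (T : ℝ) ^ (1 - θ₂) *
          ((2 * ∑ i, b.Ff i + BanditOCO.C1 m p b w ι θ₁ θ₂ θ₃) * T) := by
          gcongr
          linarith
      _ = _ := by
          rw [BanditOCO.C2]
          ring
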